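/- Let $n,m\ge 1$ be integers and $$M_{n,m}=D_x^2+(x^{2n+1}D_y)^2+(x^ny^mD_y)^2,\qquad D=\tfrac1i\partial .$$ Put $\theta=\frac{2m}{2m-1}$, $\gamma=\frac{m}{(n+1)(2m-1)}$, $\alpha=-\frac1{2n+2}$, $r=-\frac{4m-1}{2(2m-1)}+\frac{(2n+1)\gamma}{2}$, $E_k=4k(n+1)+2n+1$, $c_{[k]}=\theta E_k^{1/2m}$, $\lambda_j=e^{i\pi(1+2j)/2m}$, and let $$v_k(t)=e^{-\frac{t^{2n+2}}{2n+2}}L_k^{(\alpha)}\!\Big(\tfrac{t^{2n+2}}{n+1}\Big),\qquad -v_k''+t^{2(2n+1)}v_k=E_kt^{2n}v_k ,$$ where $L_k^{(\alpha)}$ is the generalized Laguerre polynomial. The function $t\,\partial_tv_k$ is a linear combination of $v_{k-1},v_k,v_{k+1}$, namely $tv_k'=(n+1)\big((k+1)v_{k+1}-(1+\alpha)v_k-(k+\alpha)v_{k-1}\big)$ (with $v_{-1}=0$). Let $P^{q}_{p,i}$ ($0\le i\le p$) be the polynomials with $$[\rho^{-\theta}(1-\theta+\rho\partial_\rho)]^p\rho^q[t^{2n}u(t,\rho)]_{t=\rho^\gamma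 x}=\rho^{q+p-\theta p}\Big[t^{2n}\sum_{i=0}^p\rho^{-i}P^q_{p,i}(t\partial_t)\partial_\rho^{p-i}u\Big]_{t=\rho^\gamma x},$$ and for $1\le i\le 2m$ put $\mathscr P_i=P^{\,r+2\theta-2n\gamma}_{2m,i}-m\theta P^{\,r+\theta-2n\gamma}_{2m-1,i-1}$. For a finite sum $w=\sum_p a_p(\rho)v_p(t)$ let $(\mathscr P_iw)_p$ be the coefficient of $v_p$ in $\mathscr P_i(t\partial_t)\partial_\rho^{2m-i}w$. Cutoffs $\chi_\ell$. For $R_1>0$, an $R_1$-family is a sequence of functions $\chi_\ell\in C^\infty(\mathbb R;\mathbb R)$, $\ell\ge0$, with $\chi_\ell=0$ for $\rho<2R_1(\ell+1)$, $\chi_\ell=1$ for $\rho>4R_1(\ell+1)$, and $|\chi_\ell^{(k)}|\le C_\chi$ for $k\le 2m$ with $C_\chi$ independent of $\ell$. Functions $u_\ell$. Let $$G_k(\rho)=\frac1{2\pi}\int_{\mathbb R}e^{i\rho s}\frac{(-1)^m}{s^{2m}+c_{[k]}^{2m}}\,ds=\frac{(-1)^m}{2mi\,c_{[k]}^{2m-1}}\sum_{j=0}^{m-1}\lambda_je^{ic_{[k]}\lambda_j|\rho|},$$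 the decaying fundamental solution of $\partial_\rho^{2m}+(i\theta)^{2m}E_k$. Given an $R_1$-family $\chi_\ell$, put $u_\ell(t,\rho)=\sum_{p=0}^\ell g_{\ell,p}(\rho)v_p(t)$, where $g_{0,0}=e^{-c_1\rho}$ with $c_1=\theta(2n+1)^{1/2m}\big(\sin\frac{\pi}{2m}-i\cos\frac{\pi}{2m}\big)$, and recursively, for $\ell\ge1$, $$g_{\ell,p}=G_p*(\chi_\ell f_{\ell,p})\quad(1\le p\le\ell),\qquad g_{\ell,0}=G_0*(\chi_\ell f_{\ell,0})-\sum_{j\in\{0,m-1\}}h_j,$$ $$f_{\ell,p}=-\sum_{i=1}^{\min\{\ell,2m\}}\rho^{-i}(\mathscr P_iu_{\ell-i})_p,\qquad f_{\ell,0}=-\rho^{-1}\big(\mathscr P_1(u_\ell-g_{\ell,0}v_0)\big)_0-\sum_{i=2}^{\min\{\ell+1,2m\}}\rho^{-i}(\mathscr P_iu_{\ell+1-i})_0,$$ $$h_j(\rho)=\frac{(-1)^m}{2mi\,c_{[0]}^{2m-1}}\lambda_je^{ic_{[0]}\lambda_j\rho}\int_{\mathbb R}e^{-ic_{[0]}\lambda_j\tau}\chi_\ell(\tau)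 f_{\ell,0}(\tau)\,d\tau$$ (for $m=1$ there is a single function $h_0=h_{m-1}$, subtracted once). Cutoffs $\omega_\ell$. For $\sigma>1$ and $R>0$, a $(\sigma,R)$-family of Gevrey cutoffs is a sequence $\omega_\ell\in G^\sigma(\mathbb R)$, $\ell\ge0$, $0\le\omega_\ell\le1$, with $\omega_\ell(\rho)=0$ for $|\rho|\le2R(\ell+1)$, $\omega_\ell(\rho)=1$ for $|\rho|\ge4R(\ell+1)$, for which there is a constant $C_\omega>0$, independent of $\ell,k,\rho$, such that $|\omega_\ell^{(k)}|\le C_\omega^{k+1}R^{-k}$ for $k\le3\ell$ and $|\omega_\ell^{(k)}(\rho)|\le(RC_\omega)^{k+1}k!^\sigma|\rho|^{-k}$ for all $k$ (and $\rho\neq0$). Put $$\tilde u(t,\rho)=\sum_{\ell\ge0}u_\ell(t,\rho)\,\omega_\ell(\rho),\qquad \mathscr K[\tilde u](x,y)=\int_0^{+\infty}e^{iy\rho^{\theta}}\rho^{r}\,\tilde u(\rho^\gamma x,\rho)\,d\rho .$$ **Proposition.** There is $R_1^0>0$ such that for every $R_1\ge R_1^0$ and every $R_1$-family $(\chi_\ell)$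 there is $R_0>0$ such that for all $R\ge R_0$, all $\sigma>1$ and every $(\sigma,R)$-family $(\omega_\ell)$ of Gevrey cutoffs: the integral defining $\mathscr K[\tilde u](x,y)$ converges absolutely for all $(x,y)\in\mathbb R^2$, $\mathscr K[\tilde u]\in C^\infty(\mathbb R^2)$, and $f=M_{n,m}\mathscr K[\tilde u]$ belongs to the global Beurling class $\gamma_g^{2m/(2m-1)}(\mathbb R^2)$, i.e. $f\in C^\infty(\mathbb R^2)$ and for every $\varepsilon>0$ there is $C_\varepsilon$ with $$|\partial_x^a\partial_y^bf(x,y)|\le C_\varepsilon\,\varepsilon^{a+b}(a+b)^{\frac{2m}{2m-1}(a+b)}\qquad\text{for all }a,b\ge0,\ (x,y)\in\mathbb R^2 .$$ -/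

import Mathlib

namespace MetivierGen

noncomputable section

/-! ### The operator `M_{n,m}` and the global Beurling class on the plane -/

/-- `D_x = -i ∂_x`. -/
def Dx (f : ℝ → ℝ → ℂ) : ℝ → ℝ → ℂ :=
  fun x y => -Complex.I * deriv (fun x' => f x' y) x

/-- `D_y = -i ∂_y`. -/
def Dy (f : ℝ → ℝ → ℂ) : ℝ → ℝ → ℂ :=
  fun x y => -Complex.I * deriv (fun y' => f x y') y

/-- The vector field `x^(2n+1) D_y`. -/
def X₂ (n : ℕ) (f : ℝ → ℝ → ℂ) : ℝ → ℝ → ℂ :=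
  fun x y => ((x ^ (2 * n + 1) : ℝ) : ℂ) * Dy f x y

/-- The vector field `x^n y^m D_y`. -/
def X₃ (n m : ℕ) (f : ℝ → ℝ → ℂ) : ℝ → ℝ → ℂ :=
  fun x y => ((x ^ n * y ^ m : ℝ) : ℂ) * Dy f x y

/-- `M_{n,m} = D_x^2 + (x^(2n+1) D_y)^2 + (x^n y^m D_y)^2`. -/
def opM (n m : ℕ) (f : ℝ → ℝ → ℂ) : ℝ → ℝ → ℂ :=
  fun x y => Dx (Dx f) x y + X₂ n (X₂ n f) x y + X₃ n m (X₃ n m f) x y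

/-- `f`, as a function of two real variables, is of class `C^∞`. -/
def IsSmooth (f : ℝ → ℝ → ℂ) : Prop :=
  ContDiff ℝ ((⊤ : ℕ∞) : WithTop ℕ∞) (fun z : ℝ × ℝ => f z.1 z.2)

/-- The mixed partial derivative `∂_x^a ∂_y^b f`. -/
def mixedDeriv (a b : ℕ) (f : ℝ → ℝ → ℂ) : ℝ → ℝ → ℂ :=
  fun x y => iteratedDeriv a (fun x' => iteratedDeriv b (fun y' => f x' y') y) x

/-- The global Beurling class `γ_g^s(ℝ²)`: smooth functions such that for every `ε > 0` there is
`C` with `|∂_x^a ∂_y^b f| ≤ C ε^(a+b) (a+b)^(s(a+b))` on all of `ℝ²`, for all `a`, `b`. -/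
def GlobalBeurling (s : ℝ) (f : ℝ → ℝ → ℂ) : Prop :=
  IsSmooth f ∧ ∀ ε : ℝ, 0 < ε → ∃ C : ℝ, ∀ (a b : ℕ) (x y : ℝ),
    ‖mixedDeriv a b f x y‖ ≤
      C * ε ^ (a + b) * ((a + b : ℕ) : ℝ) ^ (s * ((a + b : ℕ) : ℝ))

/-! ### Parameters -/

/-- `θ = 2m/(2m-1)`. -/
def theta (m : ℕ) : ℝ := 2 * m / (2 * m - 1)

/-- `γ = m/((n+1)(2m-1))`. -/
def gam (n m : ℕ) : ℝ := m / ((n + 1) * (2 * m - 1))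

/-- `α = -1/(2n+2)`, the index of the Laguerre polynomials. -/
def alph (n : ℕ) : ℝ := -1 / (2 * n + 2)

/-- The exponent `r`; it is the value for which the `v_0`-component of `𝒫_1 u_0` vanishes. -/
def rExp (n m : ℕ) : ℝ :=
  -(4 * m - 1) / (2 * (2 * m - 1)) + gam n m * (2 * n + 1) / 2

/-! ### The even eigenfunctions of `-∂_t² + t^(2(2n+1))` relative to the weight `t^(2n)` -/

/-- The eigenvalue `E_k = 4k(n+1) + 2n + 1`. -/
def eig (n k : ℕ) : ℝ := 4 * k * (n + 1) + 2 * n + 1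

/-- The generalized Laguerre polynomial
`L_k^(α)(s) = ∑_{i ≤ k} (-1)^i binom(k+α, k-i) s^i / i!`, with
`binom(k+α, k-i) = (i+1+α)(i+2+α)⋯(k+α) / (k-i)!`. -/
def laguerre (α : ℝ) (k : ℕ) (s : ℝ) : ℝ :=
  ∑ i ∈ Finset.range (k + 1), (-1) ^ i *
    ((∏ j ∈ Finset.Ioc i k, ((j : ℝ) + α)) / (Nat.factorial (k - i) : ℝ)) *
      s ^ i / (Nat.factorial i : ℝ)

/-- `v_k(t) = exp(-t^(2n+2)/(2n+2)) L_k^(-1/(2n+2))(t^(2n+2)/(n+1))`. -/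
def eigFun (n k : ℕ) (t : ℝ) : ℝ :=
  Real.exp (-(t ^ (2 * n + 2) / (2 * n + 2))) *
    laguerre (alph n) k (t ^ (2 * n + 2) / (n + 1))

/-- The action of `t ∂_t` on finite combinations `∑ a_p v_p`, in terms of the coefficients, by
`t v_k' = (n+1) ((k+1) v_{k+1} - (1+α) v_k - (k+α) v_{k-1})`. -/
def eulerAct (n : ℕ) (a : ℕ → ℂ) : ℕ → ℂ := fun p =>
  ((n : ℂ) + 1) * ((p : ℂ) * a (p - 1) - (1 + (alph n : ℂ)) * a p
    - ((p : ℂ) + 1 + (alph n : ℂ)) * a (p + 1))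

/-! ### The operators `𝒫_i` -/

/-- The polynomials `P_{p,i}` determined by
`[ρ^(-θ) (1 - θ + ρ∂_ρ)]^p ρ^q [t^f u(t,ρ)]_{t = ρ^γ x}
  = ρ^(q + p - θp) [t^f ∑_{i ≤ p} ρ^(-i) P_{p,i}(t∂_t) ∂_ρ^(p-i) u(t,ρ)]_{t = ρ^γ x}`.
One more factor `ρ^(-θ) (1 - θ + ρ∂_ρ)` acts inside the bracket as
`1 - (p+1)θ + q + γf + γ t∂_t + ρ∂_ρ`, which gives the recursion in `p`. -/
def euPoly (θ γ q f : ℝ) : ℕ → ℕ → Polynomial ℝ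
  | 0, 0 => 1
  | 0, _ + 1 => 0
  | p + 1, 0 => euPoly θ γ q f p 0
  | p + 1, i + 1 => euPoly θ γ q f p (i + 1)
      + (Polynomial.C (((p : ℝ) - i) + 1 - ((p : ℝ) + 1) * θ + q + γ * f)
          + Polynomial.C γ * Polynomial.X) * euPoly θ γ q f p i

/-- The polynomial `𝒫_i` (`1 ≤ i ≤ 2m`) such that, with `A = ((2m-1)/(2im))^(2m)`,
`(x^n y^m D_y)² ∫ e^(iyρ^θ) ρ^r u(ρ^γ x, ρ) dρ
  = A ∫ e^(iyρ^θ) ρ^(r+θ/(n+1)) [t^(2n) ∑_i ρ^(-i) 𝒫_i(t∂_t) ∂_ρ^(2m-i) u]_{t = ρ^γ x} dρ`.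
Its first term comes from `x^(2n) y^(2m) D_y²` and its second one from
`-i m x^(2n) y^(2m-1) D_y`. -/
def pPoly (n m i : ℕ) : Polynomial ℝ :=
  euPoly (theta m) (gam n m) (rExp n m + 2 * theta m - 2 * n * gam n m) (2 * n) (2 * m) i
    - Polynomial.C (m * theta m) *
      euPoly (theta m) (gam n m) (rExp n m + theta m - 2 * n * gam n m) (2 * n)
        (2 * m - 1) (i - 1)

/-- The coefficient of `v_p` in `𝒫_i(t∂_t) ∑ a_q v_q`. -/
def pAct (n m i : ℕ) (a : ℕ → ℂ) (p : ℕ) : ℂ :=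
  ∑ j ∈ Finset.range (i + 1), (((pPoly n m i).coeff j : ℝ) : ℂ) * ((eulerAct n)^[j] a) p

/-! ### The operators `Θ_p = ∂_ρ^(2m) + (2mi/(2m-1))^(2m) E_p` -/

/-- `c_p = 2m/(2m-1) · E_p^(1/(2m))`. -/
def freq (n m p : ℕ) : ℝ := 2 * m / (2 * m - 1) * eig n p ^ (1 / (2 * m) : ℝ)

/-- `λ_j = e^(iθ_j)`, with `θ_j = π(1+2j)/(2m)`. -/
def lam (m j : ℕ) : ℂ :=
  Complex.exp (Complex.I * ((Real.pi / (2 * m) * (1 + 2 * j) : ℝ) : ℂ))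

/-- The fundamental solution of `Θ_p` that decays at infinity, i.e.
`(1/2π) ∫ e^(iρσ) (-1)^m / (σ^(2m) + c_p^(2m)) dσ`, written out by residues. -/
def fundSol (n m p : ℕ) (ρ : ℝ) : ℂ :=
  (-1) ^ m / (2 * m * Complex.I * (freq n m p : ℂ) ^ (2 * m - 1)) *
    ∑ j ∈ Finset.range m,
      lam m j * Complex.exp (Complex.I * (freq n m p : ℂ) * lam m j * ((|ρ| : ℝ) : ℂ))

/-- The solution `h_j` of `Θ_0 h = 0` attached to a right-hand side `F`, for `j = 0, m-1`. -/
def homSol (n m j : ℕ) (F : ℝ → ℂ) (ρ : ℝ) : ℂ :=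
  (-1) ^ m / (2 * m * Complex.I * (freq n m 0 : ℂ) ^ (2 * m - 1)) *
    (lam m j * Complex.exp (Complex.I * (freq n m 0 : ℂ) * lam m j * (ρ : ℂ))) *
      ∫ τ : ℝ, Complex.exp (-(Complex.I * (freq n m 0 : ℂ) * lam m j * (τ : ℂ))) * F τ

/-- `c_1 = 2m/(2m-1) (2n+1)^(1/(2m)) (sin(π/2m) - i cos(π/2m))`. -/
def c₁ (n m : ℕ) : ℂ :=
  ((2 * m / (2 * m - 1) * (2 * n + 1 : ℝ) ^ (1 / (2 * m) : ℝ) : ℝ) : ℂ) *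
    ((Real.sin (Real.pi / (2 * m)) : ℂ) - Complex.I * (Real.cos (Real.pi / (2 * m)) : ℂ))

/-! ### The coefficients `g_{ℓ,p}` of the formal solution

`hist k q` stands for `g_{k,q}`; in row `ℓ` only the rows `k < ℓ` of `hist` are used. -/

/-- The right-hand side
`f_{ℓ,p} = -∑_{i=1}^{min(ℓ,2m)} ρ^(-i) (𝒫_i u_{ℓ-i})_p` of the equation for `g_{ℓ,p}`, `p ≥ 1`. -/
def rhsPos (n m : ℕ) (hist : ℕ → ℕ → ℝ → ℂ) (l p : ℕ) (ρ : ℝ) : ℂ :=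
  -∑ i ∈ Finset.Icc 1 (min l (2 * m)), ((ρ : ℂ) ^ i)⁻¹ *
    pAct n m i (fun q => iteratedDeriv (2 * m - i) (hist (l - i) q) ρ) p

/-- `g_{ℓ,p} = G_p * (χ_ℓ f_{ℓ,p})` for `p ≥ 1`. -/
def gPos (n m : ℕ) (χ : ℕ → ℝ → ℝ) (hist : ℕ → ℕ → ℝ → ℂ) (l p : ℕ) (ρ : ℝ) : ℂ :=
  ∫ τ : ℝ, fundSol n m p (ρ - τ) * ((χ l τ : ℂ) * rhsPos n m hist l p τ)

/-- The right-hand side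
`f_{ℓ,0} = -ρ^(-1) (𝒫_1 (1-Π_0) u_ℓ)_0 - ∑_{i=2}^{min(ℓ+1,2m)} ρ^(-i) (𝒫_i u_{ℓ+1-i})_0`. -/
def rhsZero (n m : ℕ) (χ : ℕ → ℝ → ℝ) (hist : ℕ → ℕ → ℝ → ℂ) (l : ℕ) (ρ : ℝ) : ℂ :=
  -((ρ : ℂ)⁻¹ * pAct n m 1
      (fun q => if q = 0 then 0 else iteratedDeriv (2 * m - 1) (gPos n m χ hist l q) ρ) 0)
    - ∑ i ∈ Finset.Icc 2 (min (l + 1) (2 * m)), ((ρ : ℂ) ^ i)⁻¹ *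
        pAct n m i (fun q => iteratedDeriv (2 * m - i) (hist (l + 1 - i) q) ρ) 0

/-- `g_{ℓ,0} = G_0 * (χ_ℓ f_{ℓ,0}) - h_0 - h_{m-1}`. For `m = 1` the functions `h_0` and `h_{m-1}`
are one and the same (there is one root `λ_j` with minimal imaginary part) and are subtracted
once. -/
def gZero (n m : ℕ) (χ : ℕ → ℝ → ℝ) (hist : ℕ → ℕ → ℝ → ℂ) (l : ℕ) (ρ : ℝ) : ℂ :=
  (∫ τ : ℝ, fundSol n m 0 (ρ - τ) * ((χ l τ : ℂ) * rhsZero n m χ hist l τ))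
    - ∑ j ∈ ({0, m - 1} : Finset ℕ),
        homSol n m j (fun τ => (χ l τ : ℂ) * rhsZero n m χ hist l τ) ρ

/-- The coefficients `g_{ℓ,p}(ρ)`, with `g_{ℓ,p} = 0` for `p > ℓ`. -/
def gCoef (n m : ℕ) (χ : ℕ → ℝ → ℝ) (l : ℕ) : ℕ → ℝ → ℂ :=
  if l = 0 then
    fun p ρ => if p = 0 then Complex.exp (-(c₁ n m * (ρ : ℂ))) else 0
  else
    let hist : ℕ → ℕ → ℝ → ℂ :=
      fun k => if _h : k < l then gCoef n m χ k else fun _ _ => 0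
    fun p => if p = 0 then gZero n m χ hist l
      else if p ≤ l then gPos n m χ hist l p else fun _ => 0
termination_by l

/-- `u_ℓ(t,ρ) = ∑_{p ≤ ℓ} g_{ℓ,p}(ρ) v_p(t)`. -/
def uTerm (n m : ℕ) (χ : ℕ → ℝ → ℝ) (l : ℕ) (t ρ : ℝ) : ℂ :=
  ∑ p ∈ Finset.range (l + 1), gCoef n m χ l p ρ * (eigFun n p t : ℂ)

/-! ### Cutoffs and the approximate solution -/

/-- The cutoffs used in the construction of the `g_{ℓ,p}`. -/
structure IsChiFamily (m : ℕ) (R₁ : ℝ) (χ : ℕ → ℝ → ℝ) : Prop where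
  smooth : ∀ l, ContDiff ℝ ((⊤ : ℕ∞) : WithTop ℕ∞) (χ l)
  eq_zero : ∀ (l : ℕ) (ρ : ℝ), ρ < 2 * R₁ * (l + 1) → χ l ρ = 0
  eq_one : ∀ (l : ℕ) (ρ : ℝ), 4 * R₁ * (l + 1) < ρ → χ l ρ = 1
  bound : ∃ C : ℝ, ∀ (l k : ℕ) (ρ : ℝ), k ≤ 2 * m → |iteratedDeriv k (χ l) ρ| ≤ C

/-- The Gevrey cutoffs `ω_j` of order `σ` at scale `R`. The last estimate implies that each `ω_j`
belongs to the Gevrey class `G^σ(ℝ)`, since `ω_j` vanishes near the origin. -/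
structure IsOmegaFamily (σ R : ℝ) (ω : ℕ → ℝ → ℝ) : Prop where
  smooth : ∀ j, ContDiff ℝ ((⊤ : ℕ∞) : WithTop ℕ∞) (ω j)
  nonneg : ∀ (j : ℕ) (x : ℝ), 0 ≤ ω j x
  le_one : ∀ (j : ℕ) (x : ℝ), ω j x ≤ 1
  eq_zero : ∀ (j : ℕ) (x : ℝ), |x| ≤ 2 * R * (j + 1) → ω j x = 0
  eq_one : ∀ (j : ℕ) (x : ℝ), 4 * R * (j + 1) ≤ |x| → ω j x = 1
  bound : ∃ C : ℝ, 0 < C ∧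
    (∀ (j k : ℕ) (x : ℝ), k ≤ 3 * j → |iteratedDeriv k (ω j) x| ≤ C ^ (k + 1) * (R ^ k)⁻¹) ∧
    (∀ (j k : ℕ) (x : ℝ), |iteratedDeriv k (ω j) x| ≤
      (R * C) ^ (k + 1) * (Nat.factorial k : ℝ) ^ σ / |x| ^ k)

/-- `ũ(t,ρ) = ∑_ℓ u_ℓ(t,ρ) ω_ℓ(ρ)`, a locally finite sum. -/
def uTilde (n m : ℕ) (χ ω : ℕ → ℝ → ℝ) (t ρ : ℝ) : ℂ :=
  ∑' l : ℕ, uTerm n m χ l t ρ * (ω l ρ : ℂ)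

/-- The integrand `e^(iyρ^θ) ρ^r u(ρ^γ x, ρ)` of `𝒦[u](x,y)`. -/
def kernelIntegrand (n m : ℕ) (u : ℝ → ℝ → ℂ) (x y ρ : ℝ) : ℂ :=
  Complex.exp (Complex.I * ((y * ρ ^ theta m : ℝ) : ℂ)) * ((ρ ^ rExp n m : ℝ) : ℂ) *
    u (ρ ^ gam n m * x) ρ

/-- `𝒦[u](x,y) = ∫_0^∞ e^(iyρ^θ) ρ^r u(ρ^γ x, ρ) dρ`. -/
def opK (n m : ℕ) (u : ℝ → ℝ → ℂ) : ℝ → ℝ → ℂ :=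
  fun x y => ∫ ρ in Set.Ioi (0 : ℝ), kernelIntegrand n m u x y ρ

end

end MetivierGen

/-! The phase `e^(iyρ^θ)` turns multiplication by `y` into an integration by parts in `ρ`, and the
substitution `t = ρ^γ x`, with `θ = (2n+2)γ`, gives all three terms of the operator the same power
of `ρ`. The equation `-v_p'' + t^(4n+2) v_p = E_p t^(2n) v_p` then lets `t^(2n)` factor out. So `M
𝒦[u]` is an integral of the same type whose amplitude is, up to a constant, `t^(2n)` times the
residual `∂_ρ^(2m) u + (iθ)^(2m) E u + ∑ ρ^(-i) 𝒫_i ∂_ρ^(2m-i) u`, computed on the coefficients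
along the `v_p` (`opM_integral_kerFam`). It remains to show that this residual decays faster than
every exponential, and that this forces the Beurling estimates.

Estimates of the rows. `exists_rowEst` bounds `g_{ℓ,p}` and its derivatives by `K^ℓ (ℓ!)^(1-1/2m)
ρ^(-ℓ) e^(-ρ Re c_1)`. The operator `𝒫_i` has degree `i` and costs `(p+1)^i`; solving the equation
of order `2m` gains `c_p^(-i)`, which is about `p^(-i/2m)`, for the derivative of order `2m - i`.
The net loss is what the power of the factorial records (`weight_mul_growth_le`). For `p ≥ 1` there
is a spectral gap between the rate `Re c_1` and the characteristic roots. For `p = 0` the roots `j =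
0, m-1` decay exactly like the source; subtracting `h_0, h_{m-1}` means integrating them backward
from infinity, which loses one power of `ρ` and gains a factor `1/ℓ`
(`IsSource.norm_greenSol_resonant_le`). The lost power is available because the exponent `r` makes
the `v_0` component of `𝒫_1` independent of the coefficient of `v_0` (`pAct_one_zero`), so that the
source for `p = 0` is one order smaller.

Summation. On the support of `ω_ℓ` one has `ρ ≥ 2R(ℓ+1)`, so `(ℓ!)^(1-1/2m) ρ^(-ℓ) ≤ (ℓ!)^(-1/2m)`,
which is summable against every geometric sequence (`summable_pow_mul_decayFactor`). The
contribution of row `ℓ` to the residual consists of derivatives of `ω_ℓ` and differences of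
neighbouring cutoffs. It lives on `2R(ℓ+1) ≤ ρ ≤ 4R(ℓ+2m+1)`, where `e^(δρ)` is at most geometric in
`ℓ`. Hence the residual decays at every exponential rate `δ` (`dec_residual_cutSum`).

Beurling estimates. A `y`-derivative gives `ρ^θ`, an `x`-derivative gives `ρ^γ` and a derivative of
`v_p`. The latter is controlled by Cauchy's estimate on a circle of radius `ρ^(1/(2n+2))`, where the
entire function `v_p` costs at most `e^(Cρ)` (`norm_eigDeriv_le`). Integrating powers of `ρ` against
`e^(-Λρ)` yields total order `θ`, and the freedom to take `Λ` large yields every `ε`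
(`Adm.exists_norm_integral_kerFam_le`, `factorial_mul_rpow_le`). -/

namespace MetivierGen

/-! ### Laguerre polynomials -/

/-- The coefficient of `s^i` in `L_k^(α)(s)`. -/
noncomputable def lagCoef (α : ℝ) (k i : ℕ) : ℝ :=
  if i ≤ k then (-1) ^ i * ((∏ j ∈ Finset.Ioc i k, ((j : ℝ) + α)) / (Nat.factorial (k - i) : ℝ)) /
    (Nat.factorial i : ℝ) else 0

lemma lagCoef_of_lt {α : ℝ} {k i : ℕ} (h : k < i) : lagCoef α k i = 0 := by
  simp [lagCoef, not_le.mpr h]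

/-- Passing from `k` to `k + 1` multiplies the product by `k + 1 + α` and the factorial by `k + 1 -
i`. Cleared of denominators, the relation needs no restriction on `i`. The Laguerre identities for
general `k` below are read off coefficientwise from this relation and `lagCoef_succ_right`. -/
lemma lagCoef_succ_left (α : ℝ) (k i : ℕ) :
    ((k : ℝ) + 1 - i) * lagCoef α (k + 1) i = (k + 1 + α) * lagCoef α k i := by
  rcases lt_trichotomy i (k + 1) with h | h | h
  · have hik : i ≤ k := Nat.lt_succ_iff.mp h
    obtain ⟨d, rfl⟩ := Nat.exists_eq_add_of_le hik
    have h1 : i + d + 1 - i = d + 1 := by omega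
    have h2 : i + d - i = d := by omega
    simp only [lagCoef, if_pos h.le, if_pos hik, h1, h2, Nat.factorial_succ]
    rw [Finset.prod_Ioc_succ_top (by omega)]
    have : (d.factorial : ℝ) ≠ 0 := by positivity
    have h3 : (i.factorial : ℝ) ≠ 0 := by positivity
    push_cast
    field_simp
    ring
  · subst h
    rw [lagCoef_of_lt (Nat.lt_succ_self k)]
    push_cast
    ring
  · rw [lagCoef_of_lt h, lagCoef_of_lt (by omega)]
    ring

lemma lagCoef_succ_right (α : ℝ) (k i : ℕ) :
    ((i : ℝ) + 1) * (i + 1 + α) * lagCoef α k (i + 1) = -((k : ℝ) - i) * lagCoef α k i := by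
  rcases lt_trichotomy i k with h | h | h
  · obtain ⟨d, rfl⟩ := Nat.exists_eq_add_of_lt h
    have h1 : i + d + 1 - (i + 1) = d := by omega
    have h2 : i + d + 1 - i = d + 1 := by omega
    have h4 : i ≤ i + d + 1 := by omega
    have h5 : i + 1 ≤ i + d + 1 := by omega
    simp only [lagCoef, if_pos h4, if_pos h5, h1, h2, Nat.factorial_succ]
    have hp : ∏ j ∈ Finset.Ioc i (i + d + 1), ((j : ℝ) + α)
        = ((i : ℝ) + 1 + α) * ∏ j ∈ Finset.Ioc (i + 1) (i + d + 1), ((j : ℝ) + α) := by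
      rw [← Finset.prod_Ioc_consecutive _ (Nat.le_succ i) h5]
      simp
    rw [hp]
    have : (d.factorial : ℝ) ≠ 0 := by positivity
    have h3 : (i.factorial : ℝ) ≠ 0 := by positivity
    push_cast
    field_simp
    ring
  · subst h
    rw [lagCoef_of_lt (Nat.lt_succ_self i)]
    ring
  · rw [lagCoef_of_lt h, lagCoef_of_lt (by omega)]
    ring

/-- The Laguerre polynomial `L_k^(α)`, with complex coefficients. -/
noncomputable def lagPoly (α : ℝ) (k : ℕ) : Polynomial ℂ :=
  ∑ i ∈ Finset.range (k + 1), Polynomial.C (lagCoef α k i : ℂ) * Polynomial.X ^ i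

lemma coeff_lagPoly (α : ℝ) (k i : ℕ) : (lagPoly α k).coeff i = lagCoef α k i := by
  simp only [lagPoly, Polynomial.finsetSum_coeff, Polynomial.coeff_C_mul, Polynomial.coeff_X_pow]
  rcases lt_or_ge k i with h | h
  · rw [lagCoef_of_lt h]
    apply Finset.sum_eq_zero
    intro j hj
    rw [Finset.mem_range] at hj
    rw [if_neg (by omega)]
    simp
  · rw [Finset.sum_eq_single i]
    · simp
    · intro j _ hji
      rw [if_neg (Ne.symm hji)]
      simp
    · intro hi
      exact absurd (Finset.mem_range.mpr (by omega)) hi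

open Polynomial in
lemma lagPoly_euler_succ (α : ℝ) (k : ℕ) :
    X * derivative (lagPoly α (k + 1)) =
      C ((k : ℂ) + 1) * lagPoly α (k + 1) - C ((k : ℂ) + 1 + α) * lagPoly α k := by
  ext i
  rw [coeff_sub, coeff_C_mul, coeff_C_mul, coeff_lagPoly, coeff_lagPoly]
  have h := congrArg (fun x : ℝ => (x : ℂ)) (lagCoef_succ_left α k i)
  push_cast at h
  rcases i with _ | i
  · simp at h ⊢
    linear_combination -h
  · rw [coeff_X_mul, coeff_derivative, coeff_lagPoly]
    push_cast at h ⊢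
    linear_combination -h

open Polynomial in
lemma lagPoly_euler_zero (α : ℝ) : X * derivative (lagPoly α 0) = 0 := by
  simp [lagPoly]

open Polynomial in
-- Coefficientwise, Laguerre's equation is the two-term relation `lagCoef_succ_right`. It becomes
-- the differential equation of `v_k` in `eigFunC_ode`.
lemma lagPoly_ode (α : ℝ) (k : ℕ) :
    X * derivative (derivative (lagPoly α k)) =
      (X - C ((α : ℂ) + 1)) * derivative (lagPoly α k) - C (k : ℂ) * lagPoly α k := by
  ext i
  rw [coeff_sub, sub_mul, coeff_sub, coeff_C_mul, coeff_C_mul, coeff_lagPoly]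
  have h := congrArg (fun x : ℝ => (x : ℂ)) (lagCoef_succ_right α k i)
  push_cast at h
  rcases i with _ | i
  · simp [coeff_derivative, coeff_lagPoly] at h ⊢
    linear_combination h
  · rw [coeff_X_mul, coeff_X_mul, coeff_derivative, coeff_derivative, coeff_derivative,
      coeff_lagPoly, coeff_lagPoly]
    push_cast at h ⊢
    linear_combination h

open Polynomial in
/-- Three-term recurrence. -/
lemma lagPoly_recurrence (α : ℝ) (k : ℕ) :
    C ((k : ℂ) + 2) * lagPoly α (k + 2) =
      (C (2 * (k : ℂ) + 3 + α) - X) * lagPoly α (k + 1) - C ((k : ℂ) + 1 + α) * lagPoly α k := by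
  ext i
  rw [coeff_sub, sub_mul, coeff_sub, coeff_C_mul, coeff_C_mul, coeff_C_mul, coeff_lagPoly,
    coeff_lagPoly, coeff_lagPoly]
  have h1 := lagCoef_succ_left α (k + 1) i
  have h2 := lagCoef_succ_left α k i
  have key : ((k : ℝ) + 2) * lagCoef α (k + 2) i = (2 * k + 3 + α) * lagCoef α (k + 1) i
      - (if i = 0 then 0 else lagCoef α (k + 1) (i - 1)) - (k + 1 + α) * lagCoef α k i := by
    -- The general argument cancels the factor `k + 2 - i`, which vanishes exactly in the top
    -- degree; there both sides are computed directly.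
    rcases eq_or_ne i (k + 2) with rfl | hne
    · rw [lagCoef_of_lt (i := k + 2) (k := k + 1) (by omega),
        lagCoef_of_lt (i := k + 2) (k := k) (by omega), if_neg (by omega)]
      simp only [lagCoef, show k + 2 - 1 = k + 1 from rfl, le_refl, if_true, Nat.sub_self,
        Finset.Ioc_self, Finset.prod_empty, Nat.factorial_succ]
      have : (k.factorial : ℝ) ≠ 0 := by positivity
      push_cast
      field_simp
      ring
    · rcases i with _ | i
      · simp only [Nat.cast_zero, sub_zero] at h1 h2
        push_cast at h1
        simp only [if_true]
        linear_combination h1 - h2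
      · have h3 := lagCoef_succ_right α (k + 1) i
        have hik : ((k : ℝ) + 1 - i) ≠ 0 := by
          intro h
          apply hne
          have : ((k + 1 : ℕ) : ℝ) = (i : ℝ) := by push_cast; linarith
          have := Nat.cast_injective this
          omega
        simp only [Nat.succ_ne_zero, if_false, Nat.add_sub_cancel]
        push_cast at h1 h2 h3 ⊢
        apply mul_left_cancel₀ hik
        linear_combination ((k : ℝ) + 2) * h1 - ((k : ℝ) + 1 - i) * h2 + h3
  have h := congrArg (fun x : ℝ => (x : ℂ)) key
  rcases i with _ | i
  · simp at h ⊢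
    linear_combination h
  · rw [coeff_X_mul, coeff_lagPoly]
    simp only [Nat.succ_ne_zero, if_false, Nat.add_sub_cancel] at h
    push_cast at h ⊢
    linear_combination h

open Polynomial in
lemma lagPoly_recurrence_zero (α : ℝ) :
    lagPoly α 1 = (C (1 + (α : ℂ)) - X) * lagPoly α 0 := by
  simp [lagPoly, Finset.sum_range_succ, lagCoef]
  ring

/-! ### The eigenfunctions on the complex plane -/

/-- The entire extension of `eigFun n k`. -/
noncomputable def eigFunC (n k : ℕ) (z : ℂ) : ℂ :=
  Complex.exp (-(z ^ (2 * n + 2) / (2 * n + 2))) *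
    (lagPoly (alph n) k).eval (z ^ (2 * n + 2) / (n + 1))

lemma laguerre_eq_eval (α : ℝ) (k : ℕ) (s : ℝ) :
    ((laguerre α k s : ℝ) : ℂ) = (lagPoly α k).eval (s : ℂ) := by
  simp only [laguerre, lagPoly, Polynomial.eval_finsetSum]
  push_cast
  apply Finset.sum_congr rfl
  intro i hi
  rw [Finset.mem_range, Nat.lt_succ_iff] at hi
  simp [lagCoef, if_pos hi]
  ring

lemma eigFunC_ofReal (n k : ℕ) (t : ℝ) : eigFunC n k t = (eigFun n k t : ℂ) := by
  simp only [eigFunC, eigFun]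
  push_cast
  rw [laguerre_eq_eval]
  push_cast
  rfl

lemma natCast_add_one_ne_zero (n : ℕ) : (n : ℂ) + 1 ≠ 0 := by exact_mod_cast Nat.succ_ne_zero n

open Polynomial in
/-- Derivative of a function `exp(-z^(2n+2)/(2n+2)) Q(z^(2n+2)/(n+1))`. -/
lemma hasDerivAt_exp_mul_eval (n : ℕ) (Q : Polynomial ℂ) (z : ℂ) :
    HasDerivAt (fun z : ℂ => Complex.exp (-(z ^ (2 * n + 2) / (2 * n + 2))) *
        Q.eval (z ^ (2 * n + 2) / (n + 1)))
      (z ^ (2 * n + 1) * (Complex.exp (-(z ^ (2 * n + 2) / (2 * n + 2))) *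
        (2 * derivative Q - Q).eval (z ^ (2 * n + 2) / (n + 1)))) z := by
  have hn := natCast_add_one_ne_zero n
  have hn2 : (2 * (n : ℂ) + 2) ≠ 0 := by
    rw [show (2 * (n : ℂ) + 2) = 2 * (n + 1) by ring]; exact mul_ne_zero two_ne_zero hn
  have hp : HasDerivAt (fun z : ℂ => z ^ (2 * n + 2)) ((2 * n + 2) * z ^ (2 * n + 1)) z := by
    have := hasDerivAt_pow (2 * n + 2) z
    push_cast at this
    exact this
  have h1 : HasDerivAt (fun z : ℂ => Complex.exp (-(z ^ (2 * n + 2) / (2 * n + 2))))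
      (Complex.exp (-(z ^ (2 * n + 2) / (2 * n + 2))) *
        -((2 * n + 2) * z ^ (2 * n + 1) / (2 * n + 2))) z :=
    ((hp.div_const (2 * (n : ℂ) + 2)).neg).cexp
  have h2 := (Q.hasDerivAt (z ^ (2 * n + 2) / (n + 1))).comp z (hp.div_const ((n : ℂ) + 1))
  refine (h1.mul h2).congr_deriv ?_
  simp only [eval_sub, eval_mul, Function.comp]
  have : (2 : ℂ[X]).eval (z ^ (2 * n + 2) / ((n : ℂ) + 1)) = 2 := by
    rw [← C_ofNat]; exact eval_C
  rw [this]
  field_simp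
  ring

lemma differentiable_eigFunC (n k : ℕ) : Differentiable ℂ (eigFunC n k) := fun z =>
  (hasDerivAt_exp_mul_eval n _ z).differentiableAt

open Polynomial in
lemma deriv_eigFunC (n k : ℕ) : deriv (eigFunC n k) = fun z => z ^ (2 * n + 1) *
    (Complex.exp (-(z ^ (2 * n + 2) / (2 * n + 2))) *
        (2 * derivative (lagPoly (alph n) k) - lagPoly (alph n) k).eval
          (z ^ (2 * n + 2) / (n + 1))) :=
  funext fun z => (hasDerivAt_exp_mul_eval n _ z).deriv

lemma eval_two' (s : ℂ) : (2 : Polynomial ℂ).eval s = 2 := by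
  rw [← Polynomial.C_ofNat]; exact Polynomial.eval_C

open Polynomial in
/-- The equation `-v_k'' + z^(2(2n+1)) v_k = E_k z^(2n) v_k`. -/
lemma eigFunC_ode (n k : ℕ) (z : ℂ) :
    -deriv (deriv (eigFunC n k)) z + z ^ (4 * n + 2) * eigFunC n k z =
      (eig n k : ℂ) * z ^ (2 * n) * eigFunC n k z := by
  have hn := natCast_add_one_ne_zero n
  rw [deriv_eigFunC]
  have hp : HasDerivAt (fun z : ℂ => z ^ (2 * n + 1)) ((2 * n + 1) * z ^ (2 * n)) z := by
    have := hasDerivAt_pow (2 * n + 1) z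
    push_cast at this
    exact this
  have hd : HasDerivAt (fun z => z ^ (2 * n + 1) *
      (Complex.exp (-(z ^ (2 * n + 2) / (2 * n + 2))) *
        (2 * derivative (lagPoly (alph n) k) - lagPoly (alph n) k).eval
          (z ^ (2 * n + 2) / (n + 1)))) _ z := hp.mul (hasDerivAt_exp_mul_eval n _ z)
  rw [hd.deriv]
  have hode := congrArg (Polynomial.eval (z ^ (2 * n + 2) / ((n : ℂ) + 1)))
    (lagPoly_ode (alph n) k)
  simp only [eval_mul, eval_sub, eval_X, eval_C, derivative_sub, derivative_mul,
    derivative_ofNat, zero_mul, zero_add, eval_two', eigFunC] at hode ⊢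
  set L := (lagPoly (alph n) k).eval (z ^ (2 * n + 2) / ((n : ℂ) + 1))
  set L1 := (derivative (lagPoly (alph n) k)).eval (z ^ (2 * n + 2) / ((n : ℂ) + 1))
  set L2 := (derivative (derivative (lagPoly (alph n) k))).eval
    (z ^ (2 * n + 2) / ((n : ℂ) + 1))
  have ha : (alph n : ℂ) = -1 / (2 * (n + 1)) := by
    unfold alph; push_cast; congr 1; ring
  have he : (eig n k : ℂ) = 4 * k * (n + 1) + 2 * n + 1 := by unfold eig; push_cast; ring
  rw [ha] at hode
  rw [he]
  field_simp at hode
  have e1 : z ^ (4 * n + 2) = z ^ (2 * n) * z ^ (2 * n + 2) := by rw [← pow_add]; congr 1; ring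
  have e2 : z ^ (2 * n + 1) * z ^ (2 * n + 1) = z ^ (2 * n) * z ^ (2 * n + 2) := by
    rw [← pow_add, ← pow_add]; congr 1; ring
  set E := Complex.exp (-(z ^ (2 * n + 2) / (2 * n + 2)))
  rw [e1]
  linear_combination (-(E * (4 * L2 - 4 * L1 + L))) * e2 + (-2 * z ^ (2 * n) * E) * hode

open Polynomial in
/-- `z v_k' = (n+1) ((k+1) v_{k+1} - (1+α) v_k - (k+α) v_{k-1})`. -/
lemma eigFunC_euler (n k : ℕ) (z : ℂ) :
    z * deriv (eigFunC n k) z = ((n : ℂ) + 1) * (((k : ℂ) + 1) * eigFunC n (k + 1) z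
      - (1 + (alph n : ℂ)) * eigFunC n k z
      - (if k = 0 then 0 else ((k : ℂ) + alph n) * eigFunC n (k - 1) z)) := by
  have hn := natCast_add_one_ne_zero n
  rw [deriv_eigFunC]
  simp only [eigFunC]
  set s := z ^ (2 * n + 2) / ((n : ℂ) + 1) with hs
  have hs' : z * z ^ (2 * n + 1) = (n + 1) * s := by
    rw [hs]; field_simp; ring
  rw [← mul_assoc, hs']
  set E := Complex.exp (-(z ^ (2 * n + 2) / (2 * n + 2)))
  rcases k with _ | k
  · have h1 := congrArg (Polynomial.eval s) (lagPoly_euler_zero (alph n))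
    have h2 := congrArg (Polynomial.eval s) (lagPoly_recurrence_zero (alph n))
    simp only [eval_mul, eval_sub, eval_X, eval_C, eval_two', eval_zero, if_true,
      Nat.cast_zero, zero_add] at h1 h2 ⊢
    rw [h2]
    linear_combination 2 * (n + 1) * E * h1
  · have h1 := congrArg (Polynomial.eval s) (lagPoly_euler_succ (alph n) k)
    have h2 := congrArg (Polynomial.eval s) (lagPoly_recurrence (alph n) k)
    simp only [eval_mul, eval_sub, eval_X, eval_C, eval_two', Nat.succ_ne_zero, if_false,
      Nat.add_sub_cancel] at h1 h2 ⊢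
    push_cast
    rw [show k + 1 + 1 = k + 2 from rfl]
    linear_combination 2 * (n + 1) * E * h1 - (n + 1) * E * h2

end MetivierGen

namespace MetivierGen

/-! ### Bounds for the derivatives of the eigenfunctions -/

lemma neg_one_lt_alph (n : ℕ) : -1 < alph n := by
  unfold alph
  rw [lt_div_iff₀ (by positivity)]
  have : (0 : ℝ) ≤ n := by positivity
  linarith

lemma alph_neg (n : ℕ) : alph n < 0 := by
  unfold alph
  exact div_neg_of_neg_of_pos (by norm_num) (by positivity)

/-- For `-1 < α < 0` each factor `j + α` with `j ≥ 1` lies between `0` and `j`, so the coefficients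
are dominated by those for `α = 0`. -/
lemma abs_lagCoef_le {α : ℝ} (h0 : -1 < α) (h1 : α < 0) (i d : ℕ) :
    |lagCoef α (i + d) i| ≤ ((i + d).choose i : ℝ) / i.factorial := by
  induction d with
  | zero => simp [lagCoef, abs_div]
  | succ d ih =>
    have h := lagCoef_succ_left α (i + d) i
    have hd : (0 : ℝ) < ((d : ℝ) + 1) := by positivity
    have hch : ((i + d).choose i : ℝ) * ((i : ℝ) + d + 1)
        = ((i + d + 1).choose i : ℝ) * ((d : ℝ) + 1) := by
      have := Nat.choose_mul_succ_eq (i + d) i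
      rw [show i + d + 1 - i = d + 1 by omega] at this
      exact_mod_cast this
    rw [← mul_le_mul_iff_right₀ hd, ← add_assoc]
    have e : ((d : ℝ) + 1) * |lagCoef α (i + d + 1) i|
        = ((i : ℝ) + d + 1 + α) * |lagCoef α (i + d) i| := by
      rw [← abs_of_pos hd, ← abs_mul]
      have hp : 0 ≤ (i : ℝ) + d + 1 + α := by
        have : (0 : ℝ) ≤ (i : ℝ) + d := by positivity
        linarith
      rw [← abs_of_nonneg hp, ← abs_mul]
      congr 1
      push_cast at h
      linear_combination h
    rw [e]
    calc ((i : ℝ) + d + 1 + α) * |lagCoef α (i + d) i|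
        ≤ ((i : ℝ) + d + 1) * (((i + d).choose i : ℝ) / i.factorial) := by
          exact mul_le_mul (by linarith) ih (abs_nonneg _) (by positivity)
      _ = ((d : ℝ) + 1) * (((i + d + 1).choose i : ℝ) / i.factorial) := by
          rw [← mul_div_assoc, ← mul_div_assoc, mul_comm _ ((i + d).choose i : ℝ), hch, mul_comm]

/-- Each `‖w‖^i / i!` is at most `δ^(-i) e^(δ‖w‖)`, and the binomial theorem sums the rest. The rate
`δ` can be made small enough to be absorbed by the Gaussian-type factor of `v_k`, at a price only
geometric in `k`. -/
lemma norm_eval_lagPoly_le {α : ℝ} (h0 : -1 < α) (h1 : α < 0) (k : ℕ) (w : ℂ) {δ : ℝ}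
    (hδ : 0 < δ) :
    ‖(lagPoly α k).eval w‖ ≤ (δ⁻¹ + 1) ^ k * Real.exp (δ * ‖w‖) := by
  rw [lagPoly, Polynomial.eval_finsetSum, add_pow, Finset.sum_mul]
  refine (norm_sum_le _ _).trans (Finset.sum_le_sum fun i hi => ?_)
  rw [Finset.mem_range, Nat.lt_succ_iff] at hi
  obtain ⟨d, rfl⟩ := Nat.exists_eq_add_of_le hi
  simp only [Polynomial.eval_mul, Polynomial.eval_C, Polynomial.eval_pow, Polynomial.eval_X,
    norm_mul, norm_pow, Complex.norm_real, Real.norm_eq_abs, one_pow, mul_one]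
  have hexp := Real.pow_div_factorial_le_exp (δ * ‖w‖) (by positivity) i
  calc |lagCoef α (i + d) i| * ‖w‖ ^ i
      ≤ ((i + d).choose i : ℝ) / i.factorial * ‖w‖ ^ i := by
        gcongr
        exact abs_lagCoef_le h0 h1 i d
    _ = δ⁻¹ ^ i * ((i + d).choose i : ℝ) * ((δ * ‖w‖) ^ i / i.factorial) := by
        rw [mul_pow, inv_pow]
        field_simp
    _ ≤ _ := by gcongr

lemma abs_im_pow_le (z : ℂ) (k : ℕ) : |(z ^ (k + 1)).im| ≤ (k + 1) * |z.im| * ‖z‖ ^ k := by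
  induction k with
  | zero => simp
  | succ k ih =>
    rw [pow_succ, Complex.mul_im]
    calc |(z ^ (k + 1)).re * z.im + (z ^ (k + 1)).im * z.re|
        ≤ |(z ^ (k + 1)).re| * |z.im| + |(z ^ (k + 1)).im| * |z.re| := by
          rw [← abs_mul, ← abs_mul]; exact abs_add_le _ _
      _ ≤ ‖z‖ ^ (k + 1) * |z.im| + ((k + 1) * |z.im| * ‖z‖ ^ k) * ‖z‖ := by
          gcongr
          · rw [← norm_pow]; exact Complex.abs_re_le_norm _
          · exact Complex.abs_re_le_norm _
      _ = _ := by push_cast; ring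

/-- Here `Re z^(2k+2) = ‖z‖^(2k+2) - 2 (Im z^(k+1))²`, and `Im z^(k+1)` is at most `(k+1) |Im z|
‖z‖^k`. Either this correction is absorbed in half of the main term, or `‖z‖` is comparable to `|Im
z|`. Thus the exponential in `v_k` decays in all directions up to a factor depending on `Im z`
alone. -/
lemma neg_re_pow_le (z : ℂ) (k : ℕ) :
    -(z ^ (2 * k + 2)).re ≤ -(1 / 2) * ‖z‖ ^ (2 * k + 2)
      + 2 * ((k : ℝ) + 1) ^ 2 * (4 * ((k : ℝ) + 1) ^ 2) ^ k * |z.im| ^ (2 * k + 2) := by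
  have hre : (z ^ (2 * k + 2)).re = ‖z‖ ^ (2 * k + 2) - 2 * (z ^ (k + 1)).im ^ 2 := by
    have h1 : z ^ (2 * k + 2) = z ^ (k + 1) * z ^ (k + 1) := by rw [← pow_add]; congr 1; ring
    have h2 : ‖z‖ ^ (2 * k + 2) = ‖z ^ (k + 1)‖ ^ 2 := by
      rw [norm_pow, ← pow_mul]; congr 1; ring
    rw [h1, h2, Complex.mul_re, ← Complex.normSq_eq_norm_sq, Complex.normSq_apply]
    ring
  have him := abs_im_pow_le z k
  have him2 : (z ^ (k + 1)).im ^ 2 ≤ ((k : ℝ) + 1) ^ 2 * |z.im| ^ 2 * (‖z‖ ^ 2) ^ k := by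
    rw [← sq_abs]
    calc |(z ^ (k + 1)).im| ^ 2 ≤ ((k + 1) * |z.im| * ‖z‖ ^ k) ^ 2 := by gcongr
      _ = _ := by ring
  have hN : ‖z‖ ^ (2 * k + 2) = (‖z‖ ^ 2) ^ (k + 1) := by rw [← pow_mul]; congr 1
  have hy : |z.im| ^ (2 * k + 2) = (|z.im| ^ 2) ^ (k + 1) := by rw [← pow_mul]; congr 1
  rw [hre, hN, hy]
  set Y := ‖z‖ ^ 2 with hY
  set y := |z.im| ^ 2 with hyy
  have hY0 : 0 ≤ Y := by positivity
  have hy0 : 0 ≤ y := by positivity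
  have key : 2 * (((k : ℝ) + 1) ^ 2 * y * Y ^ k) ≤ 1 / 2 * Y ^ (k + 1)
      + 2 * ((k : ℝ) + 1) ^ 2 * (4 * ((k : ℝ) + 1) ^ 2) ^ k * y ^ (k + 1) := by
    rcases le_total (4 * ((k : ℝ) + 1) ^ 2 * y) Y with h | h
    · have : 2 * (((k : ℝ) + 1) ^ 2 * y * Y ^ k) ≤ 1 / 2 * Y ^ (k + 1) := by
        calc 2 * (((k : ℝ) + 1) ^ 2 * y * Y ^ k)
            = 1 / 2 * (4 * ((k : ℝ) + 1) ^ 2 * y) * Y ^ k := by ring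
          _ ≤ 1 / 2 * Y * Y ^ k := by gcongr
          _ = _ := by ring
      have : 0 ≤ 2 * ((k : ℝ) + 1) ^ 2 * (4 * ((k : ℝ) + 1) ^ 2) ^ k * y ^ (k + 1) := by positivity
      linarith
    · have : 2 * (((k : ℝ) + 1) ^ 2 * y * Y ^ k)
          ≤ 2 * ((k : ℝ) + 1) ^ 2 * (4 * ((k : ℝ) + 1) ^ 2) ^ k * y ^ (k + 1) := by
        calc 2 * (((k : ℝ) + 1) ^ 2 * y * Y ^ k)
            ≤ 2 * (((k : ℝ) + 1) ^ 2 * y * (4 * ((k : ℝ) + 1) ^ 2 * y) ^ k) := by gcongr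
          _ = _ := by rw [mul_pow]; ring
      have : 0 ≤ 1 / 2 * Y ^ (k + 1) := by positivity
      linarith
  linarith

lemma pow_le_const_mul_exp {x ε : ℝ} (hx : 0 ≤ x) (hε : 0 < ε) (j n : ℕ) :
    x ^ j ≤ (1 + j.factorial * ε⁻¹ ^ j) * Real.exp (ε * x ^ (2 * n + 2)) := by
  have hE : 1 ≤ Real.exp (ε * x ^ (2 * n + 2)) := Real.one_le_exp (by positivity)
  have hnn : 0 ≤ (j.factorial : ℝ) * ε⁻¹ ^ j := by positivity
  rcases le_total x 1 with h | h
  · calc x ^ j ≤ 1 := pow_le_one₀ hx h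
      _ ≤ (1 + j.factorial * ε⁻¹ ^ j) * 1 := by linarith
      _ ≤ _ := by gcongr
  · have h1 : x ^ j ≤ (x ^ (2 * n + 2)) ^ j := by
      gcongr
      exact le_self_pow₀ h (by omega)
    have h2 := Real.pow_div_factorial_le_exp (ε * x ^ (2 * n + 2)) (by positivity) j
    have hf : (0 : ℝ) < j.factorial := by positivity
    rw [div_le_iff₀ hf, mul_pow] at h2
    calc x ^ j ≤ (x ^ (2 * n + 2)) ^ j := h1
      _ = ε⁻¹ ^ j * (ε ^ j * (x ^ (2 * n + 2)) ^ j) := by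
          rw [← mul_assoc, ← mul_pow, inv_mul_cancel₀ hε.ne', one_pow, one_mul]
      _ ≤ ε⁻¹ ^ j * (Real.exp (ε * x ^ (2 * n + 2)) * j.factorial) := by gcongr
      _ = (j.factorial * ε⁻¹ ^ j) * Real.exp (ε * x ^ (2 * n + 2)) := by ring
      _ ≤ _ := by gcongr; linarith

/-- The decay of the exponential absorbs both `z^j` and the growth of the Laguerre polynomial. What
is left is geometric in `k` and depends only on `Im z`, so Cauchy estimates around real points will
be uniform in the point. -/
lemma norm_pow_mul_eigFunC_le (n j : ℕ) : ∃ B C : ℝ, 1 ≤ B ∧ 0 ≤ C ∧ ∀ (k : ℕ) (z : ℂ),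
    ‖z ^ j * eigFunC n k z‖ ≤ B ^ (k + 1) * Real.exp (C * |z.im| ^ (2 * n + 2)) := by
  set N : ℝ := 2 * n + 2 with hN
  have hN0 : 0 < N := by positivity
  set K : ℝ := 2 * ((n : ℝ) + 1) ^ 2 * (4 * ((n : ℝ) + 1) ^ 2) ^ n with hK
  have hK0 : 0 ≤ K := by positivity
  set A : ℝ := 1 + j.factorial * (4 * N) ^ j with hA
  have hA1 : 1 ≤ A := by
    have : (0 : ℝ) ≤ j.factorial * (4 * N) ^ j := by positivity
    linarith
  refine ⟨9 * A, K / N, by linarith, by positivity, fun k z => ?_⟩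
  set M := ‖z‖ ^ (2 * n + 2) with hM
  set y := |z.im| ^ (2 * n + 2) with hy
  have h1 : ‖z‖ ^ j ≤ A * Real.exp ((4 * N)⁻¹ * M) := by
    have := pow_le_const_mul_exp (norm_nonneg z) (ε := (4 * N)⁻¹) (by positivity) j n
    rwa [inv_inv] at this
  have h2 : ‖(lagPoly (alph n) k).eval (z ^ (2 * n + 2) / ((n : ℂ) + 1))‖
      ≤ 9 ^ k * Real.exp (1 / 8 * (M / (n + 1))) := by
    have := norm_eval_lagPoly_le (neg_one_lt_alph n) (alph_neg n) k
      (z ^ (2 * n + 2) / ((n : ℂ) + 1)) (δ := 1 / 8) (by norm_num)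
    have e : ‖z ^ (2 * n + 2) / ((n : ℂ) + 1)‖ = M / (n + 1) := by
      rw [norm_div, norm_pow]
      congr 1
      exact_mod_cast Complex.norm_natCast (n + 1)
    rw [e] at this
    norm_num at this ⊢
    exact this
  have h3 : ‖Complex.exp (-(z ^ (2 * n + 2) / (2 * n + 2)))‖
      ≤ Real.exp ((-(1 / 2) * M + K * y) / N) := by
    rw [Complex.norm_exp]
    apply Real.exp_le_exp.mpr
    have e : (z ^ (2 * n + 2) / (2 * (n : ℂ) + 2)) = z ^ (2 * n + 2) / ((N : ℝ) : ℂ) := by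
      rw [hN]; push_cast; rfl
    rw [Complex.neg_re, e, Complex.div_ofReal_re, ← neg_div]
    gcongr
    exact neg_re_pow_le z n
  have hfin : ‖z ^ j * eigFunC n k z‖ ≤ (A * Real.exp ((4 * N)⁻¹ * M)) *
      (Real.exp ((-(1 / 2) * M + K * y) / N) * (9 ^ k * Real.exp (1 / 8 * (M / (n + 1))))) := by
    rw [norm_mul, norm_pow, eigFunC, norm_mul]
    gcongr
  refine hfin.trans ?_
  have hexp : (A * Real.exp ((4 * N)⁻¹ * M)) *
      (Real.exp ((-(1 / 2) * M + K * y) / N) * (9 ^ k * Real.exp (1 / 8 * (M / (n + 1)))))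
      = A * 9 ^ k * Real.exp (K / N * y) := by
    -- Since `n + 1 = N/2`, the coefficients of `M` are `1/(4N) - 1/(2N) + 1/(4N) = 0`: the rate
    -- `(4N)⁻¹` for `z^j` and `δ = 1/8` for the Laguerre polynomial use up exactly the available
    -- decay.
    have : (4 * N)⁻¹ * M + ((-(1 / 2) * M + K * y) / N + 1 / 8 * (M / (n + 1))) = K / N * y := by
      have : (n : ℝ) + 1 = N / 2 := by rw [hN]; ring
      rw [this]
      field_simp
      ring
    rw [← this, Real.exp_add, Real.exp_add]
    ring
  rw [hexp]
  gcongr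
  rw [mul_pow, pow_succ 9 k, pow_succ A k]
  have h9 : (9 : ℝ) ^ k ≤ 9 ^ k * 9 := by
    have : (0 : ℝ) < 9 ^ k := by positivity
    linarith
  have hAk : A ≤ A ^ k * A := by
    have := one_le_pow₀ hA1 (n := k)
    nlinarith
  calc A * 9 ^ k ≤ (A ^ k * A) * (9 ^ k * 9) := by gcongr
    _ = _ := by ring

/-- The `a`-th derivative of `t^j v_k(t)`. -/
noncomputable def eigDeriv (n j k a : ℕ) (t : ℝ) : ℂ :=
  iteratedDeriv a (fun z : ℂ => z ^ j * eigFunC n k z) (t : ℂ)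

lemma differentiable_pow_mul_eigFunC (n j k : ℕ) :
    Differentiable ℂ (fun z : ℂ => z ^ j * eigFunC n k z) :=
  (differentiable_id.pow j).mul (differentiable_eigFunC n k)

lemma hasDerivAt_eigDeriv (n j k a : ℕ) (t : ℝ) :
    HasDerivAt (eigDeriv n j k a) (eigDeriv n j k (a + 1) t) t := by
  have hd : Differentiable ℂ (iteratedDeriv a (fun z : ℂ => z ^ j * eigFunC n k z)) :=
    ((differentiable_pow_mul_eigFunC n j k).contDiff (n := ⊤)).differentiable_iteratedDeriv a
      (WithTop.coe_lt_top _)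
  have := (hd (t : ℂ)).hasDerivAt.comp_ofReal
  rwa [← iteratedDeriv_succ] at this

lemma continuous_eigDeriv (n j k a : ℕ) : Continuous (eigDeriv n j k a) :=
  continuous_iff_continuousAt.mpr fun t => (hasDerivAt_eigDeriv n j k a t).continuousAt

lemma eigDeriv_zero (n j k : ℕ) (t : ℝ) :
    eigDeriv n j k 0 t = (t : ℂ) ^ j * (eigFun n k t : ℂ) := by
  simp [eigDeriv, eigFunC_ofReal]

/-- Cauchy's estimate on the circle of radius `s` about `t`, on which `|Im z| ≤ s`. The radius stays
free: `s = 1` serves for integrability, a power of `ρ` for the Beurling bounds. -/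
lemma norm_eigDeriv_le (n j : ℕ) : ∃ B C : ℝ, 1 ≤ B ∧ 0 ≤ C ∧
    ∀ (k a : ℕ) (t s : ℝ), 0 < s → ‖eigDeriv n j k a t‖ ≤
      a.factorial * (B ^ (k + 1) * Real.exp (C * s ^ (2 * n + 2))) / s ^ a := by
  obtain ⟨B, C, hB, hC, h⟩ := norm_pow_mul_eigFunC_le n j
  refine ⟨B, C, hB, hC, fun k a t s hs => ?_⟩
  refine Complex.norm_iteratedDeriv_le_of_forall_mem_sphere_norm_le a hs
    (differentiable_pow_mul_eigFunC n j k).diffContOnCl fun z hz => (h k z).trans ?_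
  gcongr
  have : |(z - t).im| ≤ ‖z - t‖ := Complex.abs_im_le_norm _
  rw [mem_sphere_iff_norm.mp hz] at this
  simpa using this

lemma eigDeriv_euler (n k : ℕ) (t : ℝ) :
    (t : ℂ) * eigDeriv n 0 k 1 t = ((n : ℂ) + 1) * (((k : ℂ) + 1) * eigDeriv n 0 (k + 1) 0 t
      - (1 + (alph n : ℂ)) * eigDeriv n 0 k 0 t
      - (if k = 0 then 0 else ((k : ℂ) + alph n) * eigDeriv n 0 (k - 1) 0 t)) := by
  simpa [eigDeriv] using eigFunC_euler n k t

lemma eigDeriv_ode (n k : ℕ) (t : ℝ) :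
    -eigDeriv n 0 k 2 t + (t : ℂ) ^ (4 * n + 2) * eigDeriv n 0 k 0 t =
      (eig n k : ℂ) * eigDeriv n (2 * n) k 0 t := by
  have := eigFunC_ode n k t
  simp only [eigDeriv, iteratedDeriv_succ, iteratedDeriv_zero, pow_zero, one_mul] at this ⊢
  rw [this]
  ring

end MetivierGen

namespace MetivierGen
open MeasureTheory Filter Topology

/-! ### Smooth integrals with two real parameters -/

/-- A family `F a b x y ρ`, standing for `∂_x^a ∂_y^b F 0 0`, with integrable bounds uniform in
`x`, `y`. -/
structure IsDominatedFamily (μ : Measure ℝ) (F : ℕ → ℕ → ℝ → ℝ → ℝ → ℂ) : Prop where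
  meas : ∀ a b x y, AEStronglyMeasurable (F a b x y) μ
  cont : ∀ a b ρ, Continuous (fun z : ℝ × ℝ => F a b z.1 z.2 ρ)
  bound : ∀ a b, ∃ B : ℝ → ℝ, Integrable B μ ∧ ∀ᵐ ρ ∂μ, ∀ x y, ‖F a b x y ρ‖ ≤ B ρ
  deriv_x : ∀ a b x y ρ, HasDerivAt (fun x' => F a b x' y ρ) (F (a + 1) b x y ρ) x
  deriv_y : ∀ a b x y ρ, HasDerivAt (fun y' => F a b x y' ρ) (F a (b + 1) x y ρ) y

variable {μ : Measure ℝ} {F : ℕ → ℕ → ℝ → ℝ → ℝ → ℂ}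

namespace IsDominatedFamily

lemma integrable (h : IsDominatedFamily μ F) (a b : ℕ) (x y : ℝ) : Integrable (F a b x y) μ := by
  obtain ⟨B, hB, hle⟩ := h.bound a b
  exact hB.mono' (h.meas a b x y) (hle.mono fun ρ hρ => hρ x y)

lemma hasDerivAt_x (h : IsDominatedFamily μ F) (a b : ℕ) (x y : ℝ) :
    HasDerivAt (fun x' => ∫ ρ, F a b x' y ρ ∂μ) (∫ ρ, F (a + 1) b x y ρ ∂μ) x := by
  obtain ⟨B, hB, hle⟩ := h.bound (a + 1) b
  exact (hasDerivAt_integral_of_dominated_loc_of_deriv_le (F := fun x' ρ => F a b x' y ρ)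
    (F' := fun x' ρ => F (a + 1) b x' y ρ) univ_mem
    (Eventually.of_forall fun x' => h.meas a b x' y) (h.integrable a b x y) (h.meas _ _ _ _)
    (hle.mono fun ρ hρ x' _ => hρ x' y) hB
    (Eventually.of_forall fun ρ x' _ => h.deriv_x a b x' y ρ)).2

lemma hasDerivAt_y (h : IsDominatedFamily μ F) (a b : ℕ) (x y : ℝ) :
    HasDerivAt (fun y' => ∫ ρ, F a b x y' ρ ∂μ) (∫ ρ, F a (b + 1) x y ρ ∂μ) y := by
  obtain ⟨B, hB, hle⟩ := h.bound a (b + 1)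
  exact (hasDerivAt_integral_of_dominated_loc_of_deriv_le (F := fun y' ρ => F a b x y' ρ)
    (F' := fun y' ρ => F a (b + 1) x y' ρ) univ_mem
    (Eventually.of_forall fun y' => h.meas a b x y') (h.integrable a b x y) (h.meas _ _ _ _)
    (hle.mono fun ρ hρ y' _ => hρ x y') hB
    (Eventually.of_forall fun ρ y' _ => h.deriv_y a b x y' ρ)).2

lemma continuous_integral (h : IsDominatedFamily μ F) (a b : ℕ) :
    Continuous (fun z : ℝ × ℝ => ∫ ρ, F a b z.1 z.2 ρ ∂μ) := by
  obtain ⟨B, hB, hle⟩ := h.bound a b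
  exact continuous_of_dominated (fun z => h.meas a b z.1 z.2)
    (fun z => hle.mono fun ρ hρ => hρ z.1 z.2) hB (Eventually.of_forall fun ρ => h.cont a b ρ)

/-- Both partial derivatives exist by differentiation under the integral and are jointly continuous
by dominated convergence, which gives the total derivative. -/
lemma hasFDerivAt_integral (h : IsDominatedFamily μ F) (a b : ℕ) (z : ℝ × ℝ) :
    HasFDerivAt (fun z : ℝ × ℝ => ∫ ρ, F a b z.1 z.2 ρ ∂μ)
      ((ContinuousLinearMap.fst ℝ ℝ ℝ).smulRight (∫ ρ, F (a + 1) b z.1 z.2 ρ ∂μ) +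
        (ContinuousLinearMap.snd ℝ ℝ ℝ).smulRight (∫ ρ, F a (b + 1) z.1 z.2 ρ ∂μ)) z := by
  have key := hasStrictFDerivAt_uncurry_coprod (𝕜 := ℝ) (u := z)
    (f := fun x y => ∫ ρ, F a b x y ρ ∂μ)
    (f₁ := fun x y => ContinuousLinearMap.toSpanSingleton ℝ (∫ ρ, F (a + 1) b x y ρ ∂μ))
    (f₂ := fun x y => ContinuousLinearMap.toSpanSingleton ℝ (∫ ρ, F a (b + 1) x y ρ ∂μ))
    (Eventually.of_forall fun v => (h.hasDerivAt_x a b v.1 v.2).hasFDerivAt)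
    (Eventually.of_forall fun v => (h.hasDerivAt_y a b v.1 v.2).hasFDerivAt)
    ((ContinuousLinearMap.toSpanSingletonCLE (𝕜 := ℝ) (E := ℂ)).continuous.comp
      (h.continuous_integral (a + 1) b)).continuousAt
    ((ContinuousLinearMap.toSpanSingletonCLE (𝕜 := ℝ) (E := ℂ)).continuous.comp
      (h.continuous_integral a (b + 1))).continuousAt
  refine key.hasFDerivAt.congr_fderiv ?_
  ext <;> simp [Function.HasUncurry.uncurry]

/-- The family is closed under both partial derivatives, so the induction on `N` runs over all pairs
`(a, b)` at once. -/
lemma contDiff_nat (h : IsDominatedFamily μ F) (N : ℕ) : ∀ a b : ℕ,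
    ContDiff ℝ N (fun z : ℝ × ℝ => ∫ ρ, F a b z.1 z.2 ρ ∂μ) := by
  induction N with
  | zero => exact fun a b => contDiff_zero.mpr (h.continuous_integral a b)
  | succ N ih =>
    intro a b
    have := (contDiff_succ_iff_hasFDerivAt (𝕜 := ℝ) (n := N)
      (f := fun z : ℝ × ℝ => ∫ ρ, F a b z.1 z.2 ρ ∂μ)).mpr
      ⟨_, ?_, fun z => h.hasFDerivAt_integral a b z⟩
    · exact_mod_cast this
    · exact (contDiff_const.smulRight (ih (a + 1) b)).add (contDiff_const.smulRight (ih a (b + 1)))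

lemma isSmooth (h : IsDominatedFamily μ F) (a b : ℕ) :
    IsSmooth (fun x y => ∫ ρ, F a b x y ρ ∂μ) :=
  contDiff_infty.mpr fun N => h.contDiff_nat N a b

lemma mixedDeriv_eq (h : IsDominatedFamily μ F) (a b : ℕ) (x y : ℝ) :
    mixedDeriv a b (fun x y => ∫ ρ, F 0 0 x y ρ ∂μ) x y = ∫ ρ, F a b x y ρ ∂μ := by
  have hy : ∀ b x, iteratedDeriv b (fun y' => ∫ ρ, F 0 0 x y' ρ ∂μ) =
      fun y => ∫ ρ, F 0 b x y ρ ∂μ := by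
    intro b x
    induction b with
    | zero => simp
    | succ b ih =>
      rw [iteratedDeriv_succ, ih]
      exact funext fun y => (h.hasDerivAt_y 0 b x y).deriv
  have hx : ∀ a y, iteratedDeriv a (fun x' => ∫ ρ, F 0 b x' y ρ ∂μ) =
      fun x => ∫ ρ, F a b x y ρ ∂μ := by
    intro a y
    induction a with
    | zero => simp
    | succ a ih =>
      rw [iteratedDeriv_succ, ih]
      exact funext fun x => (h.hasDerivAt_x a b x y).deriv
  unfold mixedDeriv
  simp only [hy]
  rw [hx]

end IsDominatedFamily

end MetivierGen

namespace MetivierGen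
open MeasureTheory Filter Topology

/-! ### The roots `λ_j` -/

lemma lam_eq (m j : ℕ) : lam m j =
    Complex.exp (((Real.pi / (2 * m) * (1 + 2 * j) : ℝ) : ℂ) * Complex.I) := by
  rw [lam, mul_comm]

lemma lam_im (m j : ℕ) : (lam m j).im = Real.sin (Real.pi / (2 * m) * (1 + 2 * j)) := by
  rw [lam_eq, Complex.exp_ofReal_mul_I_im]

lemma norm_lam (m j : ℕ) : ‖lam m j‖ = 1 := by
  rw [lam_eq, Complex.norm_exp_ofReal_mul_I]

lemma lam_pow (m : ℕ) (hm : 0 < m) (j : ℕ) : lam m j ^ (2 * m) = -1 := by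
  have hm' : (m : ℂ) ≠ 0 := by exact_mod_cast hm.ne'
  rw [lam, ← Complex.exp_nat_mul]
  have : ((2 * m : ℕ) : ℂ) * (Complex.I * ((Real.pi / (2 * m) * (1 + 2 * j) : ℝ) : ℂ))
      = Real.pi * Complex.I + j * (2 * Real.pi * Complex.I) := by
    push_cast
    field_simp
  rw [this, Complex.exp_add, Complex.exp_pi_mul_I, Complex.exp_nat_mul_two_pi_mul_I]
  ring

lemma lam_add (m : ℕ) (hm : 0 < m) (j : ℕ) : lam m (j + m) = -lam m j := by
  have hm' : (m : ℂ) ≠ 0 := by exact_mod_cast hm.ne'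
  rw [lam, lam]
  have : Complex.I * ((Real.pi / (2 * m) * (1 + 2 * (j + m : ℕ)) : ℝ) : ℂ)
      = Complex.I * ((Real.pi / (2 * m) * (1 + 2 * j) : ℝ) : ℂ) + Real.pi * Complex.I := by
    push_cast
    field_simp
    ring
  rw [this, Complex.exp_add, Complex.exp_pi_mul_I]
  ring

/-- The summands form a geometric progression whose ratio is a root of unity different from `1`.
This vanishing removes the source from the derivatives of `greenSol` of order below `2m`. -/
lemma sum_lam_pow (m : ℕ) (hm : 0 < m) (e : ℕ) (he : 0 < e) (he' : e < 2 * m) :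
    ∑ j ∈ Finset.range (2 * m), lam m j ^ e = 0 := by
  have hm' : (m : ℂ) ≠ 0 := by exact_mod_cast hm.ne'
  have hζ := Complex.isPrimitiveRoot_exp (2 * m) (by omega)
  set ζ := Complex.exp (2 * Real.pi * Complex.I / ((2 * m : ℕ) : ℂ)) with hζd
  have hl : ∀ j, lam m j ^ e = lam m 0 ^ e * (ζ ^ e) ^ j := by
    intro j
    rw [← pow_mul, mul_comm e j, pow_mul, ← mul_pow]
    congr 1
    rw [lam, lam, hζd, ← Complex.exp_nat_mul, ← Complex.exp_add]
    congr 1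
    push_cast
    field_simp
    ring
  rw [Finset.sum_congr rfl fun j _ => hl j, ← Finset.mul_sum]
  have hne : ζ ^ e ≠ 1 := hζ.pow_ne_one_of_pos_of_lt he.ne' he'
  have := mul_geom_sum (ζ ^ e) (2 * m)
  rw [← pow_mul, mul_comm e, pow_mul, hζ.pow_eq_one, one_pow, sub_self] at this
  rcases mul_eq_zero.mp this with h | h
  · exact absurd (sub_eq_zero.mp h) hne
  · rw [h, mul_zero]

/-- `Im λ_j - Im λ_0` as a product. -/
lemma lam_im_sub (m : ℕ) (j : ℕ) : (lam m j).im - (lam m 0).im =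
    2 * Real.sin (Real.pi / (2 * m) * j) * Real.cos (Real.pi / (2 * m) * (j + 1)) := by
  rw [lam_im, lam_im, Real.sin_sub_sin]
  congr 3 <;> push_cast <;> ring

lemma lam_im_zero_pos (m : ℕ) (hm : 0 < m) : 0 < (lam m 0).im := by
  have hm' : (1 : ℝ) ≤ m := by exact_mod_cast hm
  rw [lam_im]
  apply Real.sin_pos_of_pos_of_lt_pi
  · have := Real.pi_pos
    positivity
  · have h1 : Real.pi / (2 * m) ≤ Real.pi / 2 := by
      apply div_le_div_of_nonneg_left Real.pi_pos.le (by norm_num) (by linarith)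
    have := Real.pi_pos
    push_cast
    linarith

lemma lam_im_le (m j : ℕ) (hm : 0 < m) (hj : j < m) : (lam m 0).im ≤ (lam m j).im := by
  have hm' : (0 : ℝ) < m := by exact_mod_cast hm
  have hj' : ((j : ℝ) + 1) ≤ m := by exact_mod_cast hj
  have hpi := Real.pi_pos
  rw [← sub_nonneg, lam_im_sub]
  have hb : Real.pi / (2 * m) * (j + 1) ≤ Real.pi / 2 := by
    rw [div_mul_eq_mul_div, div_le_div_iff₀ (by positivity) (by norm_num)]
    nlinarith
  have hp : 0 < Real.pi / (2 * m) := by positivity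
  have h1 : 0 ≤ Real.sin (Real.pi / (2 * m) * j) :=
    Real.sin_nonneg_of_nonneg_of_le_pi (by positivity) (by nlinarith)
  have h2 : 0 ≤ Real.cos (Real.pi / (2 * m) * (j + 1)) :=
    Real.cos_nonneg_of_neg_pi_div_two_le_of_le (by nlinarith [mul_pos hp (Nat.cast_add_one_pos (α := ℝ) j)]) hb
  positivity

lemma lam_im_lt (m j : ℕ) (hj0 : 0 < j) (hj : j + 1 < m) : (lam m 0).im < (lam m j).im := by
  have hm' : (0 : ℝ) < m := by exact_mod_cast (by omega : 0 < m)
  have hj' : ((j : ℝ) + 1) < m := by exact_mod_cast hj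
  have hj0' : (0 : ℝ) < j := by exact_mod_cast hj0
  have hpi := Real.pi_pos
  rw [← sub_pos, lam_im_sub]
  have hb : Real.pi / (2 * m) * (j + 1) < Real.pi / 2 := by
    rw [div_mul_eq_mul_div, div_lt_div_iff₀ (by positivity) (by norm_num)]
    nlinarith
  have hp : 0 < Real.pi / (2 * m) := by positivity
  have h1 : 0 < Real.sin (Real.pi / (2 * m) * j) :=
    Real.sin_pos_of_pos_of_lt_pi (by positivity) (by nlinarith)
  have h2 : 0 < Real.cos (Real.pi / (2 * m) * (j + 1)) :=
    Real.cos_pos_of_mem_Ioo ⟨by nlinarith [mul_pos hp (Nat.cast_add_one_pos (α := ℝ) j)], hb⟩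
  positivity

/-- The roots `0` and `m - 1` are mirror images in the imaginary axis, so there are two resonant
roots, which coincide when `m = 1`. -/
lemma lam_im_last (m : ℕ) (hm : 0 < m) : (lam m (m - 1)).im = (lam m 0).im := by
  have hm' : (m : ℝ) ≠ 0 := by exact_mod_cast hm.ne'
  rw [lam_im, lam_im, ← Real.sin_pi_sub]
  congr 1
  rw [Nat.cast_sub hm]
  push_cast
  field_simp
  ring

/-- The non-resonant roots are separated from the resonant ones. -/
lemma exists_gap (m : ℕ) : ∃ η : ℝ, 0 < η ∧ ∀ j, 0 < j → j + 1 < m →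
    (lam m 0).im + η ≤ (lam m j).im := by
  by_cases hne : (Finset.Ioo 0 (m - 1)).Nonempty
  · obtain ⟨j0, hj0, hmin⟩ := Finset.exists_min_image (Finset.Ioo 0 (m - 1))
      (fun j => (lam m j).im) hne
    rw [Finset.mem_Ioo] at hj0
    refine ⟨(lam m j0).im - (lam m 0).im, sub_pos.mpr (lam_im_lt m j0 hj0.1 (by omega)), ?_⟩
    intro j h1 h2
    have := hmin j (Finset.mem_Ioo.mpr ⟨h1, by omega⟩)
    linarith
  · refine ⟨1, one_pos, fun j h1 h2 => ?_⟩
    exact absurd ⟨j, Finset.mem_Ioo.mpr ⟨h1, by omega⟩⟩ hne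

/-! ### First-order equations `Y' = μ Y + F` -/

/-- A solution of `Y' = μ Y + F`. -/
noncomputable def odeSol (μ : ℂ) (F : ℝ → ℂ) (κ : ℂ) (ρ : ℝ) : ℂ :=
  Complex.exp (μ * ρ) * ((∫ τ in (0 : ℝ)..ρ, Complex.exp (-(μ * τ)) * F τ) - κ)

/-- The constant `κ` only adds a homogeneous solution. Taking `κ = 0` integrates forward from `0`;
taking `κ` to be the total integral integrates backward from infinity, see
`IsSource.odeSol_backward`. -/
lemma hasDerivAt_odeSol (μ : ℂ) {F : ℝ → ℂ} (hF : Continuous F) (κ : ℂ) (ρ : ℝ) :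
    HasDerivAt (odeSol μ F κ) (μ * odeSol μ F κ ρ + F ρ) ρ := by
  have hc : Continuous (fun τ : ℝ => Complex.exp (-(μ * τ)) * F τ) := by fun_prop
  have h1 : HasDerivAt (fun ρ : ℝ => Complex.exp (μ * ρ)) (Complex.exp (μ * ρ) * μ) ρ := by
    have := ((hasDerivAt_id (ρ : ℂ)).const_mul μ).cexp.comp_ofReal
    simpa using this
  have h2 := (intervalIntegral.integral_hasDerivAt_right (hc.intervalIntegrable 0 ρ)
    (hc.stronglyMeasurableAtFilter _ _) hc.continuousAt).sub_const κ
  refine (h1.mul h2).congr_deriv ?_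
  have : Complex.exp (μ * ρ) * Complex.exp (-(μ * ρ)) = 1 := by
    rw [← Complex.exp_add, add_neg_cancel, Complex.exp_zero]
  simp only [odeSol]
  linear_combination F ρ * this

lemma contDiff_odeSol (μ : ℂ) {F : ℝ → ℂ} (hF : ContDiff ℝ ((⊤ : ℕ∞) : WithTop ℕ∞) F) (κ : ℂ) :
    ContDiff ℝ ((⊤ : ℕ∞) : WithTop ℕ∞) (odeSol μ F κ) := by
  refine contDiff_infty.mpr fun N => ?_
  have hd : deriv (odeSol μ F κ) = fun ρ => μ * odeSol μ F κ ρ + F ρ :=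
    funext fun ρ => (hasDerivAt_odeSol μ hF.continuous κ ρ).deriv
  have hdiff : Differentiable ℝ (odeSol μ F κ) := fun ρ =>
    (hasDerivAt_odeSol μ hF.continuous κ ρ).differentiableAt
  induction N with
  | zero => exact contDiff_zero.mpr hdiff.continuous
  | succ N ih =>
    rw [show ((N + 1 : ℕ) : WithTop ℕ∞) = (N : WithTop ℕ∞) + 1 by norm_cast,
      contDiff_succ_iff_deriv]
    refine ⟨hdiff, fun h => absurd h (by simp), ?_⟩
    rw [hd]
    exact (contDiff_const.mul ih).add (contDiff_infty.mp hF N)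

/-- Right-hand sides supported in `[ρ₀, ∞)` and `O(τ^(-L) e^(-στ))`. -/
structure IsSource (ρ₀ σ B : ℝ) (L : ℕ) (F : ℝ → ℂ) : Prop where
  cont : Continuous F
  zero : ∀ τ, τ < ρ₀ → F τ = 0
  bound : ∀ τ, ρ₀ ≤ τ → ‖F τ‖ ≤ B * (τ ^ L)⁻¹ * Real.exp (-(σ * τ))
  pos : 0 < ρ₀

namespace IsSource

variable {ρ₀ σ B : ℝ} {L : ℕ} {F : ℝ → ℂ}

lemma nonneg (h : IsSource ρ₀ σ B L F) : 0 ≤ B := by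
  have h1 := (norm_nonneg _).trans (h.bound ρ₀ le_rfl)
  have h2 : 0 < (ρ₀ ^ L)⁻¹ := inv_pos.mpr (pow_pos h.pos L)
  have h3 := Real.exp_pos (-(σ * ρ₀))
  by_contra hB
  push Not at hB
  have := mul_neg_of_neg_of_pos (mul_neg_of_neg_of_pos hB h2) h3
  linarith

lemma norm_exp_mul_le (h : IsSource ρ₀ σ B L F) (μ : ℂ) {ρ τ : ℝ} (hτ : ρ₀ ≤ τ) :
    ‖Complex.exp (μ * ρ) * (Complex.exp (-(μ * τ)) * F τ)‖ ≤
      Real.exp (μ.re * (ρ - τ)) * (B * (τ ^ L)⁻¹ * Real.exp (-(σ * τ))) := by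
  rw [← mul_assoc, ← Complex.exp_add, norm_mul, Complex.norm_exp]
  have : (μ * ρ + -(μ * τ)).re = μ.re * (ρ - τ) := by
    simp [Complex.mul_re]; ring
  rw [this]
  gcongr
  exact h.bound τ hτ

/-- Forward integration along a strongly decaying exponential. -/
lemma norm_forward_le (h : IsSource ρ₀ σ B L F) {μ : ℂ} {δ : ℝ} (hδ : 0 < δ)
    (hμ : μ.re ≤ -(σ + δ)) (hL : (L : ℝ) ≤ δ / 2 * ρ₀) {ρ : ℝ} (hρ : ρ₀ ≤ ρ) :
    ‖odeSol μ F 0 ρ‖ ≤ B * (ρ ^ L)⁻¹ * Real.exp (-(σ * ρ)) * (2 / δ) := by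
  have hρ0 : 0 < ρ := h.pos.trans_le hρ
  have hB := h.nonneg
  set A := B * (ρ ^ L)⁻¹ * Real.exp (-(σ * ρ)) with hA
  have hA0 : 0 ≤ A := by positivity
  have hpt : ∀ τ ∈ Set.Ioc 0 ρ, ‖Complex.exp (μ * ρ) * (Complex.exp (-(μ * τ)) * F τ)‖ ≤
      A * Real.exp (-(δ / 2) * (ρ - τ)) := by
    intro τ hτ
    rcases lt_or_ge τ ρ₀ with hlt | hge
    · rw [h.zero τ hlt]
      simp only [mul_zero, norm_zero]
      positivity
    · refine (h.norm_exp_mul_le μ hge).trans ?_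
      have hτ0 := hτ.1
      have hsub : 0 ≤ ρ - τ := sub_nonneg.mpr hτ.2
      -- Half of the gap `δ` pays for moving the power from `τ` to `ρ`: `(ρ/τ)^L ≤ exp(L(ρ-τ)/τ)`,
      -- and `L ≤ δτ/2` on the support of the source. This is why the cutoffs start at a multiple of
      -- `ℓ + 1`.
      have e1 : (τ ^ L)⁻¹ ≤ (ρ ^ L)⁻¹ * Real.exp (δ / 2 * (ρ - τ)) := by
        have : (ρ / τ) ^ L ≤ Real.exp (δ / 2 * (ρ - τ)) := by
          have h1 : ρ / τ ≤ Real.exp (ρ / τ - 1) := by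
            have := Real.add_one_le_exp (ρ / τ - 1); linarith
          calc (ρ / τ) ^ L ≤ Real.exp (ρ / τ - 1) ^ L := by gcongr
            _ = Real.exp (L * (ρ / τ - 1)) := by rw [← Real.exp_nat_mul]
            _ ≤ _ := by
              apply Real.exp_le_exp.mpr
              have h2 : (L : ℝ) ≤ δ / 2 * τ := hL.trans (by gcongr)
              have h3 : ρ / τ - 1 = (ρ - τ) / τ := by field_simp
              rw [h3, mul_div_assoc', div_le_iff₀ hτ0]
              nlinarith
        rw [div_pow] at this
        rw [inv_mul_eq_div, le_div_iff₀ (by positivity), inv_mul_eq_div]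
        exact this
      have e2 : Real.exp (μ.re * (ρ - τ)) ≤ Real.exp (-(σ + δ) * (ρ - τ)) := by gcongr
      calc Real.exp (μ.re * (ρ - τ)) * (B * (τ ^ L)⁻¹ * Real.exp (-(σ * τ)))
          ≤ Real.exp (-(σ + δ) * (ρ - τ)) *
            (B * ((ρ ^ L)⁻¹ * Real.exp (δ / 2 * (ρ - τ))) * Real.exp (-(σ * τ))) := by gcongr
        _ = A * Real.exp (-(δ / 2) * (ρ - τ)) := by
          have : -(σ + δ) * (ρ - τ) + δ / 2 * (ρ - τ) + -(σ * τ)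
              = -(σ * ρ) + -(δ / 2) * (ρ - τ) := by ring
          calc _ = B * (ρ ^ L)⁻¹ * Real.exp (-(σ + δ) * (ρ - τ) + δ / 2 * (ρ - τ) + -(σ * τ)) := by
                rw [Real.exp_add, Real.exp_add]; ring
            _ = _ := by rw [this, Real.exp_add, hA]; ring
  rw [odeSol, sub_zero, ← intervalIntegral.integral_const_mul]
  refine (intervalIntegral.norm_integral_le_of_norm_le hρ0.le
    (Eventually.of_forall fun τ hτ => hpt τ hτ)
    (Continuous.intervalIntegrable (by fun_prop) _ _)).trans ?_
  rw [intervalIntegral.integral_const_mul]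
  gcongr
  have hd : ∀ τ ∈ Set.uIcc 0 ρ, HasDerivAt (fun τ => 2 / δ * Real.exp (-(δ / 2) * (ρ - τ)))
      (Real.exp (-(δ / 2) * (ρ - τ))) τ := by
    intro τ _
    have := ((((hasDerivAt_id τ).const_sub ρ).const_mul (-(δ / 2))).exp).const_mul (2 / δ)
    refine this.congr_deriv ?_
    simp only [id]
    field_simp
  rw [intervalIntegral.integral_eq_sub_of_hasDerivAt hd
    (Continuous.intervalIntegrable (by fun_prop) _ _)]
  simp only [sub_self, mul_zero, Real.exp_zero, mul_one, sub_zero]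
  have : 0 ≤ 2 / δ * Real.exp (-(δ / 2) * ρ) := by positivity
  linarith

lemma integrable_of_lt (h : IsSource ρ₀ σ B L F) {μ : ℂ} (hμ : -σ < μ.re) :
    Integrable (fun τ : ℝ => Complex.exp (-(μ * τ)) * F τ) := by
  have hB := h.nonneg
  have hc : Continuous (fun τ : ℝ => Complex.exp (-(μ * τ)) * F τ) := by
    have := h.cont; fun_prop
  have hg : IntegrableOn (fun τ : ℝ => B * (ρ₀ ^ L)⁻¹ * Real.exp (-(μ.re + σ) * τ))
      (Set.Ici ρ₀) := by
    rw [integrableOn_Ici_iff_integrableOn_Ioi]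
    exact (exp_neg_integrableOn_Ioi ρ₀ (by linarith)).const_mul _
  refine (hg.integrable_indicator measurableSet_Ici).mono' hc.aestronglyMeasurable
    (Eventually.of_forall fun τ => ?_)
  by_cases hτ : ρ₀ ≤ τ
  · rw [Set.indicator_of_mem (Set.mem_Ici.mpr hτ)]
    have := h.norm_exp_mul_le μ (ρ := 0) hτ
    simp only [Complex.ofReal_zero, mul_zero, Complex.exp_zero, one_mul] at this
    refine this.trans ?_
    have h0 := h.pos
    have : (τ ^ L)⁻¹ ≤ (ρ₀ ^ L)⁻¹ := by gcongr
    calc _ ≤ Real.exp (μ.re * (0 - τ)) * (B * (ρ₀ ^ L)⁻¹ * Real.exp (-(σ * τ))) := by gcongr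
      _ = B * (ρ₀ ^ L)⁻¹ * Real.exp (-(μ.re + σ) * τ) := by
        rw [show -(μ.re + σ) * τ = μ.re * (0 - τ) + -(σ * τ) by ring, Real.exp_add]; ring
  · rw [Set.indicator_of_notMem (by simpa using hτ), h.zero τ (not_le.mp hτ)]
    simp

/-- At the critical rate `μ.re = -σ` the exponentials cancel and convergence rests on the power
alone; hence the exponent `L + 2`. -/
lemma integrable_of_le (h : IsSource ρ₀ σ B (L + 2) F) {μ : ℂ} (hμ : -σ ≤ μ.re) :
    Integrable (fun τ : ℝ => Complex.exp (-(μ * τ)) * F τ) := by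
  have hB := h.nonneg
  have h0 := h.pos
  have hc : Continuous (fun τ : ℝ => Complex.exp (-(μ * τ)) * F τ) := by
    have := h.cont; fun_prop
  have hg : IntegrableOn (fun τ : ℝ => B * τ ^ (-((L + 2 : ℕ) : ℝ))) (Set.Ici ρ₀) := by
    rw [integrableOn_Ici_iff_integrableOn_Ioi]
    exact (integrableOn_Ioi_rpow_of_lt (by push_cast; linarith [(Nat.cast_nonneg L : (0:ℝ) ≤ L)])
      h0).const_mul _
  refine (hg.integrable_indicator measurableSet_Ici).mono' hc.aestronglyMeasurable
    (Eventually.of_forall fun τ => ?_)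
  by_cases hτ : ρ₀ ≤ τ
  · rw [Set.indicator_of_mem (Set.mem_Ici.mpr hτ)]
    have := h.norm_exp_mul_le μ (ρ := 0) hτ
    simp only [Complex.ofReal_zero, mul_zero, Complex.exp_zero, one_mul] at this
    refine this.trans ?_
    have hτ0 := h0.trans_le hτ
    rw [Real.rpow_neg hτ0.le, Real.rpow_natCast]
    calc _ = B * (τ ^ (L + 2))⁻¹ * (Real.exp (μ.re * (0 - τ)) * Real.exp (-(σ * τ))) := by ring
      _ ≤ B * (τ ^ (L + 2))⁻¹ * 1 := by
        gcongr
        rw [← Real.exp_add, Real.exp_le_one_iff]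
        nlinarith
      _ = _ := mul_one _
  · rw [Set.indicator_of_notMem (by simpa using hτ), h.zero τ (not_le.mp hτ)]
    simp

lemma odeSol_backward (h : IsSource ρ₀ σ B L F) {μ : ℂ}
    (hi : Integrable (fun τ : ℝ => Complex.exp (-(μ * τ)) * F τ)) (ρ : ℝ) :
    odeSol μ F (∫ τ : ℝ, Complex.exp (-(μ * τ)) * F τ) ρ =
      -∫ τ : ℝ in Set.Ioi ρ, Complex.exp (μ * ρ) * (Complex.exp (-(μ * τ)) * F τ) := by
  have h1 : ∫ τ : ℝ, Complex.exp (-(μ * τ)) * F τ =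
      ∫ τ : ℝ in Set.Ioi 0, Complex.exp (-(μ * τ)) * F τ := by
    symm
    apply setIntegral_eq_integral_of_forall_compl_eq_zero
    intro τ hτ
    rw [h.zero τ (lt_of_le_of_lt (by simpa using hτ) h.pos), mul_zero]
  rw [integral_const_mul, h1, ← intervalIntegral.integral_interval_add_Ioi hi.integrableOn
    (b := ρ) hi.integrableOn, odeSol]
  ring

/-- Backward integration along a non-resonant exponential. -/
lemma norm_backward_le (h : IsSource ρ₀ σ B L F) {μ : ℂ} {δ : ℝ} (hδ : 0 < δ)
    (hμ : -σ + δ ≤ μ.re) {ρ : ℝ} (hρ : ρ₀ ≤ ρ) :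
    ‖odeSol μ F (∫ τ : ℝ, Complex.exp (-(μ * τ)) * F τ) ρ‖ ≤
      B * (ρ ^ L)⁻¹ * Real.exp (-(σ * ρ)) * (1 / δ) := by
  have hρ0 : 0 < ρ := h.pos.trans_le hρ
  have hB := h.nonneg
  rw [h.odeSol_backward (h.integrable_of_lt (by linarith)), norm_neg]
  have hint : IntegrableOn (fun τ : ℝ => B * (ρ ^ L)⁻¹ * Real.exp (-(σ * ρ)) *
      (Real.exp (δ * ρ) * Real.exp (-δ * τ))) (Set.Ioi ρ) :=
    ((exp_neg_integrableOn_Ioi ρ hδ).const_mul _).const_mul _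
  refine (norm_integral_le_of_norm_le hint ?_).trans ?_
  · refine (ae_restrict_iff' measurableSet_Ioi).mpr (Eventually.of_forall fun τ hτ => ?_)
    have hτ' : ρ < τ := hτ
    refine (h.norm_exp_mul_le μ (hρ.trans hτ'.le)).trans ?_
    have : (τ ^ L)⁻¹ ≤ (ρ ^ L)⁻¹ := by gcongr
    have hτ0 := hρ0.trans hτ'
    calc _ ≤ Real.exp ((-σ + δ) * (ρ - τ)) * (B * (ρ ^ L)⁻¹ * Real.exp (-(σ * τ))) := by
          have : μ.re * (ρ - τ) ≤ (-σ + δ) * (ρ - τ) := by nlinarith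
          gcongr
      _ = B * (ρ ^ L)⁻¹ * Real.exp ((-σ + δ) * (ρ - τ) + -(σ * τ)) := by rw [Real.exp_add]; ring
      _ = B * (ρ ^ L)⁻¹ * Real.exp (-(σ * ρ) + (δ * ρ + -δ * τ)) := by congr 2; ring
      _ = _ := by rw [Real.exp_add, Real.exp_add]; ring
  · rw [integral_const_mul, integral_const_mul, integral_exp_mul_Ioi (by linarith)]
    apply le_of_eq
    have : Real.exp (δ * ρ) * Real.exp (-δ * ρ) = 1 := by
      rw [← Real.exp_add]; simp
    congr 1
    rw [neg_div_neg_eq, mul_div_assoc', this]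

/-- Backward integration along a resonant exponential. -/
lemma norm_backward_resonant_le (h : IsSource ρ₀ σ B (L + 2) F) {μ : ℂ}
    (hμ : -σ ≤ μ.re) {ρ : ℝ} (hρ : ρ₀ ≤ ρ) :
    ‖odeSol μ F (∫ τ : ℝ, Complex.exp (-(μ * τ)) * F τ) ρ‖ ≤
      B * (ρ ^ (L + 1))⁻¹ * Real.exp (-(σ * ρ)) * (1 / (L + 1)) := by
  have hρ0 : 0 < ρ := h.pos.trans_le hρ
  have hB := h.nonneg
  have hL : -((L + 2 : ℕ) : ℝ) < -1 := by
    push_cast; linarith [(Nat.cast_nonneg L : (0 : ℝ) ≤ L)]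
  rw [h.odeSol_backward (h.integrable_of_le hμ), norm_neg]
  have hint : IntegrableOn (fun τ : ℝ => B * Real.exp (-(σ * ρ)) * τ ^ (-((L + 2 : ℕ) : ℝ)))
      (Set.Ioi ρ) := (integrableOn_Ioi_rpow_of_lt hL hρ0).const_mul _
  refine (norm_integral_le_of_norm_le hint ?_).trans ?_
  · refine (ae_restrict_iff' measurableSet_Ioi).mpr (Eventually.of_forall fun τ hτ => ?_)
    have hτ' : ρ < τ := hτ
    have hτ0 := hρ0.trans hτ'
    refine (h.norm_exp_mul_le μ (hρ.trans hτ'.le)).trans ?_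
    rw [Real.rpow_neg hτ0.le, Real.rpow_natCast]
    calc _ = B * (τ ^ (L + 2))⁻¹ * Real.exp (μ.re * (ρ - τ) + -(σ * τ)) := by
          rw [Real.exp_add]; ring
      _ ≤ B * (τ ^ (L + 2))⁻¹ * Real.exp (-(σ * ρ)) := by
          have : μ.re * (ρ - τ) + -(σ * τ) ≤ -(σ * ρ) := by nlinarith
          gcongr
      _ = _ := by ring
  -- The tail integral of `τ^(-(L+2))` loses one power of `ρ` and gains the factor `1/(L+1)`, which
  -- later compensates the growth of the factorials.
  · rw [integral_const_mul, integral_Ioi_rpow_of_lt hL hρ0]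
    apply le_of_eq
    have e : -((L + 2 : ℕ) : ℝ) + 1 = -((L + 1 : ℕ) : ℝ) := by push_cast; ring
    rw [e, Real.rpow_neg hρ0.le, Real.rpow_natCast]
    push_cast
    rw [neg_div_neg_eq]
    ring

end IsSource

end MetivierGen

namespace MetivierGen
open MeasureTheory Filter Topology

/-! ### Solutions of `∂^(2m) g + (-1)^m c^(2m) g = F` -/

/-- The root `i c λ_j` of `μ^(2m) + (-1)^m c^(2m) = 0`. -/
noncomputable def charRoot (m : ℕ) (c : ℝ) (j : ℕ) : ℂ := Complex.I * (c : ℂ) * lam m j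

/-- The normalizing constant of the fundamental solution. -/
noncomputable def greenConst (m : ℕ) (c : ℝ) : ℂ :=
  (-1) ^ m / (2 * m * Complex.I * (c : ℂ) ^ (2 * m - 1))

/-- A solution of `∂^(2m) g + (-1)^m c^(2m) g = F`. -/
noncomputable def greenSol (m : ℕ) (c : ℝ) (κ : ℕ → ℂ) (F : ℝ → ℂ) (ρ : ℝ) : ℂ :=
  greenConst m c * ∑ j ∈ Finset.range (2 * m), lam m j * odeSol (charRoot m c j) F (κ j) ρ

variable {m : ℕ} {c : ℝ} {κ : ℕ → ℂ} {F : ℝ → ℂ}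

lemma charRoot_re (m : ℕ) (c : ℝ) (j : ℕ) : (charRoot m c j).re = -(c * (lam m j).im) := by
  simp [charRoot, Complex.mul_re]

lemma charRoot_add (hm : 0 < m) (c : ℝ) (j : ℕ) : charRoot m c (j + m) = -charRoot m c j := by
  rw [charRoot, charRoot, lam_add m hm]; ring

lemma norm_charRoot (hc : 0 < c) (j : ℕ) : ‖charRoot m c j‖ = c := by
  simp [charRoot, norm_lam, abs_of_pos hc]

lemma charRoot_pow (hm : 0 < m) (j : ℕ) :
    charRoot m c j ^ (2 * m) = -((-1) ^ m * (c : ℂ) ^ (2 * m)) := by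
  rw [charRoot, mul_pow, mul_pow, lam_pow m hm, pow_mul Complex.I, Complex.I_sq]
  ring

lemma sum_lam_mul_charRoot_pow (hm : 0 < m) (k : ℕ) (hk : k + 1 < 2 * m) :
    ∑ j ∈ Finset.range (2 * m), lam m j * charRoot m c j ^ k = 0 := by
  have : ∀ j, lam m j * charRoot m c j ^ k = (Complex.I * c) ^ k * lam m j ^ (k + 1) := by
    intro j; rw [charRoot, mul_pow]; ring
  rw [Finset.sum_congr rfl fun j _ => this j, ← Finset.mul_sum,
    sum_lam_pow m hm (k + 1) (by omega) hk, mul_zero]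

lemma greenConst_mul_sum (hm : 0 < m) (hc : 0 < c) :
    greenConst m c * ∑ j ∈ Finset.range (2 * m), lam m j * charRoot m c j ^ (2 * m - 1) = 1 := by
  have hm' : (m : ℂ) ≠ 0 := by exact_mod_cast hm.ne'
  have hc' : (c : ℂ) ≠ 0 := by exact_mod_cast hc.ne'
  have e : 2 * m - 1 + 1 = 2 * m := by omega
  have : ∀ j, lam m j * charRoot m c j ^ (2 * m - 1) = -(Complex.I * c) ^ (2 * m - 1) := by
    intro j
    rw [charRoot, mul_pow]
    calc lam m j * ((Complex.I * c) ^ (2 * m - 1) * lam m j ^ (2 * m - 1))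
        = (Complex.I * c) ^ (2 * m - 1) * lam m j ^ (2 * m - 1 + 1) := by ring
      _ = _ := by rw [e, lam_pow m hm]; ring
  rw [Finset.sum_congr rfl fun j _ => this j, Finset.sum_const, Finset.card_range, nsmul_eq_mul,
    greenConst, mul_pow]
  have hI : Complex.I ^ (2 * m - 1) * Complex.I = (-1) ^ m := by
    rw [← pow_succ, e, pow_mul, Complex.I_sq]
  have hI2 : Complex.I ^ (2 * m - 1) = -((-1) ^ m * Complex.I) := by
    rw [← hI]; linear_combination Complex.I ^ (2 * m - 1) * Complex.I_sq
  have h1 : ((-1 : ℂ) ^ m) * (-1) ^ m = 1 := by rw [← mul_pow]; simp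
  rw [hI2]
  push_cast
  have hI0 := Complex.I_ne_zero
  field_simp
  linear_combination h1

lemma hasDerivAt_sum_odeSol (hF : Continuous F) (w : ℕ → ℂ) (ρ : ℝ) (N : ℕ) :
    HasDerivAt (fun ρ => ∑ j ∈ Finset.range N, w j * odeSol (charRoot m c j) F (κ j) ρ)
      ((∑ j ∈ Finset.range N, w j * charRoot m c j * odeSol (charRoot m c j) F (κ j) ρ)
        + (∑ j ∈ Finset.range N, w j) * F ρ) ρ := by
  have := HasDerivAt.fun_sum (u := Finset.range N)
    fun j _ => (hasDerivAt_odeSol (charRoot m c j) hF (κ j) ρ).const_mul (w j)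
  refine this.congr_deriv ?_
  rw [Finset.sum_mul, ← Finset.sum_add_distrib]
  exact Finset.sum_congr rfl fun j _ => by ring

/-- The source terms produced by differentiating each `odeSol` cancel by `sum_lam_mul_charRoot_pow`.
They first survive at order `2m`, with total weight one by `greenConst_mul_sum`, whatever the
constants `κ j` are. -/
lemma iteratedDeriv_greenSol (hm : 0 < m) (hF : Continuous F) (k : ℕ) (hk : k < 2 * m) :
    iteratedDeriv k (greenSol m c κ F) = fun ρ => greenConst m c *
      ∑ j ∈ Finset.range (2 * m), lam m j * charRoot m c j ^ k *
        odeSol (charRoot m c j) F (κ j) ρ := by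
  induction k with
  | zero => funext ρ; simp [greenSol]
  | succ k ih =>
    rw [iteratedDeriv_succ, ih (by omega)]
    funext ρ
    rw [((hasDerivAt_sum_odeSol hF _ ρ (2 * m)).const_mul _).deriv,
      sum_lam_mul_charRoot_pow hm k hk, zero_mul, add_zero]
    simp only [pow_succ, mul_assoc]

lemma iteratedDeriv_greenSol_top (hm : 0 < m) (hc : 0 < c) (hF : Continuous F) (ρ : ℝ) :
    iteratedDeriv (2 * m) (greenSol m c κ F) ρ =
      -((-1) ^ m * (c : ℂ) ^ (2 * m)) * greenSol m c κ F ρ + F ρ := by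
  have e : 2 * m = (2 * m - 1) + 1 := by omega
  rw [e, iteratedDeriv_succ, iteratedDeriv_greenSol hm hF (2 * m - 1) (by omega),
    ((hasDerivAt_sum_odeSol hF _ ρ (2 * m)).const_mul _).deriv, ← e, mul_add, ← mul_assoc,
    greenConst_mul_sum hm hc, one_mul, greenSol]
  congr 1
  have : ∀ j, lam m j * charRoot m c j ^ (2 * m - 1) * charRoot m c j
      * odeSol (charRoot m c j) F (κ j) ρ
      = -((-1) ^ m * (c : ℂ) ^ (2 * m)) * (lam m j * odeSol (charRoot m c j) F (κ j) ρ) := by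
    intro j
    rw [mul_assoc (lam m j), ← pow_succ, ← e, charRoot_pow hm]
    ring
  rw [Finset.sum_congr rfl fun j _ => this j, ← Finset.mul_sum]
  ring

lemma contDiff_greenSol (hF : ContDiff ℝ ((⊤ : ℕ∞) : WithTop ℕ∞) F) :
    ContDiff ℝ ((⊤ : ℕ∞) : WithTop ℕ∞) (greenSol m c κ F) :=
  contDiff_const.mul (ContDiff.sum fun _ _ => contDiff_const.mul (contDiff_odeSol _ hF _))

lemma norm_greenConst (hc : 0 < c) : ‖greenConst m c‖ = 1 / (2 * m * c ^ (2 * m - 1)) := by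
  simp [greenConst, abs_of_pos hc]

/-- Each derivative multiplies a term by a root of modulus `c`, so the weight `c^i` on the
derivative of order `2m - i` puts all orders on the same scale; `i = 0` is read off the equation and
accounts for `‖F ρ‖`. This weight is the gain to be set against the degree of `𝒫_i`. -/
lemma norm_iteratedDeriv_greenSol_le (hm : 0 < m) (hc : 0 < c) (hF : Continuous F) {ρ M : ℝ}
    (hM : ∀ j < 2 * m, ‖odeSol (charRoot m c j) F (κ j) ρ‖ ≤ M) (i : ℕ) (hi : i ≤ 2 * m) :
    c ^ i * ‖iteratedDeriv (2 * m - i) (greenSol m c κ F) ρ‖ ≤ c * M + ‖F ρ‖ := by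
  have hm' : (0 : ℝ) < m := by exact_mod_cast hm
  have main : ∀ k < 2 * m, ‖greenConst m c * ∑ j ∈ Finset.range (2 * m),
      lam m j * charRoot m c j ^ k * odeSol (charRoot m c j) F (κ j) ρ‖
      ≤ c ^ k / c ^ (2 * m - 1) * M := by
    intro k _
    rw [norm_mul, norm_greenConst hc]
    have : ‖∑ j ∈ Finset.range (2 * m),
        lam m j * charRoot m c j ^ k * odeSol (charRoot m c j) F (κ j) ρ‖
        ≤ ∑ _j ∈ Finset.range (2 * m), c ^ k * M := by
      refine (norm_sum_le _ _).trans (Finset.sum_le_sum fun j hj => ?_)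
      rw [norm_mul, norm_mul, norm_lam, one_mul, norm_pow, norm_charRoot hc]
      exact mul_le_mul_of_nonneg_left (hM j (Finset.mem_range.mp hj)) (by positivity)
    rw [Finset.sum_const, Finset.card_range, nsmul_eq_mul] at this
    calc _ ≤ 1 / (2 * m * c ^ (2 * m - 1)) * (((2 * m : ℕ) : ℝ) * (c ^ k * M)) := by gcongr
      _ = _ := by push_cast; field_simp
  have hg : ‖greenSol m c κ F ρ‖ ≤ 1 / c ^ (2 * m - 1) * M := by
    have := main 0 (by omega)
    simpa [greenSol] using this
  rcases Nat.eq_zero_or_pos i with rfl | hi0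
  · rw [pow_zero, one_mul, Nat.sub_zero, iteratedDeriv_greenSol_top hm hc hF]
    refine (norm_add_le _ _).trans ?_
    gcongr
    rw [norm_mul, norm_neg, norm_mul, norm_pow, norm_neg, norm_one, one_pow, one_mul, norm_pow,
      Complex.norm_real, Real.norm_eq_abs, abs_of_pos hc]
    calc c ^ (2 * m) * ‖greenSol m c κ F ρ‖ ≤ c ^ (2 * m) * (1 / c ^ (2 * m - 1) * M) := by gcongr
      _ = c * M := by
        rw [show 2 * m = (2 * m - 1) + 1 by omega, pow_succ, Nat.add_sub_cancel]
        field_simp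
  · rw [iteratedDeriv_greenSol hm hF (2 * m - i) (by omega)]
    have h1 := main (2 * m - i) (by omega)
    calc _ ≤ c ^ i * (c ^ (2 * m - i) / c ^ (2 * m - 1) * M) := by gcongr
      _ = c * M := by
        rw [← mul_assoc, mul_div_assoc', ← pow_add, Nat.add_sub_cancel' hi]
        congr 1
        rw [div_eq_iff (by positivity), ← pow_succ']
        congr 1; omega
      _ ≤ _ := by linarith [norm_nonneg (F ρ)]

/-! ### Convolution with the fundamental solution -/

lemma fundSol_eq (n m p : ℕ) (ρ : ℝ) : fundSol n m p ρ = greenConst m (freq n m p) *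
    ∑ j ∈ Finset.range m, lam m j * Complex.exp (charRoot m (freq n m p) j * ((|ρ| : ℝ) : ℂ)) :=
  rfl

lemma lam_im_pos (hm : 0 < m) {j : ℕ} (hj : j < m) : 0 < (lam m j).im :=
  (lam_im_zero_pos m hm).trans_le (lam_im_le m j hm hj)

namespace IsSource

variable {ρ₀ σ B : ℝ} {L : ℕ}

/-- Splitting at `τ = ρ` removes the absolute value: the left part is the forward solution for `μ`,
the right part the backward solution for `-μ`. -/
lemma integral_exp_abs (h : IsSource ρ₀ σ B L F) (hσ : 0 < σ) {μ : ℂ} (hμ : μ.re < 0) (ρ : ℝ) :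
    Integrable (fun τ : ℝ => Complex.exp (μ * ((|ρ - τ| : ℝ) : ℂ)) * F τ) ∧
    ∫ τ : ℝ, Complex.exp (μ * ((|ρ - τ| : ℝ) : ℂ)) * F τ = odeSol μ F 0 ρ -
      odeSol (-μ) F (∫ τ : ℝ, Complex.exp (-(-μ * τ)) * F τ) ρ := by
  have hF : Integrable F := by
    have := h.integrable_of_lt (μ := 0) (by simpa using hσ)
    simpa using this
  have hc := h.cont
  have hK : Integrable (fun τ : ℝ => Complex.exp (μ * ((|ρ - τ| : ℝ) : ℂ)) * F τ) := by
    refine hF.norm.mono' (Continuous.aestronglyMeasurable (by fun_prop))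
      (Eventually.of_forall fun τ => ?_)
    rw [norm_mul, Complex.norm_exp]
    have : (μ * ((|ρ - τ| : ℝ) : ℂ)).re = μ.re * |ρ - τ| := by simp [Complex.mul_re]
    rw [this]
    refine mul_le_of_le_one_left (norm_nonneg _) (Real.exp_le_one_iff.mpr ?_)
    nlinarith [abs_nonneg (ρ - τ)]
  refine ⟨hK, ?_⟩
  have hz : ∀ τ ≤ (0 : ℝ), F τ = 0 := fun τ hτ => h.zero τ (hτ.trans_lt h.pos)
  rw [← intervalIntegral.integral_Iic_add_Ioi hK.integrableOn (b := ρ) hK.integrableOn]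
  have h0 : ∫ τ : ℝ in Set.Iic 0, Complex.exp (μ * ((|ρ - τ| : ℝ) : ℂ)) * F τ = 0 := by
    rw [setIntegral_congr_fun (g := fun _ => (0 : ℂ)) measurableSet_Iic
      (fun τ hτ => by simp [hz τ hτ])]
    simp
  have h1 : ∫ τ : ℝ in Set.Iic ρ, Complex.exp (μ * ((|ρ - τ| : ℝ) : ℂ)) * F τ =
      odeSol μ F 0 ρ := by
    have := intervalIntegral.integral_Iic_sub_Iic (hK.integrableOn (s := Set.Iic 0))
      (hK.integrableOn (s := Set.Iic ρ))
    rw [h0, sub_zero] at this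
    rw [this, odeSol, sub_zero, ← intervalIntegral.integral_const_mul]
    apply intervalIntegral.integral_congr
    intro τ hτ
    simp only
    rcases le_or_gt τ 0 with hle | hlt
    · rw [hz τ hle]; simp
    · have : τ ≤ ρ := by
        rcases Set.mem_uIcc.mp hτ with h | h
        · exact h.2
        · linarith [h.2]
      rw [← mul_assoc, ← Complex.exp_add, abs_of_nonneg (by linarith)]
      congr 2
      push_cast
      ring
  have h2 : ∫ τ : ℝ in Set.Ioi ρ, Complex.exp (μ * ((|ρ - τ| : ℝ) : ℂ)) * F τ =
      -odeSol (-μ) F (∫ τ : ℝ, Complex.exp (-(-μ * τ)) * F τ) ρ := by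
    rw [h.odeSol_backward (h.integrable_of_lt (by rw [Complex.neg_re]; linarith)), neg_neg]
    refine setIntegral_congr_fun measurableSet_Ioi fun τ hτ => ?_
    have : ρ < τ := hτ
    rw [← mul_assoc, ← Complex.exp_add, abs_of_neg (by linarith)]
    congr 2
    push_cast
    ring
  rw [h1, h2]
  ring

/-- The `m` decaying exponentials of the kernel, split at `τ = ρ`, account for all `2m` roots
because `λ_{j+m} = -λ_j`. Convolution is therefore the `greenSol` with decaying roots integrated
forward and growing roots backward. -/
lemma integral_fundSol (h : IsSource ρ₀ σ B L F) (hσ : 0 < σ) (n p : ℕ) (hm : 0 < m)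
    (hc : 0 < freq n m p) (ρ : ℝ) :
    ∫ τ : ℝ, fundSol n m p (ρ - τ) * F τ = greenSol m (freq n m p)
      (fun j => if j < m then 0 else ∫ τ : ℝ, Complex.exp (-(charRoot m (freq n m p) j * τ)) * F τ)
      F ρ := by
  set c := freq n m p
  have hre : ∀ j < m, (charRoot m c j).re < 0 := by
    intro j hj
    rw [charRoot_re, neg_lt_zero]
    exact mul_pos hc (lam_im_pos hm hj)
  have e1 : ∀ τ : ℝ, fundSol n m p (ρ - τ) * F τ = greenConst m c * ∑ j ∈ Finset.range m,
      lam m j * (Complex.exp (charRoot m c j * ((|ρ - τ| : ℝ) : ℂ)) * F τ) := by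
    intro τ
    rw [fundSol_eq, mul_assoc, Finset.sum_mul]
    simp only [mul_assoc]
    rfl
  simp only [e1]
  rw [integral_const_mul, integral_finsetSum]
  · rw [greenSol, two_mul, Finset.sum_range_add]
    congr 1
    rw [← Finset.sum_add_distrib]
    refine Finset.sum_congr rfl fun j hj => ?_
    have hj' := Finset.mem_range.mp hj
    rw [integral_const_mul, (h.integral_exp_abs hσ (hre j hj') ρ).2, if_pos hj',
      if_neg (by omega), add_comm m j, charRoot_add hm, lam_add m hm]
    ring
  · intro j hj
    exact (h.integral_exp_abs hσ (hre j (Finset.mem_range.mp hj)) ρ).1.const_mul _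

/-- The solution for `p ≥ 1`: decaying roots forward, growing roots backward. -/
lemma norm_greenSol_le (h : IsSource ρ₀ σ B L F) (hm : 0 < m) (hc : 0 < c) {η : ℝ}
    (hη : 0 < η) (hσc : σ + η * c ≤ c * (lam m 0).im) (hσ : 0 < σ) (hL : (L : ℝ) ≤ η * c / 2 * ρ₀)
    {ρ : ℝ} (hρ : ρ₀ ≤ ρ) (i : ℕ) (hi : i ≤ 2 * m) :
    c ^ i * ‖iteratedDeriv (2 * m - i) (greenSol m c (fun j => if j < m then 0 else
      ∫ τ : ℝ, Complex.exp (-(charRoot m c j * τ)) * F τ) F) ρ‖ ≤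
      (2 / η + 1) * (B * (ρ ^ L)⁻¹ * Real.exp (-(σ * ρ))) := by
  have hρ0 := h.pos.trans_le hρ
  have hB := h.nonneg
  set A := B * (ρ ^ L)⁻¹ * Real.exp (-(σ * ρ)) with hA
  have hA0 : 0 ≤ A := by positivity
  have hδ : 0 < η * c := by positivity
  have key := norm_iteratedDeriv_greenSol_le (m := m) (c := c) (F := F)
    (κ := fun j => if j < m then 0 else ∫ τ : ℝ, Complex.exp (-(charRoot m c j * τ)) * F τ)
    hm hc h.cont (ρ := ρ) (M := A * (2 / (η * c))) ?_ i hi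
  · refine key.trans ?_
    have : c * (A * (2 / (η * c))) = 2 / η * A := by field_simp
    rw [this, add_mul, one_mul]
    gcongr
    exact h.bound ρ hρ
  · intro j hj
    by_cases hjm : j < m
    · simp only [if_pos hjm]
      refine h.norm_forward_le hδ ?_ hL hρ
      rw [charRoot_re]
      have := mul_le_mul_of_nonneg_left (lam_im_le m j hm hjm) hc.le
      linarith
    · simp only [if_neg hjm]
      obtain ⟨j, rfl⟩ := Nat.exists_eq_add_of_le' (not_lt.mp hjm)
      have hj' : j < m := by omega
      refine (h.norm_backward_le hδ ?_ hρ).trans ?_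
      · rw [charRoot_add hm, Complex.neg_re, charRoot_re, neg_neg]
        have := mul_le_mul_of_nonneg_left (lam_im_le m j hm hj') hc.le
        linarith
      · rw [← hA]
        gcongr
        norm_num

/-- The solution for `p = 0`: the resonant roots are integrated backward as well. -/
lemma norm_greenSol_resonant_le (h : IsSource ρ₀ σ B (L + 2) F) (hm : 0 < m) (hc : 0 < c) {η : ℝ}
    (hη : 0 < η) (hη1 : η ≤ (lam m 0).im)
    (hgap : ∀ j, 0 < j → j + 1 < m → (lam m 0).im + η ≤ (lam m j).im)
    (hσ : σ = c * (lam m 0).im) (hL : ((L : ℝ) + 2) ≤ η * c / 2 * ρ₀)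
    {ρ : ℝ} (hρ : ρ₀ ≤ ρ) (i : ℕ) (hi : i ≤ 2 * m) :
    c ^ i * ‖iteratedDeriv (2 * m - i) (greenSol m c
      (fun j => if j < m ∧ j ≠ 0 ∧ j ≠ m - 1 then 0 else
      ∫ τ : ℝ, Complex.exp (-(charRoot m c j * τ)) * F τ) F) ρ‖ ≤
      2 * (c + η * c) / (L + 1) * (B * (ρ ^ (L + 1))⁻¹ * Real.exp (-(σ * ρ))) := by
  have hρ0 := h.pos.trans_le hρ
  have hB := h.nonneg
  have him := lam_im_zero_pos m hm
  set A := B * (ρ ^ (L + 1))⁻¹ * Real.exp (-(σ * ρ)) with hA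
  have hA0 : 0 ≤ A := by positivity
  have hδ : 0 < η * c := by positivity
  have hL0 : (0 : ℝ) < (L : ℝ) + 1 := by positivity
  have hρL : ((L : ℝ) + 1) / (η * c) ≤ ρ := by
    rw [div_le_iff₀ hδ]
    nlinarith [h.pos]
  -- Non-resonant roots and the source itself keep the power `L + 2`. Since `ρ ≥ (L+1)/(ηc)`, the
  -- spare factor `ρ⁻¹` becomes `ηc/(L+1)`, the form of the resonant bound.
  have hsmall : B * (ρ ^ (L + 2))⁻¹ * Real.exp (-(σ * ρ)) ≤ η * c / (L + 1) * A := by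
    rw [hA, pow_succ ρ (L + 1), mul_inv]
    have : ρ⁻¹ ≤ η * c / (L + 1) := by
      rw [← inv_div]
      exact inv_anti₀ (by positivity) hρL
    calc _ = ρ⁻¹ * (B * (ρ ^ (L + 1))⁻¹ * Real.exp (-(σ * ρ))) := by ring
      _ ≤ _ := by gcongr
  have key := norm_iteratedDeriv_greenSol_le (m := m) (c := c) (F := F)
    (κ := fun j => if j < m ∧ j ≠ 0 ∧ j ≠ m - 1 then 0 else
      ∫ τ : ℝ, Complex.exp (-(charRoot m c j * τ)) * F τ)
    hm hc h.cont (ρ := ρ) (M := 2 / (L + 1) * A) ?_ i hi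
  · refine key.trans ?_
    calc c * (2 / (L + 1) * A) + ‖F ρ‖ ≤ c * (2 / (L + 1) * A) + η * c / (L + 1) * A := by
          gcongr
          exact (h.bound ρ hρ).trans hsmall
      _ = (2 * c + η * c) / (L + 1) * A := by ring
      _ ≤ _ := by gcongr; linarith
  · intro j hj
    have hres : ∀ j', (lam m j').im ≤ (lam m 0).im →
        ‖odeSol (charRoot m c j') F (∫ τ : ℝ, Complex.exp (-(charRoot m c j' * τ)) * F τ) ρ‖
        ≤ 2 / (L + 1) * A := by
      intro j' hj'
      refine (h.norm_backward_resonant_le ?_ hρ).trans ?_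
      · rw [charRoot_re, hσ, neg_le_neg_iff]
        gcongr
      · rw [← hA, mul_comm]
        gcongr
        norm_num
    by_cases hjm : j < m ∧ j ≠ 0 ∧ j ≠ m - 1
    · simp only [if_pos hjm]
      have hg := hgap j (by omega) (by omega)
      refine (h.norm_forward_le hδ ?_ (by push_cast; exact hL) hρ).trans ?_
      · rw [charRoot_re, hσ, neg_le_neg_iff]
        nlinarith
      · calc _ ≤ η * c / (L + 1) * A * (2 / (η * c)) := by gcongr
          _ = _ := by field_simp
    · simp only [if_neg hjm]
      by_cases hj1 : j < m
      · apply hres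
        have : j = 0 ∨ j = m - 1 := by
          by_contra hcon
          push Not at hcon
          exact hjm ⟨hj1, hcon⟩
        rcases this with rfl | rfl
        · exact le_rfl
        · exact (lam_im_last m hm).le
      -- The growing roots have `Im λ < 0 < Im λ_0`, so the resonant estimate covers them as well.
      · obtain ⟨j, rfl⟩ := Nat.exists_eq_add_of_le' (not_lt.mp hj1)
        apply hres
        rw [lam_add m hm, Complex.neg_im]
        have := lam_im_pos hm (show j < m by omega)
        linarith

end IsSource

end MetivierGen

namespace MetivierGen

/-! ### The Euler operator on coefficient sequences -/

/-- `eulerAct` as a linear operator. -/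
noncomputable def eulerLin (n : ℕ) : Module.End ℂ (ℕ → ℂ) where
  toFun := eulerAct n
  map_add' a b := by funext p; simp only [eulerAct, Pi.add_apply]; ring
  map_smul' c a := by
    funext p; simp only [eulerAct, Pi.smul_apply, smul_eq_mul, RingHom.id_apply]; ring

lemma eulerLin_apply (n : ℕ) (a : ℕ → ℂ) : eulerLin n a = eulerAct n a := rfl

/-- The operator `Q(t∂_t)` on coefficient sequences. -/
noncomputable def polyAct (n : ℕ) (Q : Polynomial ℝ) : Module.End ℂ (ℕ → ℂ) :=
  Polynomial.aeval (eulerLin n) (Q.map Complex.ofRealHom)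

lemma polyAct_add (n : ℕ) (P Q : Polynomial ℝ) :
    polyAct n (P + Q) = polyAct n P + polyAct n Q := by simp [polyAct]

lemma polyAct_sub (n : ℕ) (P Q : Polynomial ℝ) :
    polyAct n (P - Q) = polyAct n P - polyAct n Q := by simp [polyAct]

lemma polyAct_mul (n : ℕ) (P Q : Polynomial ℝ) :
    polyAct n (P * Q) = polyAct n P * polyAct n Q := by simp [polyAct]

lemma polyAct_C (n : ℕ) (c : ℝ) (a : ℕ → ℂ) : polyAct n (Polynomial.C c) a = (c : ℂ) • a := by
  simp [polyAct, Algebra.algebraMap_eq_smul_one]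

lemma polyAct_X (n : ℕ) : polyAct n Polynomial.X = eulerLin n := by simp [polyAct]

lemma polyAct_one (n : ℕ) : polyAct n 1 = 1 := by simp [polyAct]

lemma polyAct_zero (n : ℕ) : polyAct n 0 = 0 := by simp [polyAct]

/-- A property of sequence-valued maps that is stable under linear combinations and `eulerAct` is
stable under every `polyAct n Q`. -/
lemma polyAct_induction {ι : Type*} (n : ℕ) {S : (ι → ℕ → ℂ) → Prop}
    (hadd : ∀ a b, S a → S b → S (fun i => a i + b i))
    (hsmul : ∀ (c : ℂ) a, S a → S (fun i => c • a i))
    (hE : ∀ a, S a → S (fun i => eulerAct n (a i))) (Q : Polynomial ℝ) :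
    ∀ a, S a → S (fun i => polyAct n Q (a i)) := by
  induction Q using Polynomial.induction_on with
  | C c => intro a ha; simpa only [polyAct_C] using hsmul c a ha
  | add P Q hP hQ =>
    intro a ha
    simpa only [polyAct_add, LinearMap.add_apply] using hadd _ _ (hP a ha) (hQ a ha)
  | monomial k c ih =>
    intro a ha
    have := ih _ (hE a ha)
    simpa only [pow_succ, ← mul_assoc, polyAct_mul _ _ Polynomial.X, polyAct_X,
      Module.End.mul_apply, eulerLin_apply] using this

lemma hasDerivAt_polyAct (n : ℕ) (Q : Polynomial ℝ) {a a' : ℕ → ℝ → ℂ} {ρ : ℝ}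
    (h : ∀ q, HasDerivAt (a q) (a' q ρ) ρ) (p : ℕ) :
    HasDerivAt (fun ρ => polyAct n Q (fun q => a q ρ) p) (polyAct n Q (fun q => a' q ρ) p) ρ := by
  induction Q using Polynomial.induction_on generalizing a a' p with
  | C c =>
    simp only [polyAct_C, Pi.smul_apply, smul_eq_mul]
    exact (h p).const_mul _
  | add P Q hP hQ =>
    simp only [polyAct_add, LinearMap.add_apply, Pi.add_apply]
    exact (hP h p).add (hQ h p)
  | monomial k c ih =>
    simp only [pow_succ, ← mul_assoc, polyAct_mul _ _ Polynomial.X, polyAct_X]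
    refine ih (a := fun q ρ => eulerAct n (fun q => a q ρ) q)
      (a' := fun q ρ => eulerAct n (fun q => a' q ρ) q) (fun q => ?_) p
    simp only [eulerAct]
    exact ((((h _).const_mul _).sub ((h _).const_mul _)).sub ((h _).const_mul _)).const_mul _

lemma contDiff_polyAct {N : WithTop ℕ∞} (n : ℕ) (Q : Polynomial ℝ) {a : ℕ → ℝ → ℂ}
    (h : ∀ q, ContDiff ℝ N (a q)) (p : ℕ) :
    ContDiff ℝ N (fun ρ => polyAct n Q (fun q => a q ρ) p) := by
  refine polyAct_induction n (S := fun a : ℝ → ℕ → ℂ => ∀ p, ContDiff ℝ N (fun ρ => a ρ p))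
    ?_ ?_ ?_ Q (fun ρ q => a q ρ) h p
  · exact fun a b ha hb p => (ha p).add (hb p)
  · exact fun c a ha p => contDiff_const.mul (ha p)
  · intro a ha p
    simp only [eulerAct]
    exact contDiff_const.mul (((contDiff_const.mul (ha _)).sub (contDiff_const.mul (ha _))).sub
      (contDiff_const.mul (ha _)))

/-! ### The polynomials `𝒫_i` -/

lemma natDegree_euPoly_le (θ γ q f : ℝ) (p i : ℕ) : (euPoly θ γ q f p i).natDegree ≤ i := by
  induction p generalizing i with
  | zero => cases i <;> simp [euPoly]
  | succ p ih =>
    cases i with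
    | zero => simpa [euPoly] using ih 0
    | succ i =>
      rw [euPoly]
      refine Polynomial.natDegree_add_le_of_degree_le (ih (i + 1)) ?_
      rw [add_comm i 1]
      refine Polynomial.natDegree_mul_le_of_le ?_ (ih i)
      refine Polynomial.natDegree_add_le_of_degree_le
        ((Polynomial.natDegree_C _).le.trans (Nat.zero_le _)) ?_
      exact (Polynomial.natDegree_C_mul_le _ _).trans (by simp)

lemma euPoly_eq_zero (θ γ q f : ℝ) (p i : ℕ) (h : p < i) : euPoly θ γ q f p i = 0 := by
  induction p generalizing i with
  | zero => cases i with
    | zero => omega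
    | succ i => simp [euPoly]
  | succ p ih => cases i with
    | zero => omega
    | succ i => rw [euPoly, ih (i + 1) (by omega), ih i (by omega)]; simp

lemma euPoly_zero_right (θ γ q f : ℝ) (p : ℕ) : euPoly θ γ q f p 0 = 1 := by
  induction p with
  | zero => simp [euPoly]
  | succ p ih => rw [euPoly, ih]

/-- Besides the trivial `i = 0`, only `i = 1` is needed in closed form: it gives the `v_0` component
of `𝒫_1`. -/
lemma euPoly_one_right (θ γ q f : ℝ) (p : ℕ) : euPoly θ γ q f p 1 =
    Polynomial.C ((p : ℝ) * (q + γ * f) + (1 - θ) * p * (p + 1) / 2)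
      + Polynomial.C (p * γ) * Polynomial.X := by
  induction p with
  | zero => simp [euPoly]
  | succ p ih =>
    have h : euPoly θ γ q f (p + 1) 1 = euPoly θ γ q f p 1 +
        (Polynomial.C (((p : ℝ) - (0 : ℕ)) + 1 - ((p : ℝ) + 1) * θ + q + γ * f)
          + Polynomial.C γ * Polynomial.X) * euPoly θ γ q f p 0 := by rw [euPoly]
    rw [h, ih, euPoly_zero_right]
    have e1 : ((p + 1 : ℕ) : ℝ) * (q + γ * f) + (1 - θ) * (p + 1 : ℕ) * ((p + 1 : ℕ) + 1) / 2
        = ((p : ℝ) * (q + γ * f) + (1 - θ) * p * (p + 1) / 2)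
          + (((p : ℝ) - (0 : ℕ)) + 1 - ((p : ℝ) + 1) * θ + q + γ * f) := by
      push_cast; ring
    have e2 : ((p + 1 : ℕ) : ℝ) * γ = p * γ + γ := by push_cast; ring
    rw [e1, e2]
    generalize (p : ℝ) * (q + γ * f) + (1 - θ) * p * (p + 1) / 2 = A
    generalize ((p : ℝ) - (0 : ℕ)) + 1 - ((p : ℝ) + 1) * θ + q + γ * f = B
    generalize (p : ℝ) * γ = D
    simp only [Polynomial.C_add]
    ring

lemma natDegree_pPoly_le (n m i : ℕ) : (pPoly n m i).natDegree ≤ i := by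
  rw [pPoly]
  refine (Polynomial.natDegree_sub_le_of_le (natDegree_euPoly_le _ _ _ _ _ _) ?_).trans
    (max_self i).le
  exact (Polynomial.natDegree_C_mul_le _ _).trans
    ((natDegree_euPoly_le _ _ _ _ _ _).trans (Nat.sub_le i 1))

lemma pAct_eq_polyAct (n m i : ℕ) (a : ℕ → ℂ) (p : ℕ) :
    pAct n m i a p = polyAct n (pPoly n m i) a p := by
  rw [polyAct, Polynomial.aeval_eq_sum_range' (n := i + 1)
    (Nat.lt_succ_of_le ((Polynomial.natDegree_map_le).trans (natDegree_pPoly_le n m i)))]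
  simp only [pAct, LinearMap.sum_apply, LinearMap.smul_apply, Finset.sum_apply, Pi.smul_apply,
    smul_eq_mul, Polynomial.coeff_map, Module.End.pow_apply]
  rfl

/-- The component along `v_0` of `𝒫_1 a` does not involve `a_0`. -/
lemma pAct_one_zero (n m : ℕ) (hm : 0 < m) (a : ℕ → ℂ) :
    pAct n m 1 a 0 = -(2 * m * gam n m * (n + 1) * (1 + alph n) : ℝ) * a 1 := by
  have hm' : (1 : ℝ) ≤ m := by exact_mod_cast hm
  have hm2 : (2 * (m : ℝ) - 1) ≠ 0 := by linarith
  -- The value of `rExp` enters here. It makes the constant term cancel the diagonal entry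
  -- `-(n+1)(1+α)` of `t∂_t` at `v_0`, multiplied by `2mγ`.
  have hP : pPoly n m 1 = Polynomial.C (2 * m * gam n m * (n + 1) * (1 + alph n))
      + Polynomial.C (2 * m * gam n m) * Polynomial.X := by
    rw [pPoly, euPoly_one_right, Nat.sub_self, euPoly_zero_right, mul_one, add_sub_right_comm,
      ← Polynomial.C_sub]
    congr 2
    · have hn : (n : ℝ) + 1 ≠ 0 := by positivity
      rw [rExp, theta, gam, alph]
      push_cast
      field_simp
      ring
    · push_cast; ring
  have hcoeff : ∀ u v : ℝ, (Polynomial.C u + Polynomial.C v * Polynomial.X).coeff 0 = u ∧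
      (Polynomial.C u + Polynomial.C v * Polynomial.X).coeff 1 = v := by
    intro u v; simp [Polynomial.coeff_C]
  simp only [pAct, Finset.sum_range_succ, Finset.sum_range_zero, hP, (hcoeff _ _).1,
    (hcoeff _ _).2]
  simp [eulerAct]
  ring

/-! ### Bounds for the action of `𝒫_i` -/

lemma norm_eulerAct_le (n : ℕ) (a : ℕ → ℂ) (p : ℕ) : ‖eulerAct n a p‖ ≤
    ((n : ℝ) + 1) * (p * ‖a (p - 1)‖ + ‖a p‖ + (p + 1) * ‖a (p + 1)‖) := by
  have h1 := neg_one_lt_alph n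
  have h2 := alph_neg n
  have e0 : ‖((n : ℂ) + 1)‖ = (n : ℝ) + 1 := by exact_mod_cast Complex.norm_natCast (n + 1)
  have e1 : ‖(1 + (alph n : ℂ))‖ ≤ 1 := by
    rw [show (1 + (alph n : ℂ)) = ((1 + alph n : ℝ) : ℂ) by push_cast; rfl, Complex.norm_real,
      Real.norm_eq_abs, abs_of_nonneg (by linarith)]
    linarith
  have e2 : ‖((p : ℂ) + 1 + (alph n : ℂ))‖ ≤ p + 1 := by
    have : (0 : ℝ) ≤ p := by positivity
    rw [show ((p : ℂ) + 1 + (alph n : ℂ)) = ((p + 1 + alph n : ℝ) : ℂ) by push_cast; rfl,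
      Complex.norm_real, Real.norm_eq_abs, abs_of_nonneg (by linarith)]
    linarith
  rw [eulerAct, norm_mul, e0]
  gcongr
  refine (norm_sub_le _ _).trans (add_le_add ((norm_sub_le _ _).trans (add_le_add ?_ ?_)) ?_)
  · rw [norm_mul, Complex.norm_natCast]
  · rw [norm_mul]
    exact mul_le_of_le_one_left (norm_nonneg _) e1
  · rw [norm_mul]
    gcongr

/-- `eulerAct` couples only neighbouring indices, with coefficients of size `p + 1`, so an
application uses up one power of the weight; the shift from `p - 1` costs `2^e`. -/
lemma eulerAct_weight (n e : ℕ) {a : ℕ → ℂ} {A : ℝ}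
    (h : ∀ q : ℕ, ((q : ℝ) + 1) ^ (e + 1) * ‖a q‖ ≤ A) (p : ℕ) :
    ((p : ℝ) + 1) ^ e * ‖eulerAct n a p‖ ≤ ((n : ℝ) + 1) * (2 ^ e + 2) * A := by
  have hA : 0 ≤ A := (by positivity : (0 : ℝ) ≤ _).trans (h 0)
  have t1 : ((p : ℝ) + 1) ^ e * (p * ‖a (p - 1)‖) ≤ 2 ^ e * A := by
    rcases p with _ | p
    · simp; positivity
    · have := h p
      calc (((p + 1 : ℕ) : ℝ) + 1) ^ e * (((p + 1 : ℕ) : ℝ) * ‖a (p + 1 - 1)‖)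
          ≤ (2 * ((p : ℝ) + 1)) ^ e * (((p : ℝ) + 1) * ‖a p‖) := by
            push_cast
            gcongr
            linarith [(Nat.cast_nonneg p : (0 : ℝ) ≤ p)]
        _ = 2 ^ e * (((p : ℝ) + 1) ^ (e + 1) * ‖a p‖) := by rw [mul_pow]; ring
        _ ≤ _ := by gcongr
  have t2 : ((p : ℝ) + 1) ^ e * ‖a p‖ ≤ A := by
    refine le_trans ?_ (h p)
    gcongr
    · linarith [(Nat.cast_nonneg p : (0 : ℝ) ≤ p)]
    · omega
  have t3 : ((p : ℝ) + 1) ^ e * ((p + 1) * ‖a (p + 1)‖) ≤ A := by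
    refine le_trans ?_ (h (p + 1))
    rw [← mul_assoc, ← pow_succ]
    gcongr
    linarith
  calc _ ≤ ((p : ℝ) + 1) ^ e *
        (((n : ℝ) + 1) * (p * ‖a (p - 1)‖ + ‖a p‖ + (p + 1) * ‖a (p + 1)‖)) := by
        gcongr
        exact norm_eulerAct_le n a p
    _ = ((n : ℝ) + 1) * (((p : ℝ) + 1) ^ e * (p * ‖a (p - 1)‖) + ((p : ℝ) + 1) ^ e * ‖a p‖
        + ((p : ℝ) + 1) ^ e * ((p + 1) * ‖a (p + 1)‖)) := by ring
    _ ≤ ((n : ℝ) + 1) * (2 ^ e * A + A + A) := by gcongr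
    _ = _ := by ring

lemma eulerAct_iterate_weight (n i j : ℕ) (hj : j ≤ i) {a : ℕ → ℂ} {A : ℝ}
    (h : ∀ q : ℕ, ((q : ℝ) + 1) ^ i * ‖a q‖ ≤ A) (p : ℕ) :
    ((p : ℝ) + 1) ^ (i - j) * ‖((eulerAct n)^[j] a) p‖ ≤ (((n : ℝ) + 1) * (2 ^ i + 2)) ^ j * A := by
  have hA : 0 ≤ A := (by positivity : (0 : ℝ) ≤ _).trans (h 0)
  induction j generalizing p with
  | zero => simpa using h p
  | succ j ih =>
    rw [Function.iterate_succ_apply']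
    refine (eulerAct_weight n (i - (j + 1)) (A := (((n : ℝ) + 1) * (2 ^ i + 2)) ^ j * A)
      (fun q => ?_) p).trans ?_
    · rw [show i - (j + 1) + 1 = i - j by omega]
      exact ih (by omega) q
    · rw [pow_succ' _ j, mul_assoc _ _ A]
      refine mul_le_mul_of_nonneg_right ?_ (by positivity)
      gcongr
      · norm_num
      · omega

/-- The sum defining `pAct` stops at the `i`-th iterate of `eulerAct`, so the weight `(q+1)^i` pays
for all of it. Summing over the finitely many `i` makes the constant uniform. -/
lemma exists_norm_pAct_le (n m : ℕ) : ∃ C : ℝ, 1 ≤ C ∧ ∀ (i : ℕ) (a : ℕ → ℂ) (A : ℝ), i ≤ 2 * m →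
    (∀ q : ℕ, ((q : ℝ) + 1) ^ i * ‖a q‖ ≤ A) → ∀ p, ‖pAct n m i a p‖ ≤ C * A := by
  set c : ℕ → ℝ := fun i => ∑ j ∈ Finset.range (i + 1), |(pPoly n m i).coeff j| *
    (((n : ℝ) + 1) * (2 ^ i + 2)) ^ j with hc
  have hc0 : ∀ i, 0 ≤ c i := fun i => Finset.sum_nonneg fun j _ => by positivity
  refine ⟨1 + ∑ i ∈ Finset.range (2 * m + 1), c i, ?_, ?_⟩
  · linarith [Finset.sum_nonneg fun i (_ : i ∈ Finset.range (2 * m + 1)) => hc0 i]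
  · intro i a A hi h p
    have hA : 0 ≤ A := (by positivity : (0 : ℝ) ≤ _).trans (h 0)
    have h1 : ‖pAct n m i a p‖ ≤ c i * A := by
      rw [pAct, hc, Finset.sum_mul]
      refine (norm_sum_le _ _).trans (Finset.sum_le_sum fun j hj => ?_)
      rw [norm_mul, Complex.norm_real, Real.norm_eq_abs, mul_assoc]
      gcongr
      refine le_trans ?_ (eulerAct_iterate_weight n i j
        (Nat.lt_succ_iff.mp (Finset.mem_range.mp hj)) h p)
      refine le_mul_of_one_le_left (norm_nonneg _) (one_le_pow₀ ?_)
      linarith [(Nat.cast_nonneg p : (0 : ℝ) ≤ p)]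
    have h2 : c i ≤ ∑ i ∈ Finset.range (2 * m + 1), c i :=
      Finset.single_le_sum (fun i _ => hc0 i) (Finset.mem_range.mpr (by omega))
    refine h1.trans ?_
    gcongr
    linarith

lemma eulerAct_support (n : ℕ) {a : ℕ → ℂ} {L : ℕ} (h : ∀ q, L < q → a q = 0) (p : ℕ)
    (hp : L + 1 < p) : eulerAct n a p = 0 := by
  rw [eulerAct, h (p - 1) (by omega), h p (by omega), h (p + 1) (by omega)]
  ring

lemma pAct_support (n m i : ℕ) {a : ℕ → ℂ} {L : ℕ} (h : ∀ q, L < q → a q = 0) (p : ℕ)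
    (hp : L + i < p) : pAct n m i a p = 0 := by
  have key : ∀ j p, L + j < p → ((eulerAct n)^[j] a) p = 0 := by
    intro j
    induction j with
    | zero => exact fun p hp => h p hp
    | succ j ih =>
      intro p hp
      rw [Function.iterate_succ_apply']
      exact eulerAct_support n (L := L + j) ih p (by omega)
  rw [pAct]
  refine Finset.sum_eq_zero fun j hj => ?_
  rw [key j p (by have := Finset.mem_range.mp hj; omega), mul_zero]

end MetivierGen

namespace MetivierGen
open MeasureTheory Filter Topology

/-! ### The frequencies -/

lemma theta_gt_one {m : ℕ} (hm : 0 < m) : 1 < theta m := by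
  have hm' : (1 : ℝ) ≤ m := by exact_mod_cast hm
  rw [theta, lt_div_iff₀ (by linarith)]
  linarith

lemma add_one_le_eig (n p : ℕ) : (p : ℝ) + 1 ≤ eig n p := by
  have : (0 : ℝ) ≤ p := by positivity
  have : (0 : ℝ) ≤ n := by positivity
  rw [eig]
  nlinarith [mul_nonneg (Nat.cast_nonneg p : (0 : ℝ) ≤ p) (Nat.cast_nonneg n : (0 : ℝ) ≤ n)]

lemma freq_eq (n m p : ℕ) : freq n m p = theta m * eig n p ^ (1 / (2 * m) : ℝ) := rfl

lemma rpow_le_freq (n p : ℕ) {m : ℕ} (hm : 0 < m) :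
    ((p : ℝ) + 1) ^ (1 / (2 * m) : ℝ) ≤ freq n m p := by
  rw [freq_eq]
  have h1 : ((p : ℝ) + 1) ^ (1 / (2 * m) : ℝ) ≤ eig n p ^ (1 / (2 * m) : ℝ) :=
    Real.rpow_le_rpow (by positivity) (add_one_le_eig n p) (by positivity)
  refine h1.trans (le_mul_of_one_le_left ?_ (theta_gt_one hm).le)
  exact Real.rpow_nonneg ((by positivity : (0 : ℝ) ≤ (p : ℝ) + 1).trans (add_one_le_eig n p)) _

lemma one_le_freq (n p : ℕ) {m : ℕ} (hm : 0 < m) : 1 ≤ freq n m p := by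
  refine le_trans (Real.one_le_rpow ?_ (by positivity)) (rpow_le_freq n p hm)
  linarith [(Nat.cast_nonneg p : (0 : ℝ) ≤ p)]

lemma freq_pow (n p : ℕ) {m : ℕ} (hm : 0 < m) :
    freq n m p ^ (2 * m) = theta m ^ (2 * m) * eig n p := by
  have hm' : (m : ℝ) ≠ 0 := by exact_mod_cast hm.ne'
  have h0 : 0 ≤ eig n p := (by positivity : (0 : ℝ) ≤ (p : ℝ) + 1).trans (add_one_le_eig n p)
  rw [freq_eq, mul_pow, ← Real.rpow_natCast (eig n p ^ _), ← Real.rpow_mul h0]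
  push_cast
  rw [one_div_mul_cancel (by simpa using hm'), Real.rpow_one]

lemma freq_strictMono (n : ℕ) {m : ℕ} (hm : 0 < m) : StrictMono (freq n m) := by
  intro p q hpq
  rw [freq_eq, freq_eq]
  have h0 : 0 ≤ eig n p := (by positivity : (0 : ℝ) ≤ (p : ℝ) + 1).trans (add_one_le_eig n p)
  have hm' : (0 : ℝ) < m := by exact_mod_cast hm
  have hpq' : (p : ℝ) < q := by exact_mod_cast hpq
  refine mul_lt_mul_of_pos_left (Real.rpow_lt_rpow h0 ?_ (by positivity))
    (by linarith [theta_gt_one hm])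
  rw [eig, eig]
  have : (0 : ℝ) < (n : ℝ) + 1 := by positivity
  nlinarith

/-- The decay rate `Re c_1` of the leading term. -/
noncomputable def decayRate (n m : ℕ) : ℝ := freq n m 0 * (lam m 0).im

lemma decayRate_pos (n : ℕ) {m : ℕ} (hm : 0 < m) : 0 < decayRate n m :=
  mul_pos (by linarith [one_le_freq n 0 hm]) (lam_im_zero_pos m hm)

/-- The leading term `e^(-c_1 ρ)` is one of the resonant exponentials. Hence it solves the
homogeneous equation for `p = 0` and fixes the decay rate of all rows. -/
lemma neg_c₁_eq (n : ℕ) (m : ℕ) : -c₁ n m = charRoot m (freq n m 0) 0 := by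
  rw [c₁, charRoot, freq, eig, lam_eq, Complex.exp_mul_I, ← Complex.ofReal_cos,
    ← Complex.ofReal_sin]
  have e1 : (Real.pi / (2 * m) * (1 + 2 * (0 : ℕ)) : ℝ) = Real.pi / (2 * m) := by push_cast; ring
  have e2 : (4 * (0 : ℕ) * ((n : ℝ) + 1) + 2 * n + 1) = 2 * n + 1 := by push_cast; ring
  rw [e1, e2]
  linear_combination (-((2 * m / (2 * m - 1) * (2 * n + 1 : ℝ) ^ (1 / (2 * m) : ℝ) : ℝ) : ℂ) *
    (Real.sin (Real.pi / (2 * m)) : ℂ)) * Complex.I_sq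

/-- Constants controlling the spectral gaps. -/
lemma exists_spectral_gap (n : ℕ) {m : ℕ} (hm : 0 < m) : ∃ η : ℝ, 0 < η ∧ η ≤ (lam m 0).im ∧
    (∀ j, 0 < j → j + 1 < m → (lam m 0).im + η ≤ (lam m j).im) ∧
    ∀ p, 0 < p → decayRate n m + η * freq n m p ≤ freq n m p * (lam m 0).im := by
  obtain ⟨η₁, hη₁, hgap⟩ := exists_gap m
  have hs := lam_im_zero_pos m hm
  set s := (lam m 0).im
  have h01 : freq n m 0 < freq n m 1 := freq_strictMono n hm one_pos
  have hc0 : 0 < freq n m 0 := by linarith [one_le_freq n 0 hm]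
  have hc1 : 0 < freq n m 1 := hc0.trans h01
  have hη₂ : 0 < s * (1 - freq n m 0 / freq n m 1) := by
    refine mul_pos hs (sub_pos.mpr ?_)
    rwa [div_lt_one hc1]
  refine ⟨min (min s η₁) (s * (1 - freq n m 0 / freq n m 1)), by positivity,
    (min_le_left _ _).trans (min_le_left _ _), fun j h1 h2 => ?_, fun p hp => ?_⟩
  · have := hgap j h1 h2
    have : min (min s η₁) (s * (1 - freq n m 0 / freq n m 1)) ≤ η₁ :=
      (min_le_left _ _).trans (min_le_right _ _)
    linarith
  · have h1p : freq n m 1 ≤ freq n m p := (freq_strictMono n hm).monotone hp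
    have hcp : 0 < freq n m p := hc1.trans_le h1p
    have h1 : min (min s η₁) (s * (1 - freq n m 0 / freq n m 1)) * freq n m p
        ≤ s * (1 - freq n m 0 / freq n m 1) * freq n m p :=
      mul_le_mul_of_nonneg_right (min_le_right _ _) hcp.le
    have h2 : freq n m 0 ≤ freq n m 0 / freq n m 1 * freq n m p := by
      rw [div_mul_eq_mul_div, le_div_iff₀ hc1]
      gcongr
    have h3 : decayRate n m ≤ s * (freq n m 0 / freq n m 1 * freq n m p) := by
      rw [decayRate, mul_comm]
      gcongr
    linarith

/-! ### The growth factor `(ℓ!)^(1-1/2m)` -/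

/-- `κ = 1 - 1/(2m)`. -/
noncomputable def growthExp (m : ℕ) : ℝ := 1 - 1 / (2 * m)

/-- `(ℓ!)^(1-1/2m)`. -/
noncomputable def growth (m l : ℕ) : ℝ := (l.factorial : ℝ) ^ growthExp m

lemma growthExp_nonneg {m : ℕ} (hm : 0 < m) : 0 ≤ growthExp m := by
  have hm' : (1 : ℝ) ≤ m := by exact_mod_cast hm
  rw [growthExp, sub_nonneg, div_le_one (by positivity)]
  linarith

lemma growthExp_le_one (m : ℕ) : growthExp m ≤ 1 := by
  rw [growthExp]
  have : (0 : ℝ) ≤ 1 / (2 * m) := by positivity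
  linarith

lemma growth_pos (m l : ℕ) : 0 < growth m l := Real.rpow_pos_of_pos (by positivity) _

lemma growth_mono {m : ℕ} (hm : 0 < m) : Monotone (growth m) := by
  intro k l h
  exact Real.rpow_le_rpow (by positivity) (by exact_mod_cast Nat.factorial_le h)
    (growthExp_nonneg hm)

/-- The crude factor `l + 1` in place of `(l+1)^κ` is enough, because the resonant integration
returns a factor of the order of its inverse. -/
lemma growth_succ_le (m l : ℕ) : growth m (l + 1) ≤ ((l : ℝ) + 1) * growth m l := by
  rw [growth, growth, Nat.factorial_succ]
  push_cast
  rw [Real.mul_rpow (by positivity) (by positivity)]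
  gcongr
  calc ((l : ℝ) + 1) ^ growthExp m ≤ ((l : ℝ) + 1) ^ (1 : ℝ) :=
        Real.rpow_le_rpow_of_exponent_le (by linarith [(Nat.cast_nonneg l : (0 : ℝ) ≤ l)])
          (growthExp_le_one m)
    _ = _ := Real.rpow_one _

/-- The gain `c_q^(-i)` compensates the loss `(q+1)^i` up to the growth factor. -/
lemma weight_mul_growth_le (n : ℕ) {m : ℕ} (hm : 0 < m) {q l : ℕ} (hq : q ≤ l) (i : ℕ) :
    ((q : ℝ) + 1) ^ i * growth m l ≤ freq n m q ^ i * growth m (l + i) := by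
  have hm' : (0 : ℝ) < m := by exact_mod_cast hm
  have hq0 : (0 : ℝ) < (q : ℝ) + 1 := by positivity
  -- The first factor is at most `c_q`. The second is at most `(l+1)^κ`, whose `i`-th power
  -- multiplied by `(l!)^κ` stays below `((l+i)!)^κ`.
  have e : (q : ℝ) + 1 = ((q : ℝ) + 1) ^ (1 / (2 * m) : ℝ) * ((q : ℝ) + 1) ^ growthExp m := by
    rw [← Real.rpow_add hq0, growthExp, add_sub_cancel, Real.rpow_one]
  have hq' : ((q : ℝ) + 1) ^ growthExp m ≤ ((l : ℝ) + 1) ^ growthExp m :=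
    Real.rpow_le_rpow hq0.le (by exact_mod_cast Nat.succ_le_succ hq) (growthExp_nonneg hm)
  have hfac : ((((l : ℝ) + 1) ^ growthExp m)) ^ i * growth m l ≤ growth m (l + i) := by
    rw [growth, growth, ← Real.rpow_natCast, ← Real.rpow_mul (by positivity), mul_comm (growthExp m),
      Real.rpow_mul (by positivity), Real.rpow_natCast,
      ← Real.mul_rpow (by positivity) (by positivity)]
    refine Real.rpow_le_rpow (by positivity) ?_ (growthExp_nonneg hm)
    have := Nat.factorial_mul_pow_le_factorial (m := l) (n := i)
    rw [mul_comm]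
    exact_mod_cast this
  have hf := rpow_le_freq n q hm
  have hf0 : 0 ≤ freq n m q := by linarith [one_le_freq n q hm]
  have h0 : (0 : ℝ) ≤ ((q : ℝ) + 1) ^ (1 / (2 * m) : ℝ) := by positivity
  have hg := growth_pos m l
  calc ((q : ℝ) + 1) ^ i * growth m l
      = (((q : ℝ) + 1) ^ (1 / (2 * m) : ℝ)) ^ i * ((((q : ℝ) + 1) ^ growthExp m) ^ i * growth m l) := by
        nth_rewrite 1 [e]; rw [mul_pow]; ring
    _ ≤ freq n m q ^ i * ((((l : ℝ) + 1) ^ growthExp m) ^ i * growth m l) := by gcongr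
    _ ≤ _ := by gcongr

/-! ### The recursion for the coefficients -/

section Recursion

variable (n m : ℕ) (χ : ℕ → ℝ → ℝ)

lemma gCoef_zero_row (p : ℕ) : gCoef n m χ 0 p =
    fun ρ : ℝ => if p = 0 then Complex.exp (-(c₁ n m * (ρ : ℂ))) else 0 := by
  rw [gCoef]; simp

/-- Row `l` reads only rows `k < l` of its history, so the truncation that makes the recursion
terminate can be dropped. -/
lemma gCoef_of_pos {l : ℕ} (hl : 0 < l) : gCoef n m χ l =
    fun p => if p = 0 then gZero n m χ (gCoef n m χ) l
      else if p ≤ l then gPos n m χ (gCoef n m χ) l p else fun _ => 0 := by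
  have hpos : ∀ p, gPos n m χ (fun k => if _h : k < l then gCoef n m χ k else fun _ _ => 0) l p
      = gPos n m χ (gCoef n m χ) l p := by
    intro p
    have : rhsPos n m (fun k => if _h : k < l then gCoef n m χ k else fun _ _ => 0) l p
        = rhsPos n m (gCoef n m χ) l p := by
      funext ρ
      rw [rhsPos, rhsPos]
      congr 1
      refine Finset.sum_congr rfl fun i hi => ?_
      rw [Finset.mem_Icc] at hi
      simp only [dif_pos (show l - i < l by omega)]
    funext ρ
    rw [gPos, gPos, this]
  have hzero : gZero n m χ (fun k => if _h : k < l then gCoef n m χ k else fun _ _ => 0) l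
      = gZero n m χ (gCoef n m χ) l := by
    have : rhsZero n m χ (fun k => if _h : k < l then gCoef n m χ k else fun _ _ => 0) l
        = rhsZero n m χ (gCoef n m χ) l := by
      funext ρ
      rw [rhsZero, rhsZero]
      simp only [hpos]
      congr 1
      refine Finset.sum_congr rfl fun i hi => ?_
      rw [Finset.mem_Icc] at hi
      simp only [dif_pos (show l + 1 - i < l by omega)]
    funext ρ
    rw [gZero, gZero, this]
  funext p
  rw [gCoef]
  simp only [if_neg hl.ne', hpos, hzero]

lemma gCoef_of_lt {l p : ℕ} (h : l < p) : gCoef n m χ l p = fun _ => 0 := by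
  rcases Nat.eq_zero_or_pos l with rfl | hl
  · rw [gCoef_zero_row]; simp [h.ne']
  · rw [gCoef_of_pos n m χ hl]
    simp only [if_neg (show p ≠ 0 by omega), if_neg (show ¬ p ≤ l by omega)]

lemma gCoef_pos {l p : ℕ} (hp : 0 < p) (hpl : p ≤ l) :
    gCoef n m χ l p = gPos n m χ (gCoef n m χ) l p := by
  rw [gCoef_of_pos n m χ (hp.trans_le hpl)]
  simp only [if_neg hp.ne', if_pos hpl]

lemma gCoef_zero {l : ℕ} (hl : 0 < l) : gCoef n m χ l 0 = gZero n m χ (gCoef n m χ) l := by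
  rw [gCoef_of_pos n m χ hl]
  simp

end Recursion

lemma greenSol_sub (m : ℕ) (c : ℝ) (κ₁ κ₂ : ℕ → ℂ) (F : ℝ → ℂ) (ρ : ℝ) :
    greenSol m c κ₁ F ρ - greenConst m c * ∑ j ∈ Finset.range (2 * m),
      lam m j * (Complex.exp (charRoot m c j * ρ) * (κ₂ j - κ₁ j)) = greenSol m c κ₂ F ρ := by
  rw [greenSol, greenSol, ← mul_sub, ← Finset.sum_sub_distrib]
  congr 1
  refine Finset.sum_congr rfl fun j _ => ?_
  rw [odeSol, odeSol]
  ring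

lemma homSol_eq (n m j : ℕ) (F : ℝ → ℂ) (ρ : ℝ) : homSol n m j F ρ =
    greenConst m (freq n m 0) * (lam m j * (Complex.exp (charRoot m (freq n m 0) j * ρ) *
      ∫ τ : ℝ, Complex.exp (-(charRoot m (freq n m 0) j * τ)) * F τ)) := by
  rw [homSol, greenConst, charRoot]; ring

/-- Subtracting `h_j` changes `κ j` from `0` to the total integral, turning a forward integration
into a backward one. This is done for the resonant roots `0` and `m - 1` only; when `m = 1` the
index set collapses to one element, in accordance with the single subtraction. -/
lemma IsSource.integral_fundSol_sub_homSol {ρ₀ σ B : ℝ} {L : ℕ} {F : ℝ → ℂ}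
    (h : IsSource ρ₀ σ B L F) (hσ : 0 < σ) (n : ℕ) {m : ℕ} (hm : 0 < m) (ρ : ℝ) :
    (∫ τ : ℝ, fundSol n m 0 (ρ - τ) * F τ) - ∑ j ∈ ({0, m - 1} : Finset ℕ), homSol n m j F ρ =
      greenSol m (freq n m 0) (fun j => if j < m ∧ j ≠ 0 ∧ j ≠ m - 1 then 0 else
        ∫ τ : ℝ, Complex.exp (-(charRoot m (freq n m 0) j * τ)) * F τ) F ρ := by
  rw [h.integral_fundSol hσ n 0 hm (by linarith [one_le_freq n 0 hm])]
  refine Eq.trans ?_ (greenSol_sub m _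
    (fun j => if j < m then 0 else ∫ τ : ℝ, Complex.exp (-(charRoot m (freq n m 0) j * τ)) * F τ)
    _ F ρ)
  congr 1
  simp only [homSol_eq]
  rw [← Finset.mul_sum]
  congr 1
  have hsub : ({0, m - 1} : Finset ℕ) ⊆ Finset.range (2 * m) := by
    intro j hj
    simp only [Finset.mem_insert, Finset.mem_singleton] at hj
    rw [Finset.mem_range]; omega
  refine Eq.trans (Finset.sum_congr rfl fun j hj => ?_) (Finset.sum_subset hsub fun j _ hj => ?_)
  · simp only [Finset.mem_insert, Finset.mem_singleton] at hj
    rw [if_pos (show j < m by omega), if_neg (by tauto), sub_zero]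
  · simp only [Finset.mem_insert, Finset.mem_singleton, not_or] at hj
    by_cases hjm : j < m
    · simp [hjm, hj]
    · simp [hjm]

end MetivierGen

namespace MetivierGen
open MeasureTheory Filter Topology

/-! ### Estimates of the coefficients `g_{ℓ,p}` -/

lemma contDiff_iteratedDeriv_infty {f : ℝ → ℂ} (hf : ContDiff ℝ ((⊤ : ℕ∞) : WithTop ℕ∞) f)
    (k : ℕ) : ContDiff ℝ ((⊤ : ℕ∞) : WithTop ℕ∞) (iteratedDeriv k f) := by
  rw [iteratedDeriv_eq_iterate]
  exact hf.iterate_deriv k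

/-- A function vanishing near the origin can be divided by powers of the variable. -/
lemma contDiff_cutoff_mul_inv {f h : ℝ → ℂ} {ρ₀ : ℝ} (hρ₀ : 0 < ρ₀)
    (hf : ContDiff ℝ ((⊤ : ℕ∞) : WithTop ℕ∞) f) (h0 : ∀ ρ, ρ < ρ₀ → f ρ = 0)
    (hh : ContDiff ℝ ((⊤ : ℕ∞) : WithTop ℕ∞) h) (i : ℕ) :
    ContDiff ℝ ((⊤ : ℕ∞) : WithTop ℕ∞) (fun ρ : ℝ => f ρ * (((ρ : ℂ) ^ i)⁻¹ * h ρ)) := by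
  refine contDiff_iff_contDiffAt.mpr fun ρ => ?_
  rcases lt_or_ge ρ ρ₀ with hlt | hge
  · refine (contDiffAt_const (c := (0 : ℂ))).congr_of_eventuallyEq ?_
    filter_upwards [Iio_mem_nhds hlt] with τ hτ
    rw [h0 τ hτ, zero_mul]
  · have hne : (ρ : ℂ) ^ i ≠ 0 := pow_ne_zero _ (by exact_mod_cast (hρ₀.trans_le hge).ne')
    have hp : ContDiffAt ℝ ((⊤ : ℕ∞) : WithTop ℕ∞) (fun ρ : ℝ => ((ρ : ℂ) ^ i)) ρ :=
      (Complex.ofRealCLM.contDiff.pow i).contDiffAt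
    exact hf.contDiffAt.mul ((hp.inv hne).mul hh.contDiffAt)

/-- The estimate of the row `ℓ` of coefficients on `[2R₁(ℓ+1), ∞)`. -/
structure RowEst (n m : ℕ) (χ : ℕ → ℝ → ℝ) (R₁ K D : ℝ) (l : ℕ) : Prop where
  smooth : ∀ p, ContDiff ℝ ((⊤ : ℕ∞) : WithTop ℕ∞) (gCoef n m χ l p)
  bound : ∀ (p i : ℕ) (ρ : ℝ), i ≤ 2 * m → 2 * R₁ * (l + 1) ≤ ρ →
    freq n m p ^ i * ‖iteratedDeriv (2 * m - i) (gCoef n m χ l p) ρ‖ ≤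
      D * K ^ l * growth m l * (ρ ^ l)⁻¹ * Real.exp (-(decayRate n m * ρ))

section Rows

variable {n m : ℕ} {χ : ℕ → ℝ → ℝ} {R₁ K D : ℝ}

lemma iteratedDeriv_zero_fun (k : ℕ) (ρ : ℝ) : iteratedDeriv k (fun _ : ℝ => (0 : ℂ)) ρ = 0 := by
  simp

/-- The loss `(q+1)^i` of `𝒫_i` meets the factor `c_q^i` in the row estimate, and
`weight_mul_growth_le` settles the difference. So `ρ^(-i) 𝒫_i` applied to row `k` has the growth and
the power of `ρ` of row `k + i`. -/
lemma RowEst.norm_term_le (hm : 0 < m) {k : ℕ} (h : RowEst n m χ R₁ K D k) {C : ℝ}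
    (hC : ∀ (i : ℕ) (a : ℕ → ℂ) (A : ℝ), i ≤ 2 * m →
      (∀ q : ℕ, ((q : ℝ) + 1) ^ i * ‖a q‖ ≤ A) → ∀ p, ‖pAct n m i a p‖ ≤ C * A)
    (hR₁ : 0 < R₁) (hK : 0 ≤ K) (hD : 0 ≤ D) {i : ℕ} (hi : i ≤ 2 * m) {ρ : ℝ}
    (hρ : 2 * R₁ * (k + 1) ≤ ρ) (p : ℕ) :
    ‖((ρ : ℂ) ^ i)⁻¹ * pAct n m i (fun q => iteratedDeriv (2 * m - i) (gCoef n m χ k q) ρ) p‖ ≤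
      C * (D * K ^ k * growth m (k + i) * (ρ ^ (k + i))⁻¹ *
        Real.exp (-(decayRate n m * ρ))) := by
  have hρ0 : 0 < ρ := lt_of_lt_of_le (by positivity) hρ
  set E := Real.exp (-(decayRate n m * ρ))
  have hG := growth_pos m k
  have hG' := growth_pos m (k + i)
  have hA := hC i (fun q => iteratedDeriv (2 * m - i) (gCoef n m χ k q) ρ)
    (D * K ^ k * growth m (k + i) * (ρ ^ k)⁻¹ * E) hi (fun q => ?_) p
  · rw [norm_mul, norm_inv, norm_pow, Complex.norm_real, Real.norm_eq_abs, abs_of_pos hρ0]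
    calc _ ≤ (ρ ^ i)⁻¹ * (C * (D * K ^ k * growth m (k + i) * (ρ ^ k)⁻¹ * E)) := by gcongr
      _ = _ := by rw [pow_add ρ, mul_inv]; ring
  · rcases lt_or_ge k q with hlt | hge
    · simp only [gCoef_of_lt n m χ hlt, iteratedDeriv_zero_fun, norm_zero, mul_zero]
      positivity
    · have h1 := weight_mul_growth_le n hm hge i
      have h2 := h.bound q i ρ hi hρ
      set N := ‖iteratedDeriv (2 * m - i) (gCoef n m χ k q) ρ‖
      have hN : 0 ≤ N := norm_nonneg _
      rw [← mul_le_mul_iff_left₀ hG]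
      calc ((q : ℝ) + 1) ^ i * N * growth m k = (((q : ℝ) + 1) ^ i * growth m k) * N := by ring
        _ ≤ (freq n m q ^ i * growth m (k + i)) * N := by gcongr
        _ = growth m (k + i) * (freq n m q ^ i * N) := by ring
        _ ≤ growth m (k + i) * (D * K ^ k * growth m k * (ρ ^ k)⁻¹ * E) := by gcongr
        _ = _ := by ring

lemma smooth_cutoff_ofReal (hχ : IsChiFamily m R₁ χ) (l : ℕ) :
    ContDiff ℝ ((⊤ : ℕ∞) : WithTop ℕ∞) (fun ρ => (χ l ρ : ℂ)) :=
  Complex.ofRealCLM.contDiff.comp (hχ.smooth l)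

lemma contDiff_pAct {N : WithTop ℕ∞} (n m i : ℕ) {a : ℕ → ℝ → ℂ}
    (h : ∀ q, ContDiff ℝ N (a q)) (p : ℕ) :
    ContDiff ℝ N (fun ρ => pAct n m i (fun q => a q ρ) p) := by
  simp only [pAct_eq_polyAct]
  exact contDiff_polyAct n _ h p

lemma contDiff_source_pos (hχ : IsChiFamily m R₁ χ) (hR₁ : 0 < R₁) {l : ℕ}
    (h : ∀ k < l, RowEst n m χ R₁ K D k) (p : ℕ) :
    ContDiff ℝ ((⊤ : ℕ∞) : WithTop ℕ∞)
      (fun τ => (χ l τ : ℂ) * rhsPos n m (gCoef n m χ) l p τ) := by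
  simp only [rhsPos, mul_neg, Finset.mul_sum]
  refine (ContDiff.sum fun i hi => ?_).neg
  rw [Finset.mem_Icc] at hi
  refine contDiff_cutoff_mul_inv (ρ₀ := 2 * R₁ * (l + 1)) (by positivity)
    (smooth_cutoff_ofReal hχ l) (fun ρ hρ => by rw [hχ.eq_zero l ρ hρ]; simp) ?_ i
  exact contDiff_pAct n m i (fun q => contDiff_iteratedDeriv_infty
    ((h (l - i) (by omega)).smooth q) _) p

/-- Every term has the order of row `(l - i) + i = l`. Since `i ≥ 1`, only `K^(l-1)` appears, and
the spare factor `K` will absorb all constants. -/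
lemma norm_rhsPos_le (hm : 0 < m) {l : ℕ} (h : ∀ k < l, RowEst n m χ R₁ K D k)
    {C : ℝ} (hC1 : 1 ≤ C) (hC : ∀ (i : ℕ) (a : ℕ → ℂ) (A : ℝ), i ≤ 2 * m →
      (∀ q : ℕ, ((q : ℝ) + 1) ^ i * ‖a q‖ ≤ A) → ∀ p, ‖pAct n m i a p‖ ≤ C * A)
    (hR₁ : 0 < R₁) (hK : 1 ≤ K) (hD : 0 ≤ D) {ρ : ℝ} (hρ : 2 * R₁ * (l + 1) ≤ ρ) (p : ℕ) :
    ‖rhsPos n m (gCoef n m χ) l p ρ‖ ≤ 2 * m * C * (D * K ^ (l - 1)) * growth m l *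
      (ρ ^ l)⁻¹ * Real.exp (-(decayRate n m * ρ)) := by
  have hρ0 : 0 < ρ := lt_of_lt_of_le (by positivity) hρ
  have hG := growth_pos m l
  rw [rhsPos, norm_neg]
  set E := Real.exp (-(decayRate n m * ρ))
  have : ∀ i ∈ Finset.Icc 1 (min l (2 * m)), ‖((ρ : ℂ) ^ i)⁻¹ *
      pAct n m i (fun q => iteratedDeriv (2 * m - i) (gCoef n m χ (l - i) q) ρ) p‖ ≤
      C * (D * K ^ (l - 1) * growth m l * (ρ ^ l)⁻¹ * E) := by
    intro i hi
    rw [Finset.mem_Icc] at hi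
    have hρ' : 2 * R₁ * (((l - i : ℕ) : ℝ) + 1) ≤ ρ := by
      refine le_trans ?_ hρ
      have : ((l - i : ℕ) : ℝ) ≤ l := by exact_mod_cast Nat.sub_le l i
      gcongr
    have := (h (l - i) (by omega)).norm_term_le hm hC hR₁ (by linarith) hD
      (show i ≤ 2 * m by omega) hρ' p
    rw [Nat.sub_add_cancel (show i ≤ l by omega)] at this
    refine this.trans ?_
    have hKK : K ^ (l - i) ≤ K ^ (l - 1) := pow_le_pow_right₀ hK (by omega)
    gcongr
  refine (norm_sum_le_of_le _ this).trans ?_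
  rw [Finset.sum_const, nsmul_eq_mul, Nat.card_Icc, Nat.add_sub_cancel]
  have hcard : ((min l (2 * m) : ℕ) : ℝ) ≤ 2 * m := by exact_mod_cast min_le_right l (2 * m)
  calc _ ≤ (2 * m : ℝ) * (C * (D * K ^ (l - 1) * growth m l * (ρ ^ l)⁻¹ * E)) := by gcongr
    _ = _ := by ring

lemma isSource_pos (hm : 0 < m) (hχ : IsChiFamily m R₁ χ) {l : ℕ}
    (h : ∀ k < l, RowEst n m χ R₁ K D k)
    {C : ℝ} (hC1 : 1 ≤ C) (hC : ∀ (i : ℕ) (a : ℕ → ℂ) (A : ℝ), i ≤ 2 * m →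
      (∀ q : ℕ, ((q : ℝ) + 1) ^ i * ‖a q‖ ≤ A) → ∀ p, ‖pAct n m i a p‖ ≤ C * A)
    (hR₁ : 0 < R₁) (hK : 1 ≤ K) (hD : 0 ≤ D) {Cχ : ℝ} (hCχ : ∀ l ρ, |χ l ρ| ≤ Cχ) (p : ℕ) :
    IsSource (2 * R₁ * (l + 1)) (decayRate n m)
      (Cχ * (2 * m * C * (D * K ^ (l - 1)) * growth m l)) l
      (fun τ => (χ l τ : ℂ) * rhsPos n m (gCoef n m χ) l p τ) where
  cont := (contDiff_source_pos hχ hR₁ h p).continuous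
  zero τ hτ := by rw [hχ.eq_zero l τ hτ]; simp
  bound τ hτ := by
    rw [norm_mul, Complex.norm_real, Real.norm_eq_abs, mul_assoc Cχ, mul_assoc Cχ]
    have := norm_rhsPos_le hm h hC1 hC hR₁ hK hD hτ p
    have h0 : 0 ≤ Cχ := (abs_nonneg _).trans (hCχ 0 0)
    exact mul_le_mul (hCχ l τ) this (norm_nonneg _) h0
  pos := by positivity

/-- Estimates of `G_p * (χ_ℓ f_{ℓ,p})`, `p ≥ 1`. -/
lemma gPos_est (hm : 0 < m) (hχ : IsChiFamily m R₁ χ) {l : ℕ}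
    (h : ∀ k < l, RowEst n m χ R₁ K D k)
    {C : ℝ} (hC1 : 1 ≤ C) (hC : ∀ (i : ℕ) (a : ℕ → ℂ) (A : ℝ), i ≤ 2 * m →
      (∀ q : ℕ, ((q : ℝ) + 1) ^ i * ‖a q‖ ≤ A) → ∀ p, ‖pAct n m i a p‖ ≤ C * A)
    (hR₁ : 0 < R₁) (hK : 1 ≤ K) (hD : 0 ≤ D) {Cχ : ℝ} (hCχ : ∀ l ρ, |χ l ρ| ≤ Cχ)
    {η : ℝ} (hη : 0 < η) (hηR : 1 ≤ η * R₁)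
    (hgap : ∀ p, 0 < p → decayRate n m + η * freq n m p ≤ freq n m p * (lam m 0).im)
    {p : ℕ} (hp : 0 < p) :
    ContDiff ℝ ((⊤ : ℕ∞) : WithTop ℕ∞) (gPos n m χ (gCoef n m χ) l p) ∧
    (∀ ρ, iteratedDeriv (2 * m) (gPos n m χ (gCoef n m χ) l p) ρ =
      -((-1) ^ m * (freq n m p : ℂ) ^ (2 * m)) * gPos n m χ (gCoef n m χ) l p ρ
        + (χ l ρ : ℂ) * rhsPos n m (gCoef n m χ) l p ρ) ∧
    ∀ (i : ℕ) (ρ : ℝ), i ≤ 2 * m → 2 * R₁ * (l + 1) ≤ ρ →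
    freq n m p ^ i * ‖iteratedDeriv (2 * m - i) (gPos n m χ (gCoef n m χ) l p) ρ‖ ≤
      (2 / η + 1) * (Cχ * (2 * m * C * (D * K ^ (l - 1)) * growth m l) * (ρ ^ l)⁻¹ *
        Real.exp (-(decayRate n m * ρ))) := by
  have hs := isSource_pos hm hχ h hC1 hC hR₁ hK hD hCχ p
  have hc1 := one_le_freq n p hm
  have hc : 0 < freq n m p := by linarith
  have hσ := decayRate_pos n hm
  have heq : gPos n m χ (gCoef n m χ) l p = greenSol m (freq n m p)
      (fun j => if j < m then 0 else ∫ τ : ℝ, Complex.exp (-(charRoot m (freq n m p) j * τ)) *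
        ((χ l τ : ℂ) * rhsPos n m (gCoef n m χ) l p τ))
      (fun τ => (χ l τ : ℂ) * rhsPos n m (gCoef n m χ) l p τ) :=
    funext fun ρ => hs.integral_fundSol hσ n p hm hc ρ
  rw [heq]
  refine ⟨contDiff_greenSol (contDiff_source_pos hχ hR₁ h p),
    fun ρ => iteratedDeriv_greenSol_top hm hc hs.cont ρ, fun i ρ hi hρ => ?_⟩
  refine hs.norm_greenSol_le hm hc hη (hgap p hp) hσ ?_ hρ i hi
  have h1 : η * R₁ ≤ η * freq n m p * R₁ := by
    have : 0 < η * R₁ := by positivity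
    nlinarith
  have hl : (0 : ℝ) ≤ l := by positivity
  calc (l : ℝ) ≤ 1 * (l + 1) := by linarith
    _ ≤ (η * freq n m p * R₁) * (l + 1) := by gcongr; linarith
    _ = _ := by ring

lemma rhsZero_eq (hm : 0 < m) (l : ℕ) (ρ : ℝ) : rhsZero n m χ (gCoef n m χ) l ρ =
    -(((ρ : ℂ) ^ 1)⁻¹ * (-(2 * m * gam n m * (n + 1) * (1 + alph n) : ℝ) *
      iteratedDeriv (2 * m - 1) (gPos n m χ (gCoef n m χ) l 1) ρ))
    - ∑ i ∈ Finset.Icc 2 (min (l + 1) (2 * m)), ((ρ : ℂ) ^ i)⁻¹ *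
        pAct n m i (fun q => iteratedDeriv (2 * m - i) (gCoef n m χ (l + 1 - i) q) ρ) 0 := by
  rw [rhsZero, pAct_one_zero n m hm]
  simp

lemma contDiff_source_zero (hm : 0 < m) (hχ : IsChiFamily m R₁ χ) (hR₁ : 0 < R₁) {l : ℕ}
    (h : ∀ k < l, RowEst n m χ R₁ K D k)
    (hg : ContDiff ℝ ((⊤ : ℕ∞) : WithTop ℕ∞) (gPos n m χ (gCoef n m χ) l 1)) :
    ContDiff ℝ ((⊤ : ℕ∞) : WithTop ℕ∞)
      (fun τ => (χ l τ : ℂ) * rhsZero n m χ (gCoef n m χ) l τ) := by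
  simp only [rhsZero_eq hm, mul_sub, mul_neg, Finset.mul_sum]
  have hz : ∀ ρ, ρ < 2 * R₁ * (l + 1) → (χ l ρ : ℂ) = 0 := fun ρ hρ => by
    rw [hχ.eq_zero l ρ hρ]; simp
  refine ContDiff.sub (ContDiff.neg ?_) (ContDiff.sum fun i hi => ?_)
  · exact contDiff_cutoff_mul_inv (ρ₀ := 2 * R₁ * (l + 1)) (by positivity)
      (smooth_cutoff_ofReal hχ l) hz (contDiff_const.mul (contDiff_iteratedDeriv_infty hg _)) 1
  · rw [Finset.mem_Icc] at hi
    refine contDiff_cutoff_mul_inv (ρ₀ := 2 * R₁ * (l + 1)) (by positivity)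
      (smooth_cutoff_ofReal hχ l) hz ?_ i
    exact contDiff_pAct n m i (fun q => contDiff_iteratedDeriv_infty
      ((h (l + 1 - i) (by omega)).smooth q) _) 0

/-- `𝒫_1` enters only through component `1` of the current row, with an extra `ρ⁻¹`, and the terms
`i ≥ 2` act on rows `l + 1 - i`. Everything is of order `ρ^(-(l+1))`, which supplies the power lost
in the resonant integration. -/
lemma norm_rhsZero_le (hm : 0 < m) {l : ℕ} (hl : 0 < l) (h : ∀ k < l, RowEst n m χ R₁ K D k)
    {C : ℝ} (hC1 : 1 ≤ C) (hC : ∀ (i : ℕ) (a : ℕ → ℂ) (A : ℝ), i ≤ 2 * m →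
      (∀ q : ℕ, ((q : ℝ) + 1) ^ i * ‖a q‖ ≤ A) → ∀ p, ‖pAct n m i a p‖ ≤ C * A)
    (hR₁ : 0 < R₁) (hK : 1 ≤ K) (hD : 0 ≤ D) {Q : ℝ} (hQ : 0 ≤ Q) {ρ : ℝ}
    (hρ : 2 * R₁ * (l + 1) ≤ ρ)
    (hg : ‖iteratedDeriv (2 * m - 1) (gPos n m χ (gCoef n m χ) l 1) ρ‖ ≤
      Q * (D * K ^ (l - 1)) * growth m l * (ρ ^ l)⁻¹ * Real.exp (-(decayRate n m * ρ))) :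
    ‖rhsZero n m χ (gCoef n m χ) l ρ‖ ≤
      (|2 * m * gam n m * (n + 1) * (1 + alph n)| * Q + 2 * m * C) * (D * K ^ (l - 1)) *
        growth m (l + 1) * (ρ ^ (l + 1))⁻¹ * Real.exp (-(decayRate n m * ρ)) := by
  have hρ0 : 0 < ρ := lt_of_lt_of_le (by positivity) hρ
  have hG := growth_pos m l
  have hG' := growth_pos m (l + 1)
  have hGG : growth m l ≤ growth m (l + 1) := growth_mono hm (Nat.le_succ l)
  rw [rhsZero_eq hm]
  set E := Real.exp (-(decayRate n m * ρ))
  set W : ℝ := 2 * m * gam n m * (n + 1) * (1 + alph n)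
  set P := D * K ^ (l - 1) * growth m (l + 1) * (ρ ^ (l + 1))⁻¹ * E with hP
  have hP0 : 0 ≤ P := by positivity
  have t1 : ‖-(((ρ : ℂ) ^ 1)⁻¹ * (-(W : ℝ) *
      iteratedDeriv (2 * m - 1) (gPos n m χ (gCoef n m χ) l 1) ρ))‖ ≤ |W| * Q * P := by
    rw [norm_neg, norm_mul, norm_inv, norm_pow, norm_mul, norm_neg, Complex.norm_real,
      Complex.norm_real, Real.norm_eq_abs, Real.norm_eq_abs, abs_of_pos hρ0]
    calc _ ≤ (ρ ^ 1)⁻¹ * (|W| * (Q * (D * K ^ (l - 1)) * growth m (l + 1) * (ρ ^ l)⁻¹ * E)) := by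
          gcongr
          refine hg.trans ?_
          gcongr
      _ = _ := by rw [hP, pow_succ ρ l, mul_inv]; ring
  have t2 : ∀ i ∈ Finset.Icc 2 (min (l + 1) (2 * m)), ‖((ρ : ℂ) ^ i)⁻¹ *
      pAct n m i (fun q => iteratedDeriv (2 * m - i) (gCoef n m χ (l + 1 - i) q) ρ) 0‖ ≤
      C * P := by
    intro i hi
    rw [Finset.mem_Icc] at hi
    have hρ' : 2 * R₁ * (((l + 1 - i : ℕ) : ℝ) + 1) ≤ ρ := by
      refine le_trans ?_ hρ
      have : ((l + 1 - i : ℕ) : ℝ) ≤ l := by exact_mod_cast (by omega : l + 1 - i ≤ l)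
      gcongr
    have := (h (l + 1 - i) (by omega)).norm_term_le hm hC hR₁ (by linarith) hD
      (show i ≤ 2 * m by omega) hρ' 0
    rw [Nat.sub_add_cancel (show i ≤ l + 1 by omega)] at this
    refine this.trans ?_
    have hKK : K ^ (l + 1 - i) ≤ K ^ (l - 1) := pow_le_pow_right₀ hK (by omega)
    rw [hP]
    gcongr
  refine (norm_sub_le _ _).trans ((add_le_add t1 (norm_sum_le_of_le _ t2)).trans ?_)
  rw [Finset.sum_const, nsmul_eq_mul, Nat.card_Icc]
  have hcard : ((min (l + 1) (2 * m) + 1 - 2 : ℕ) : ℝ) ≤ 2 * m := by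
    exact_mod_cast (by omega : min (l + 1) (2 * m) + 1 - 2 ≤ 2 * m)
  calc _ ≤ |W| * Q * P + (2 * m : ℝ) * (C * P) := by gcongr
    _ = _ := by rw [hP]; ring

lemma isSource_zero (hχ : IsChiFamily m R₁ χ) {l : ℕ}
    (hR₁ : 0 < R₁) {Cχ : ℝ} (hCχ : ∀ l ρ, |χ l ρ| ≤ Cχ) {B : ℝ} {L : ℕ}
    (hcont : Continuous (fun τ => (χ l τ : ℂ) * rhsZero n m χ (gCoef n m χ) l τ))
    (hb : ∀ ρ, 2 * R₁ * (l + 1) ≤ ρ → ‖rhsZero n m χ (gCoef n m χ) l ρ‖ ≤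
      B * (ρ ^ L)⁻¹ * Real.exp (-(decayRate n m * ρ))) :
    IsSource (2 * R₁ * (l + 1)) (decayRate n m) (Cχ * B) L
      (fun τ => (χ l τ : ℂ) * rhsZero n m χ (gCoef n m χ) l τ) where
  cont := hcont
  zero τ hτ := by rw [hχ.eq_zero l τ hτ]; simp
  bound τ hτ := by
    rw [norm_mul, Complex.norm_real, Real.norm_eq_abs, mul_assoc Cχ, mul_assoc Cχ]
    have h0 : 0 ≤ Cχ := (abs_nonneg _).trans (hCχ 0 0)
    refine mul_le_mul (hCχ l τ) ((hb τ hτ).trans_eq ?_) (norm_nonneg _) h0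
    ring
  pos := by positivity

/-- Estimates of `g_{ℓ,0}`. -/
lemma gZero_est (hm : 0 < m) (hχ : IsChiFamily m R₁ χ) {L : ℕ}
    (hR₁ : 0 < R₁) {Cχ : ℝ} (hCχ : ∀ l ρ, |χ l ρ| ≤ Cχ) {η : ℝ} (hη : 0 < η) (hηR : 1 ≤ η * R₁)
    (hη1 : η ≤ (lam m 0).im) (hgap : ∀ j, 0 < j → j + 1 < m → (lam m 0).im + η ≤ (lam m j).im)
    {B : ℝ} (hsm : ContDiff ℝ ((⊤ : ℕ∞) : WithTop ℕ∞)
      (fun τ => (χ (L + 1) τ : ℂ) * rhsZero n m χ (gCoef n m χ) (L + 1) τ))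
    (hb : ∀ ρ, 2 * R₁ * ((L + 1 : ℕ) + 1) ≤ ρ → ‖rhsZero n m χ (gCoef n m χ) (L + 1) ρ‖ ≤
      B * (ρ ^ (L + 2))⁻¹ * Real.exp (-(decayRate n m * ρ))) :
    ContDiff ℝ ((⊤ : ℕ∞) : WithTop ℕ∞) (gZero n m χ (gCoef n m χ) (L + 1)) ∧
    (∀ ρ, iteratedDeriv (2 * m) (gZero n m χ (gCoef n m χ) (L + 1)) ρ =
      -((-1) ^ m * (freq n m 0 : ℂ) ^ (2 * m)) * gZero n m χ (gCoef n m χ) (L + 1) ρ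
        + (χ (L + 1) ρ : ℂ) * rhsZero n m χ (gCoef n m χ) (L + 1) ρ) ∧
    ∀ (i : ℕ) (ρ : ℝ), i ≤ 2 * m → 2 * R₁ * ((L + 1 : ℕ) + 1) ≤ ρ →
    freq n m 0 ^ i * ‖iteratedDeriv (2 * m - i) (gZero n m χ (gCoef n m χ) (L + 1)) ρ‖ ≤
      2 * (freq n m 0 + η * freq n m 0) / (L + 1) * (Cχ * B * (ρ ^ (L + 1))⁻¹ *
        Real.exp (-(decayRate n m * ρ))) := by
  have hs := isSource_zero hχ hR₁ hCχ hsm.continuous hb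
  have hc1 := one_le_freq n 0 hm
  have hc : 0 < freq n m 0 := by linarith
  have hσ := decayRate_pos n hm
  have heq : gZero n m χ (gCoef n m χ) (L + 1) = greenSol m (freq n m 0)
      (fun j => if j < m ∧ j ≠ 0 ∧ j ≠ m - 1 then 0 else
        ∫ τ : ℝ, Complex.exp (-(charRoot m (freq n m 0) j * τ)) *
        ((χ (L + 1) τ : ℂ) * rhsZero n m χ (gCoef n m χ) (L + 1) τ))
      (fun τ => (χ (L + 1) τ : ℂ) * rhsZero n m χ (gCoef n m χ) (L + 1) τ) :=
    funext fun ρ => hs.integral_fundSol_sub_homSol hσ n hm ρ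
  rw [heq]
  refine ⟨contDiff_greenSol hsm, fun ρ => iteratedDeriv_greenSol_top hm hc hs.cont ρ,
    fun i ρ hi hρ => ?_⟩
  refine hs.norm_greenSol_resonant_le hm hc hη hη1 hgap rfl ?_ hρ i hi
  have h1 : η * R₁ ≤ η * freq n m 0 * R₁ := by
    have : 0 < η * R₁ := by positivity
    nlinarith
  push_cast
  calc (L : ℝ) + 2 = 1 * (L + 2) := by ring
    _ ≤ (η * freq n m 0 * R₁) * (L + 2) := by gcongr; linarith
    _ = _ := by ring

lemma gCoef_zero_zero (n m : ℕ) (χ : ℕ → ℝ → ℝ) :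
    gCoef n m χ 0 0 = fun ρ : ℝ => Complex.exp (charRoot m (freq n m 0) 0 * ρ) := by
  rw [gCoef_zero_row, ← neg_c₁_eq]; simp

lemma iteratedDeriv_gCoef_zero_zero (n m : ℕ) (χ : ℕ → ℝ → ℝ) (k : ℕ) :
    iteratedDeriv k (gCoef n m χ 0 0) = fun ρ : ℝ =>
      charRoot m (freq n m 0) 0 ^ k * Complex.exp (charRoot m (freq n m 0) 0 * ρ) := by
  induction k with
  | zero => rw [iteratedDeriv_zero, gCoef_zero_zero]; simp
  | succ k ih =>
    rw [iteratedDeriv_succ, ih]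
    funext ρ
    have : HasDerivAt (fun ρ : ℝ => Complex.exp (charRoot m (freq n m 0) 0 * ρ))
        (Complex.exp (charRoot m (freq n m 0) 0 * ρ) * charRoot m (freq n m 0) 0) ρ := by
      simpa using ((hasDerivAt_id (ρ : ℂ)).const_mul (charRoot m (freq n m 0) 0)).cexp.comp_ofReal
    rw [(this.const_mul _).deriv]
    ring

lemma rowEst_zero (hm : 0 < m) (hD : freq n m 0 ^ (2 * m) ≤ D) :
    RowEst n m χ R₁ K D 0 := by
  have hc1 := one_le_freq n 0 hm
  have hc : 0 < freq n m 0 := by linarith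
  have hfun := gCoef_zero_zero n m χ
  have hder := iteratedDeriv_gCoef_zero_zero n m χ
  constructor
  · intro p
    rcases Nat.eq_zero_or_pos p with rfl | hp
    · rw [hfun]
      exact (contDiff_const.mul Complex.ofRealCLM.contDiff).cexp
    · rw [gCoef_of_lt n m χ hp]
      exact contDiff_const
  · intro p i ρ hi _
    have hD0 : 0 ≤ D := (by positivity : 0 ≤ freq n m 0 ^ (2 * m)).trans hD
    have hrhs : D * K ^ 0 * growth m 0 * (ρ ^ 0)⁻¹ * Real.exp (-(decayRate n m * ρ))
        = D * Real.exp (-(decayRate n m * ρ)) := by simp [growth]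
    rw [hrhs]
    rcases Nat.eq_zero_or_pos p with rfl | hp
    · rw [hder, norm_mul, norm_pow, norm_charRoot hc, Complex.norm_exp, ← mul_assoc, ← pow_add,
        Nat.add_sub_cancel' hi]
      have : (charRoot m (freq n m 0) 0 * (ρ : ℂ)).re = -(decayRate n m * ρ) := by
        rw [Complex.re_mul_ofReal, charRoot_re, decayRate]; ring
      rw [this]
      gcongr
    · rw [gCoef_of_lt n m χ hp, iteratedDeriv_zero_fun, norm_zero, mul_zero]
      positivity

/-- Estimates of all coefficients. -/
theorem exists_rowEst (hm : 0 < m) (hχ : IsChiFamily m R₁ χ) (hR₁ : 0 < R₁)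
    {η : ℝ} (hη : 0 < η) (hηR : 1 ≤ η * R₁)
    (hη1 : η ≤ (lam m 0).im) (hgap : ∀ j, 0 < j → j + 1 < m → (lam m 0).im + η ≤ (lam m j).im)
    (hgapp : ∀ p, 0 < p → decayRate n m + η * freq n m p ≤ freq n m p * (lam m 0).im) :
    ∃ K D : ℝ, 1 ≤ K ∧ 0 < D ∧ (∀ l, RowEst n m χ R₁ K D l) ∧
      (∀ l p ρ, 0 < p → p ≤ l → iteratedDeriv (2 * m) (gCoef n m χ l p) ρ =
        -((-1) ^ m * (freq n m p : ℂ) ^ (2 * m)) * gCoef n m χ l p ρ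
          + (χ l ρ : ℂ) * rhsPos n m (gCoef n m χ) l p ρ) ∧
      (∀ l ρ, 0 < l → iteratedDeriv (2 * m) (gCoef n m χ l 0) ρ =
        -((-1) ^ m * (freq n m 0 : ℂ) ^ (2 * m)) * gCoef n m χ l 0 ρ
          + (χ l ρ : ℂ) * rhsZero n m χ (gCoef n m χ) l ρ) := by
  obtain ⟨C, hC1, hC⟩ := exists_norm_pAct_le n m
  obtain ⟨Cχ', hCχ'⟩ := hχ.bound
  set Cχ := Cχ' with hCχd
  have hCχ : ∀ l ρ, |χ l ρ| ≤ Cχ := fun l ρ => by simpa using hCχ' l 0 ρ (Nat.zero_le _)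
  have hCχ0 : 0 ≤ Cχ := (abs_nonneg _).trans (hCχ 0 0)
  have hc1 := one_le_freq n 0 hm
  set c := freq n m 0
  set D := c ^ (2 * m)
  have hD : 0 < D := by positivity
  set Q := (2 / η + 1) * (Cχ * (2 * m * C)) with hQ
  have hQ0 : 0 ≤ Q := by positivity
  set W : ℝ := |2 * m * gam n m * (n + 1) * (1 + alph n)| * Q + 2 * m * C with hW
  have hW0 : 0 ≤ W := by positivity
  -- `K` dominates the constants of both recursions, `Q` for `p ≥ 1` and the last summand for `p =
  -- 0`, independently of the row.
  set K := 1 + Q + 4 * (c + η * c) * (Cχ * W) with hKd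
  have hx : 0 ≤ 4 * (c + η * c) * (Cχ * W) := by positivity
  have hK1 : 1 ≤ K := by rw [hKd]; linarith
  have hQK : Q ≤ K := by rw [hKd]; linarith
  have hWK : 4 * (c + η * c) * (Cχ * W) ≤ K := by rw [hKd]; linarith
  have hpos : ∀ {l : ℕ}, (∀ k < l, RowEst n m χ R₁ K D k) → ∀ p, 0 < p → _ :=
    fun {l} h p hp => gPos_est hm hχ h hC1 hC hR₁ hK1 hD.le hCχ hη hηR hgapp (p := p) hp
  have hbd : ∀ {L : ℕ}, (∀ k < L + 1, RowEst n m χ R₁ K D k) → ∀ ρ,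
      2 * R₁ * ((L + 1 : ℕ) + 1) ≤ ρ → ‖rhsZero n m χ (gCoef n m χ) (L + 1) ρ‖ ≤
      W * (D * K ^ L) * growth m (L + 2) * (ρ ^ (L + 2))⁻¹ *
        Real.exp (-(decayRate n m * ρ)) := by
    intro L h ρ hρ
    have := norm_rhsZero_le hm (l := L + 1) (by omega) h hC1 hC hR₁ hK1 hD.le hQ0 hρ ?_
    · exact this
    · have h1 := (hpos h 1 one_pos).2.2 1 ρ (by omega) hρ
      have hc1' := one_le_freq n 1 hm
      rw [pow_one] at h1
      refine le_trans (le_mul_of_one_le_left (norm_nonneg _) hc1') (h1.trans_eq ?_)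
      rw [hQ]
      ring
  have hzero : ∀ {L : ℕ}, (∀ k < L + 1, RowEst n m χ R₁ K D k) → _ := fun {L} h =>
    gZero_est hm hχ (L := L) hR₁ hCχ hη hηR hη1 hgap
      (contDiff_source_zero hm hχ hR₁ h (hpos h 1 one_pos).1) (hbd h)
  have hall : ∀ l, RowEst n m χ R₁ K D l := by
    intro l
    induction l using Nat.strong_induction_on with
    | _ l ih =>
      rcases l with _ | L
      · exact rowEst_zero hm le_rfl
      · have hz := hzero ih
        have hG := growth_pos m (L + 1)
        constructor
        · intro p
          rcases Nat.eq_zero_or_pos p with rfl | hp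
          · rw [gCoef_zero n m χ (Nat.succ_pos L)]
            exact hz.1
          · by_cases hpl : p ≤ L + 1
            · rw [gCoef_pos n m χ hp hpl]
              exact (hpos ih p hp).1
            · rw [gCoef_of_lt n m χ (not_le.mp hpl)]
              exact contDiff_const
        · intro p i ρ hi hρ
          have hρ0 : 0 < ρ := lt_of_lt_of_le (by positivity) hρ
          rcases Nat.eq_zero_or_pos p with rfl | hp
          · rw [gCoef_zero n m χ (Nat.succ_pos L)]
            refine (hz.2.2 i ρ hi hρ).trans ?_
            have hgr := growth_succ_le m (L + 1)
            -- The source for `p = 0` carries the growth factor of the next row; the gain `1/(L+1)`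
            -- of the resonant integration brings it back.
            have h2 : growth m (L + 2) / (L + 1) ≤ 2 * growth m (L + 1) := by
              rw [div_le_iff₀ (by positivity)]
              refine hgr.trans ?_
              push_cast
              nlinarith [(Nat.cast_nonneg L : (0 : ℝ) ≤ L)]
            calc _ = 2 * (c + η * c) * (Cχ * W) * (D * K ^ L) * (growth m (L + 2) / (L + 1)) *
                  (ρ ^ (L + 1))⁻¹ * Real.exp (-(decayRate n m * ρ)) := by ring
              _ ≤ 2 * (c + η * c) * (Cχ * W) * (D * K ^ L) * (2 * growth m (L + 1)) *
                  (ρ ^ (L + 1))⁻¹ * Real.exp (-(decayRate n m * ρ)) := by gcongr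
              _ = (4 * (c + η * c) * (Cχ * W)) * (D * K ^ L) * growth m (L + 1) *
                  (ρ ^ (L + 1))⁻¹ * Real.exp (-(decayRate n m * ρ)) := by ring
              _ ≤ K * (D * K ^ L) * growth m (L + 1) *
                  (ρ ^ (L + 1))⁻¹ * Real.exp (-(decayRate n m * ρ)) := by gcongr
              _ = _ := by rw [pow_succ K]; ring
          · by_cases hpl : p ≤ L + 1
            · rw [gCoef_pos n m χ hp hpl]
              refine ((hpos ih p hp).2.2 i ρ hi hρ).trans ?_
              calc _ = Q * (D * K ^ L) * growth m (L + 1) *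
                  (ρ ^ (L + 1))⁻¹ * Real.exp (-(decayRate n m * ρ)) := by
                    rw [hQ, Nat.add_sub_cancel]; ring
                _ ≤ K * (D * K ^ L) * growth m (L + 1) *
                  (ρ ^ (L + 1))⁻¹ * Real.exp (-(decayRate n m * ρ)) := by gcongr
                _ = _ := by rw [pow_succ K]; ring
            · rw [gCoef_of_lt n m χ (not_le.mp hpl), iteratedDeriv_zero_fun, norm_zero, mul_zero]
              positivity
  refine ⟨K, D, hK1, hD, hall, fun l p ρ hp hpl => ?_, fun l ρ hl => ?_⟩
  · rw [gCoef_pos n m χ hp hpl]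
    exact (hpos (fun k _ => hall k) p hp).2.1 ρ
  · obtain ⟨L, rfl⟩ := Nat.exists_eq_add_of_le' hl
    rw [gCoef_zero n m χ hl]
    exact (hzero (fun k _ => hall k)).2.1 ρ

end Rows

end MetivierGen

namespace MetivierGen
open MeasureTheory Filter Topology

/-! ### Families of coefficients -/

/-- Rapidly decreasing families of coefficients with exponential decay of rate `δ`. -/
def Dec (δ : ℝ) (a : ℕ → ℝ → ℂ) : Prop :=
  ∀ X : ℝ, 1 ≤ X → ∃ C : ℝ, ∀ (p : ℕ) (ρ : ℝ), 0 < ρ → X ^ p * ‖a p ρ‖ ≤ C * Real.exp (-(δ * ρ))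

/-- Smooth, locally finite, rapidly decreasing families supported in `[ρ₀, ∞)`. -/
structure Adm (ρ₀ δ : ℝ) (a : ℕ → ℝ → ℂ) : Prop where
  smooth : ∀ p, ContDiff ℝ ((⊤ : ℕ∞) : WithTop ℕ∞) (a p)
  zero : ∀ p ρ, ρ < ρ₀ → a p ρ = 0
  locFin : ∀ r : ℝ, ∃ N : ℕ, ∀ p, N ≤ p → ∀ ρ, ρ < r → a p ρ = 0
  dec : Dec δ a

section Closure

variable {ρ₀ δ : ℝ} {a b : ℕ → ℝ → ℂ}

lemma Dec.add (ha : Dec δ a) (hb : Dec δ b) : Dec δ (fun p ρ => a p ρ + b p ρ) := by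
  intro X hX
  obtain ⟨C, hC⟩ := ha X hX
  obtain ⟨C', hC'⟩ := hb X hX
  refine ⟨C + C', fun p ρ hρ => ?_⟩
  calc X ^ p * ‖a p ρ + b p ρ‖ ≤ X ^ p * (‖a p ρ‖ + ‖b p ρ‖) := by gcongr; exact norm_add_le _ _
    _ = X ^ p * ‖a p ρ‖ + X ^ p * ‖b p ρ‖ := by ring
    _ ≤ C * Real.exp (-(δ * ρ)) + C' * Real.exp (-(δ * ρ)) := add_le_add (hC p ρ hρ) (hC' p ρ hρ)
    _ = _ := by ring

lemma Dec.smul (ha : Dec δ a) (c : ℂ) : Dec δ (fun p ρ => c * a p ρ) := by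
  intro X hX
  obtain ⟨C, hC⟩ := ha X hX
  refine ⟨‖c‖ * C, fun p ρ hρ => ?_⟩
  rw [norm_mul]
  calc X ^ p * (‖c‖ * ‖a p ρ‖) = ‖c‖ * (X ^ p * ‖a p ρ‖) := by ring
    _ ≤ ‖c‖ * (C * Real.exp (-(δ * ρ))) := mul_le_mul_of_nonneg_left (hC p ρ hρ) (norm_nonneg _)
    _ = _ := by ring

/-- The linear factors and index shifts are absorbed by passing from the weight `X` to `2X`;
requiring all geometric weights is what makes `Dec` stable under `t∂_t`. -/
lemma Dec.eulerAct (n : ℕ) (ha : Dec δ a) :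
    Dec δ (fun p ρ => eulerAct n (fun q => a q ρ) p) := by
  intro X hX
  obtain ⟨C, hC⟩ := ha (2 * X) (by linarith)
  refine ⟨((n : ℝ) + 1) * (2 * X + 1 + 1) * C, fun p ρ hρ => ?_⟩
  have hX0 : (0 : ℝ) < X := by linarith
  set E := Real.exp (-(δ * ρ))
  have hp2 : ∀ q : ℕ, ((q : ℝ) + 1) ≤ 2 ^ q := fun q => by exact_mod_cast Nat.lt_two_pow_self
  have hq : ∀ q : ℕ, ((q : ℝ) + 1) * X ^ q * ‖a q ρ‖ ≤ C * E := by
    intro q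
    refine le_trans ?_ (hC q ρ hρ)
    rw [mul_pow]
    gcongr
    exact hp2 q
  have hCE : 0 ≤ C * E := (by positivity : (0 : ℝ) ≤ _).trans (hq 0)
  have t1 : X ^ p * (p * ‖a (p - 1) ρ‖) ≤ 2 * X * (C * E) := by
    rcases p with _ | p
    · simp; positivity
    · rw [Nat.add_sub_cancel]
      push_cast
      have := hq p
      calc X ^ (p + 1) * (((p : ℝ) + 1) * ‖a p ρ‖) = X * (((p : ℝ) + 1) * X ^ p * ‖a p ρ‖) := by ring
        _ ≤ X * (C * E) := by gcongr
        _ ≤ _ := by nlinarith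
  have t2 : X ^ p * ‖a p ρ‖ ≤ C * E := by
    refine le_trans ?_ (hq p)
    rw [mul_assoc]
    refine le_mul_of_one_le_left (by positivity) ?_
    linarith [(Nat.cast_nonneg p : (0 : ℝ) ≤ p)]
  have t3 : X ^ p * ((p + 1) * ‖a (p + 1) ρ‖) ≤ C * E := by
    refine le_trans ?_ (hq (p + 1))
    push_cast
    calc X ^ p * (((p : ℝ) + 1) * ‖a (p + 1) ρ‖)
        ≤ X ^ (p + 1) * (((p : ℝ) + 1 + 1) * ‖a (p + 1) ρ‖) := by
          refine mul_le_mul (pow_le_pow_right₀ hX (Nat.le_succ p)) ?_ (by positivity) (by positivity)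
          gcongr
          linarith
      _ = _ := by ring
  calc X ^ p * ‖MetivierGen.eulerAct n (fun q => a q ρ) p‖
      ≤ X ^ p * (((n : ℝ) + 1) * (p * ‖a (p - 1) ρ‖ + ‖a p ρ‖ + (p + 1) * ‖a (p + 1) ρ‖)) := by
        gcongr
        exact norm_eulerAct_le n _ p
    _ = ((n : ℝ) + 1) * (X ^ p * (p * ‖a (p - 1) ρ‖) + X ^ p * ‖a p ρ‖
        + X ^ p * ((p + 1) * ‖a (p + 1) ρ‖)) := by ring
    _ ≤ ((n : ℝ) + 1) * (2 * X * (C * E) + C * E + C * E) := by gcongr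
    _ = _ := by ring

namespace Adm

lemma add (ha : Adm ρ₀ δ a) (hb : Adm ρ₀ δ b) : Adm ρ₀ δ (fun p ρ => a p ρ + b p ρ) where
  smooth p := (ha.smooth p).add (hb.smooth p)
  zero p ρ h := by simp [ha.zero p ρ h, hb.zero p ρ h]
  locFin r := by
    obtain ⟨N, hN⟩ := ha.locFin r
    obtain ⟨N', hN'⟩ := hb.locFin r
    refine ⟨max N N', fun p hp ρ hρ => ?_⟩
    rw [hN p (le_of_max_le_left hp) ρ hρ, hN' p (le_of_max_le_right hp) ρ hρ, add_zero]
  dec := ha.dec.add hb.dec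

lemma smul (ha : Adm ρ₀ δ a) (c : ℂ) : Adm ρ₀ δ (fun p ρ => c * a p ρ) where
  smooth p := contDiff_const.mul (ha.smooth p)
  zero p ρ h := by simp [ha.zero p ρ h]
  locFin r := by
    obtain ⟨N, hN⟩ := ha.locFin r
    exact ⟨N, fun p hp ρ hρ => by rw [hN p hp ρ hρ, mul_zero]⟩
  dec := ha.dec.smul c

lemma eulerAct (n : ℕ) (ha : Adm ρ₀ δ a) :
    Adm ρ₀ δ (fun p ρ => eulerAct n (fun q => a q ρ) p) where
  smooth p := by
    simp only [MetivierGen.eulerAct]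
    exact contDiff_const.mul (((contDiff_const.mul (ha.smooth _)).sub
      (contDiff_const.mul (ha.smooth _))).sub (contDiff_const.mul (ha.smooth _)))
  zero p ρ h := by simp [MetivierGen.eulerAct, ha.zero _ ρ h]
  locFin r := by
    obtain ⟨N, hN⟩ := ha.locFin r
    refine ⟨N + 1, fun p hp ρ hρ => ?_⟩
    simp [MetivierGen.eulerAct, hN (p - 1) (by omega) ρ hρ, hN p (by omega) ρ hρ,
      hN (p + 1) (by omega) ρ hρ]
  dec := ha.dec.eulerAct n

lemma polyAct (n : ℕ) (Q : Polynomial ℝ) (ha : Adm ρ₀ δ a) :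
    Adm ρ₀ δ (fun p ρ => polyAct n Q (fun q => a q ρ) p) :=
  polyAct_induction n (S := fun a : ℝ → ℕ → ℂ => Adm ρ₀ δ (fun p ρ => a ρ p))
    (fun _ _ ha hb => ha.add hb) (fun c _ ha => ha.smul c) (fun _ ha => ha.eulerAct n) Q
    (fun ρ q => a q ρ) ha

lemma inv_pow_mul (hρ₀ : 0 < ρ₀) (i : ℕ) (ha : Adm ρ₀ δ a) :
    Adm ρ₀ δ (fun p ρ => ((ρ : ℂ) ^ i)⁻¹ * a p ρ) where
  smooth p := by
    have := contDiff_cutoff_mul_inv hρ₀ (ha.smooth p) (ha.zero p)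
      (contDiff_const (c := (1 : ℂ))) i
    simpa [mul_comm] using this
  zero p ρ h := by simp [ha.zero p ρ h]
  locFin r := by
    obtain ⟨N, hN⟩ := ha.locFin r
    exact ⟨N, fun p hp ρ hρ => by rw [hN p hp ρ hρ, mul_zero]⟩
  dec := by
    intro X hX
    obtain ⟨C, hC⟩ := ha.dec X hX
    have hC0 : 0 ≤ C := by
      have := (by positivity : (0 : ℝ) ≤ X ^ 0 * ‖a 0 1‖).trans (hC 0 1 one_pos)
      exact nonneg_of_mul_nonneg_left this (Real.exp_pos _)
    refine ⟨(ρ₀ ^ i)⁻¹ * C, fun p ρ hρ => ?_⟩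
    beta_reduce
    rcases lt_or_ge ρ ρ₀ with hlt | hge
    · rw [ha.zero p ρ hlt, mul_zero, norm_zero, mul_zero]
      positivity
    · rw [norm_mul, norm_inv, norm_pow, Complex.norm_real, Real.norm_eq_abs, abs_of_pos hρ]
      calc X ^ p * ((ρ ^ i)⁻¹ * ‖a p ρ‖) = (ρ ^ i)⁻¹ * (X ^ p * ‖a p ρ‖) := by ring
        _ ≤ (ρ₀ ^ i)⁻¹ * (C * Real.exp (-(δ * ρ))) :=
            mul_le_mul (by gcongr) (hC p ρ hρ) (by positivity) (by positivity)
        _ = _ := by ring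

lemma zero_family : Adm ρ₀ δ (fun _ _ => 0) where
  smooth _ := contDiff_const
  zero _ _ _ := rfl
  locFin _ := ⟨0, fun _ _ _ _ => rfl⟩
  dec X _ := ⟨0, fun p ρ _ => by simp⟩

lemma sum {ι : Type*} (s : Finset ι) {f : ι → ℕ → ℝ → ℂ} (h : ∀ i ∈ s, Adm ρ₀ δ (f i)) :
    Adm ρ₀ δ (fun p ρ => ∑ i ∈ s, f i p ρ) := by
  classical
  induction s using Finset.induction_on with
  | empty => simpa using zero_family
  | insert i s hi ih =>
    simp only [Finset.sum_insert hi]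
    exact (h i (Finset.mem_insert_self i s)).add
      (ih fun j hj => h j (Finset.mem_insert_of_mem hj))

end Adm

end Closure

/-! ### Amplitudes -/

/-- `∂_t^b (t^j ∑_p a_p(ρ) v_p(t))`. -/
noncomputable def amp (n j b : ℕ) (a : ℕ → ℝ → ℂ) (t ρ : ℝ) : ℂ :=
  ∑' p : ℕ, a p ρ * eigDeriv n j p b t

lemma amp_eq_sum {n j b N : ℕ} {a : ℕ → ℝ → ℂ} {t ρ : ℝ} (h : ∀ p, N ≤ p → a p ρ = 0) :
    amp n j b a t ρ = ∑ p ∈ Finset.range N, a p ρ * eigDeriv n j p b t :=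
  tsum_eq_sum fun p hp => by rw [h p (by simpa using hp), zero_mul]

/-- The weight `X = 2B` turns the growth `B^(p+1)` of the eigenfunctions into a geometric series.
The order of quantifiers matters: `Ce` precedes `δ`, so a rate `δ` exceeding `Ce` can be chosen
afterwards. -/
lemma exists_norm_amp_le (n j : ℕ) : ∃ Ce : ℝ, 0 ≤ Ce ∧ ∀ (δ : ℝ) (a : ℕ → ℝ → ℂ), Dec δ a →
    ∃ C : ℝ, 0 ≤ C ∧ ∀ (b : ℕ) (t s ρ : ℝ), 0 < s → 0 < ρ → ‖amp n j b a t ρ‖ ≤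
      C * Real.exp (-(δ * ρ)) * (b.factorial * Real.exp (Ce * s ^ (2 * n + 2)) / s ^ b) := by
  obtain ⟨B, Ce, hB, hCe, h⟩ := norm_eigDeriv_le n j
  have hB0 : 0 < B := by linarith
  refine ⟨Ce, hCe, fun δ a ha => ?_⟩
  obtain ⟨C, hC⟩ := ha (2 * B) (by linarith)
  have hC0 : 0 ≤ C := by
    have := (by positivity : (0 : ℝ) ≤ (2 * B) ^ 0 * ‖a 0 1‖).trans (hC 0 1 one_pos)
    exact nonneg_of_mul_nonneg_left this (Real.exp_pos _)
  refine ⟨2 * B * C, by positivity, fun b t s ρ hs hρ => ?_⟩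
  set E := Real.exp (-(δ * ρ))
  set S := (b.factorial * Real.exp (Ce * s ^ (2 * n + 2)) / s ^ b : ℝ) with hS
  have hS0 : 0 ≤ S := by positivity
  have hsum : HasSum (fun p : ℕ => B * C * E * S * (1 / 2 : ℝ) ^ p) (B * C * E * S * 2) :=
    hasSum_geometric_two.mul_left _
  refine (tsum_of_norm_bounded hsum fun p => ?_).trans_eq (by ring)
  rw [norm_mul]
  have h1 : ‖a p ρ‖ ≤ C * E / (2 * B) ^ p := by
    rw [le_div_iff₀ (by positivity), mul_comm]; exact hC p ρ hρ
  calc ‖a p ρ‖ * ‖eigDeriv n j p b t‖ ≤ (C * E / (2 * B) ^ p) *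
        (b.factorial * (B ^ (p + 1) * Real.exp (Ce * s ^ (2 * n + 2))) / s ^ b) := by
        gcongr
        exact h p b t s hs
    _ = _ := by
      rw [hS, mul_pow, pow_succ B, one_div, inv_pow]
      field_simp

lemma exists_rpow_le_exp {ρ₀ ε : ℝ} (hρ₀ : 0 < ρ₀) (hε : 0 < ε) (q : ℝ) :
    ∃ C : ℝ, 0 ≤ C ∧ ∀ ρ, ρ₀ ≤ ρ → ρ ^ q ≤ C * Real.exp (ε * ρ) := by
  obtain ⟨k, hk⟩ := exists_nat_ge q
  refine ⟨ρ₀ ^ q * ((ε * ρ₀)⁻¹ ^ k * k.factorial), by positivity, fun ρ hρ => ?_⟩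
  have hρ0 : 0 < ρ := hρ₀.trans_le hρ
  have h1 : 1 ≤ ρ / ρ₀ := by rwa [one_le_div hρ₀]
  have h2 : (ρ / ρ₀) ^ q ≤ (ρ / ρ₀) ^ k := by
    rw [← Real.rpow_natCast]
    exact Real.rpow_le_rpow_of_exponent_le h1 hk
  have h3 := Real.pow_div_factorial_le_exp (ε * ρ) (by positivity) k
  rw [div_le_iff₀ (by positivity)] at h3
  calc ρ ^ q = ρ₀ ^ q * (ρ / ρ₀) ^ q := by
        rw [← Real.mul_rpow hρ₀.le (by positivity), mul_div_cancel₀ _ hρ₀.ne']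
    _ ≤ ρ₀ ^ q * (ρ / ρ₀) ^ k := by gcongr
    _ = ρ₀ ^ q * ((ε * ρ₀)⁻¹ ^ k * (ε * ρ) ^ k) := by
        rw [← mul_pow]; congr 2; field_simp
    _ ≤ ρ₀ ^ q * ((ε * ρ₀)⁻¹ ^ k * (Real.exp (ε * ρ) * k.factorial)) := by gcongr
    _ = _ := by ring

/-- The mixed derivatives of `e^(iyρ^θ) ρ^q [t^j ∑ a_p v_p(t)]_{t = ρ^γ x}`. -/
noncomputable def kerFam (n m j : ℕ) (q : ℝ) (a : ℕ → ℝ → ℂ) (A B : ℕ) (x y ρ : ℝ) : ℂ :=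
  (Complex.I * ((ρ ^ theta m : ℝ) : ℂ)) ^ B * Complex.exp (Complex.I * ((y * ρ ^ theta m : ℝ) : ℂ))
    * ((ρ ^ q : ℝ) : ℂ) * ((ρ ^ gam n m : ℝ) : ℂ) ^ A * amp n j A a (ρ ^ gam n m * x) ρ

lemma norm_kerFam {n m j : ℕ} {q : ℝ} {a : ℕ → ℝ → ℂ} {A B : ℕ} {x y ρ : ℝ} (hρ : 0 < ρ) :
    ‖kerFam n m j q a A B x y ρ‖ = ρ ^ (theta m * B + q + gam n m * A) *
      ‖amp n j A a (ρ ^ gam n m * x) ρ‖ := by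
  have h1 : ‖Complex.exp (Complex.I * ((y * ρ ^ theta m : ℝ) : ℂ))‖ = 1 := by
    rw [mul_comm]; exact Complex.norm_exp_ofReal_mul_I _
  rw [kerFam, norm_mul, norm_mul, norm_mul, norm_mul, h1, norm_pow, norm_pow, norm_mul,
    Complex.norm_I, Complex.norm_real, Complex.norm_real, Complex.norm_real, Real.norm_eq_abs,
    Real.norm_eq_abs, Real.norm_eq_abs, abs_of_pos (Real.rpow_pos_of_pos hρ _),
    abs_of_pos (Real.rpow_pos_of_pos hρ _), abs_of_pos (Real.rpow_pos_of_pos hρ _),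
    Real.rpow_add hρ, Real.rpow_add hρ, Real.rpow_mul hρ.le, Real.rpow_mul hρ.le,
    Real.rpow_natCast, Real.rpow_natCast]
  ring

lemma Adm.continuousOn_kerFam {ρ₀ δ : ℝ} {a : ℕ → ℝ → ℂ} (ha : Adm ρ₀ δ a) (n m j : ℕ) (q : ℝ)
    (A B : ℕ) (x y : ℝ) : ContinuousOn (kerFam n m j q a A B x y) (Set.Ioi 0) := by
  have hpow : ∀ s : ℝ, ContinuousOn (fun ρ : ℝ => ρ ^ s) (Set.Ioi 0) := fun s ρ hρ =>
    (Real.continuousAt_rpow_const ρ s (Or.inl (ne_of_gt hρ))).continuousWithinAt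
  have hamp : ContinuousOn (fun ρ => amp n j A a (ρ ^ gam n m * x) ρ) (Set.Ioi 0) := by
    intro ρ₁ hρ₁
    obtain ⟨N, hN⟩ := ha.locFin (ρ₁ + 1)
    have hsum : ContinuousAt (fun ρ => ∑ p ∈ Finset.range N,
        a p ρ * eigDeriv n j p A (ρ ^ gam n m * x)) ρ₁ := by
      refine tendsto_finsetSum _ fun p _ => ?_
      refine (ha.smooth p).continuous.continuousAt.mul ?_
      exact (continuous_eigDeriv n j p A).continuousAt.comp
        ((Real.continuousAt_rpow_const ρ₁ _ (Or.inl (ne_of_gt hρ₁))).mul continuousAt_const)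
    refine (hsum.congr ?_).continuousWithinAt
    filter_upwards [Iio_mem_nhds (show ρ₁ < ρ₁ + 1 by linarith)] with ρ hρ
    exact (amp_eq_sum fun p hp => hN p hp ρ hρ).symm
  have hof : ∀ {f : ℝ → ℝ}, ContinuousOn f (Set.Ioi 0) →
      ContinuousOn (fun ρ => (f ρ : ℂ)) (Set.Ioi 0) := fun hf =>
    Complex.continuous_ofReal.comp_continuousOn hf
  unfold kerFam
  refine ((((ContinuousOn.pow (continuousOn_const.mul (hof (hpow _))) B).mul ?_).mul
    (hof (hpow q))).mul ((hof (hpow _)).pow A)).mul hamp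
  exact Complex.continuous_exp.comp_continuousOn
    (continuousOn_const.mul (hof (continuousOn_const.mul (hpow _))))

lemma Adm.exists_norm_kerFam_le {ρ₀ δ : ℝ} {a : ℕ → ℝ → ℂ} (ha : Adm ρ₀ δ a) (hρ₀ : 0 < ρ₀)
    (hδ : 0 < δ) (n m j : ℕ) (q : ℝ) (A B : ℕ) : ∃ C : ℝ, ∀ x y ρ, 0 < ρ →
      ‖kerFam n m j q a A B x y ρ‖ ≤ C * Real.exp (-(δ / 2) * ρ) := by
  obtain ⟨Ce, hCe, h⟩ := exists_norm_amp_le n j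
  obtain ⟨C, hC0, hC⟩ := h δ a ha.dec
  obtain ⟨C', hC'0, hC'⟩ := exists_rpow_le_exp hρ₀ (half_pos hδ) (theta m * B + q + gam n m * A)
  set S : ℝ := A.factorial * Real.exp Ce
  refine ⟨C' * C * S, fun x y ρ hρ0 => ?_⟩
  rw [norm_kerFam hρ0]
  rcases lt_or_ge ρ ρ₀ with hlt | hge
  · rw [amp_eq_sum (N := 0) fun p _ => ha.zero p ρ hlt]
    simp only [Finset.range_zero, Finset.sum_empty, norm_zero, mul_zero]
    positivity
  · have h1 := hC A (ρ ^ gam n m * x) 1 ρ one_pos hρ0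
    simp only [one_pow, mul_one, div_one] at h1
    calc _ ≤ (C' * Real.exp (δ / 2 * ρ)) * (C * Real.exp (-(δ * ρ)) * S) :=
          mul_le_mul (hC' ρ hge) h1 (norm_nonneg _) (by positivity)
      _ = C' * C * S * (Real.exp (δ / 2 * ρ) * Real.exp (-(δ * ρ))) := by ring
      _ = _ := by rw [← Real.exp_add]; congr 2; ring

/-- At fixed `ρ` only finitely many coefficients survive, so continuity and derivatives in `x`, `y`
are termwise. Half of the rate `δ` absorbs the powers of `ρ`. -/
lemma Adm.isDominatedFamily {ρ₀ δ : ℝ} {a : ℕ → ℝ → ℂ} (ha : Adm ρ₀ δ a) (hρ₀ : 0 < ρ₀)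
    (hδ : 0 < δ) (n m j : ℕ) (q : ℝ) :
    IsDominatedFamily (volume.restrict (Set.Ioi 0)) (kerFam n m j q a) where
  meas A B x y := (ha.continuousOn_kerFam n m j q A B x y).aestronglyMeasurable measurableSet_Ioi
  cont A B ρ := by
    obtain ⟨N, hN⟩ := ha.locFin (ρ + 1)
    have : ∀ t, amp n j A a t ρ = ∑ p ∈ Finset.range N, a p ρ * eigDeriv n j p A t :=
      fun t => amp_eq_sum fun p hp => hN p hp ρ (by linarith)
    simp only [kerFam, this]
    have hc : ∀ p, Continuous (fun z : ℝ × ℝ => eigDeriv n j p A (ρ ^ gam n m * z.1)) := fun p =>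
      (continuous_eigDeriv n j p A).comp (by fun_prop)
    fun_prop
  bound A B := by
    obtain ⟨C, hC⟩ := ha.exists_norm_kerFam_le hρ₀ hδ n m j q A B
    refine ⟨fun ρ => C * Real.exp (-(δ / 2) * ρ),
      (exp_neg_integrableOn_Ioi 0 (half_pos hδ)).const_mul _, ?_⟩
    exact (ae_restrict_iff' measurableSet_Ioi).mpr (Eventually.of_forall fun ρ hρ x y =>
      hC x y ρ hρ)
  deriv_x A B x y ρ := by
    obtain ⟨N, hN⟩ := ha.locFin (ρ + 1)
    have : ∀ A t, amp n j A a t ρ = ∑ p ∈ Finset.range N, a p ρ * eigDeriv n j p A t :=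
      fun A t => amp_eq_sum fun p hp => hN p hp ρ (by linarith)
    simp only [kerFam, this]
    have hd : ∀ p, HasDerivAt (fun x' => eigDeriv n j p A (ρ ^ gam n m * x'))
        (((ρ ^ gam n m : ℝ) : ℂ) * eigDeriv n j p (A + 1) (ρ ^ gam n m * x)) x := by
      intro p
      have := (hasDerivAt_eigDeriv n j p A (ρ ^ gam n m * x)).scomp x
        ((hasDerivAt_id x).const_mul (ρ ^ gam n m))
      simpa [Function.comp_def] using this
    have := (HasDerivAt.fun_sum (u := Finset.range N) fun p _ => (hd p).const_mul (a p ρ)).const_mul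
      ((Complex.I * ((ρ ^ theta m : ℝ) : ℂ)) ^ B *
        Complex.exp (Complex.I * ((y * ρ ^ theta m : ℝ) : ℂ)) * ((ρ ^ q : ℝ) : ℂ) *
        ((ρ ^ gam n m : ℝ) : ℂ) ^ A)
    refine this.congr_deriv ?_
    simp only [Finset.mul_sum]
    refine Finset.sum_congr rfl fun p _ => ?_
    ring
  deriv_y A B x y ρ := by
    have h1 : HasDerivAt (fun y' : ℝ => Complex.exp (Complex.I * ((y' * ρ ^ theta m : ℝ) : ℂ)))
        (Complex.exp (Complex.I * ((y * ρ ^ theta m : ℝ) : ℂ)) *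
          (Complex.I * ((ρ ^ theta m : ℝ) : ℂ))) y := by
      have := ((((hasDerivAt_id y).mul_const (ρ ^ theta m)).ofReal_comp).const_mul Complex.I).cexp
      simpa using this
    have := (((h1.const_mul ((Complex.I * ((ρ ^ theta m : ℝ) : ℂ)) ^ B)).mul_const
      ((ρ ^ q : ℝ) : ℂ)).mul_const (((ρ ^ gam n m : ℝ) : ℂ) ^ A)).mul_const
      (amp n j A a (ρ ^ gam n m * x) ρ)
    refine this.congr_deriv ?_
    rw [kerFam]
    ring

end MetivierGen

namespace MetivierGen
open MeasureTheory Filter Topology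

/-! ### Integration by parts in `ρ` -/

/-- Summation by parts in `p` moves the three-term action of `t∂_t` from the `v_p` to the
coefficients. The range grows by one because `t v_{N-1}'` involves `v_N`. -/
lemma sum_mul_eigDeriv_one (n N : ℕ) {a : ℕ → ℂ} (h : ∀ p, N ≤ p → a p = 0) (t : ℝ) :
    ∑ p ∈ Finset.range N, a p * ((t : ℂ) * eigDeriv n 0 p 1 t) =
      ∑ p ∈ Finset.range (N + 1), eulerAct n a p * eigDeriv n 0 p 0 t := by
  have e1 : ∑ p ∈ Finset.range (N + 1), ((p : ℂ) * a (p - 1)) * eigDeriv n 0 p 0 t =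
      ∑ p ∈ Finset.range N, ((p : ℂ) + 1) * a p * eigDeriv n 0 (p + 1) 0 t := by
    rw [Finset.sum_range_succ']
    simp
  have e2 : ∑ p ∈ Finset.range (N + 1), a p * eigDeriv n 0 p 0 t =
      ∑ p ∈ Finset.range N, a p * eigDeriv n 0 p 0 t := by
    rw [Finset.sum_range_succ, h N le_rfl, zero_mul, add_zero]
  have e3 : ∑ p ∈ Finset.range (N + 1), ((p : ℂ) + 1 + (alph n : ℂ)) * a (p + 1) *
        eigDeriv n 0 p 0 t =
      ∑ p ∈ Finset.range N, (if p = 0 then 0 else ((p : ℂ) + alph n) * a p *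
        eigDeriv n 0 (p - 1) 0 t) := by
    have := Finset.sum_range_succ' (fun p => if p = 0 then (0 : ℂ) else ((p : ℂ) + alph n) * a p *
        eigDeriv n 0 (p - 1) 0 t) (N + 1)
    simp only [Nat.add_eq_zero_iff, one_ne_zero, and_false, if_false, if_true, add_zero,
      Nat.add_sub_cancel, Nat.cast_add, Nat.cast_one] at this
    rw [← this, Finset.sum_range_succ, Finset.sum_range_succ, h N le_rfl, h (N + 1) (by omega)]
    simp
  have : ∀ p, eulerAct n a p * eigDeriv n 0 p 0 t = ((n : ℂ) + 1) *
      (((p : ℂ) * a (p - 1)) * eigDeriv n 0 p 0 t - (1 + (alph n : ℂ)) * (a p * eigDeriv n 0 p 0 t)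
        - ((p : ℂ) + 1 + (alph n : ℂ)) * a (p + 1) * eigDeriv n 0 p 0 t) := by
    intro p; rw [eulerAct]; ring
  simp only [this]
  rw [← Finset.mul_sum, Finset.sum_sub_distrib, Finset.sum_sub_distrib, e1, e3, ← Finset.mul_sum,
    e2, Finset.mul_sum _ _ (1 + (alph n : ℂ)), ← Finset.sum_sub_distrib, ← Finset.sum_sub_distrib,
    Finset.mul_sum]
  refine Finset.sum_congr rfl fun p _ => ?_
  rw [eigDeriv_euler]
  split_ifs <;> ring

/-- The action of `ρ^(θ-1)(iθ)⁻¹ y`, after integration by parts, on coefficients. -/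
noncomputable def stepFam (n m : ℕ) (q : ℝ) (a : ℕ → ℝ → ℂ) (p : ℕ) (ρ : ℝ) : ℂ :=
  deriv (a p) ρ + (ρ : ℂ)⁻¹ * (((1 - theta m + q : ℝ) : ℂ) * a p ρ
    + (gam n m : ℂ) * eulerAct n (fun r => a r ρ) p)

lemma kerFam_zero_zero (n m j : ℕ) (q : ℝ) (a : ℕ → ℝ → ℂ) (x y ρ : ℝ) :
    kerFam n m j q a 0 0 x y ρ = Complex.exp (Complex.I * ((y * ρ ^ theta m : ℝ) : ℂ))
      * ((ρ ^ q : ℝ) : ℂ) * amp n j 0 a (ρ ^ gam n m * x) ρ := by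
  simp [kerFam]

/-- The phase contributes `iθ y ρ^(θ-1)`, which brings `ρ^(q+1-θ)` back to `ρ^q`. All other
derivatives, including that of the argument `ρ^γ x`, make up `stepFam`. -/
lemma hasDerivAt_kerFam {ρ₀ δ : ℝ} {a : ℕ → ℝ → ℂ} (ha : Adm ρ₀ δ a) (n m : ℕ) (q : ℝ)
    (x y : ℝ) {ρ : ℝ} (hρ : 0 < ρ) :
    HasDerivAt (kerFam n m 0 (q + 1 - theta m) a 0 0 x y)
      (Complex.I * theta m * y * kerFam n m 0 q a 0 0 x y ρ
        + kerFam n m 0 (q + 1 - theta m) (stepFam n m q a) 0 0 x y ρ) ρ := by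
  obtain ⟨N, hN⟩ := ha.locFin (ρ + 1)
  have hN' : ∀ p, N ≤ p → deriv (a p) ρ = 0 := fun p hp => by
    have : a p =ᶠ[𝓝 ρ] fun _ => 0 := by
      filter_upwards [Iio_mem_nhds (show ρ < ρ + 1 by linarith)] with r hr
      exact hN p hp r hr
    rw [this.deriv_eq, deriv_const]
  have hN0 : ∀ p, N ≤ p → a p ρ = 0 := fun p hp => hN p hp ρ (by linarith)
  have hpow : ∀ s : ℝ, HasDerivAt (fun r : ℝ => ((r ^ s : ℝ) : ℂ))
      ((s * ρ ^ (s - 1) : ℝ) : ℂ) ρ := fun s =>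
    (Real.hasDerivAt_rpow_const (Or.inl hρ.ne')).ofReal_comp
  have hexp : HasDerivAt (fun r : ℝ => Complex.exp (Complex.I * ((y * r ^ theta m : ℝ) : ℂ)))
      (Complex.exp (Complex.I * ((y * ρ ^ theta m : ℝ) : ℂ)) *
        (Complex.I * ((y : ℂ) * ((theta m * ρ ^ (theta m - 1) : ℝ) : ℂ)))) ρ := by
    have := (((hpow (theta m)).const_mul (y : ℂ)).const_mul Complex.I).cexp
    simpa using this
  set t : ℝ := ρ ^ gam n m * x with ht
  have hamp : HasDerivAt (fun r => amp n 0 0 a (r ^ gam n m * x) r)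
      (∑ p ∈ Finset.range N, deriv (a p) ρ * eigDeriv n 0 p 0 t
        + (gam n m : ℂ) * (ρ : ℂ)⁻¹ * ∑ p ∈ Finset.range (N + 1),
            eulerAct n (fun r => a r ρ) p * eigDeriv n 0 p 0 t) ρ := by
    have hs : HasDerivAt (fun r : ℝ => r ^ gam n m * x) (gam n m * ρ⁻¹ * t) ρ := by
      have := (Real.hasDerivAt_rpow_const (p := gam n m) (Or.inl hρ.ne')).mul_const x
      refine this.congr_deriv ?_
      rw [Real.rpow_sub_one hρ.ne', ht]
      ring
    have hv : ∀ p, HasDerivAt (fun r : ℝ => eigDeriv n 0 p 0 (r ^ gam n m * x))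
        (((gam n m * ρ⁻¹ * t : ℝ) : ℂ) * eigDeriv n 0 p 1 t) ρ := fun p => by
      have := (hasDerivAt_eigDeriv n 0 p 0 t).scomp ρ hs
      simpa [Function.comp_def] using this
    have hsum : HasDerivAt (fun r => ∑ p ∈ Finset.range N,
        a p r * eigDeriv n 0 p 0 (r ^ gam n m * x))
        (∑ p ∈ Finset.range N, (deriv (a p) ρ * eigDeriv n 0 p 0 t +
          a p ρ * (((gam n m * ρ⁻¹ * t : ℝ) : ℂ) * eigDeriv n 0 p 1 t))) ρ :=
      HasDerivAt.fun_sum fun p _ =>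
        (((ha.smooth p).differentiable (by simp)) ρ).hasDerivAt.mul (hv p)
    rw [← sum_mul_eigDeriv_one n N hN0 t, Finset.mul_sum, ← Finset.sum_add_distrib]
    refine (hsum.congr_of_eventuallyEq ?_).congr_deriv ?_
    · filter_upwards [Iio_mem_nhds (show ρ < ρ + 1 by linarith)] with r hr
      exact amp_eq_sum fun p hp => hN p hp r hr
    · refine Finset.sum_congr rfl fun p _ => ?_
      push_cast
      ring
  have hstep : amp n 0 0 (stepFam n m q a) t ρ =
      ∑ p ∈ Finset.range N, deriv (a p) ρ * eigDeriv n 0 p 0 t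
        + (gam n m : ℂ) * (ρ : ℂ)⁻¹ * ∑ p ∈ Finset.range (N + 1),
            eulerAct n (fun r => a r ρ) p * eigDeriv n 0 p 0 t
        + ((1 - theta m + q : ℝ) : ℂ) * (ρ : ℂ)⁻¹ * amp n 0 0 a t ρ := by
    have e : ∀ p, N + 1 ≤ p → eulerAct n (fun r => a r ρ) p = 0 := fun p hp => by
      simp [eulerAct, hN0 (p - 1) (by omega), hN0 p (by omega), hN0 (p + 1) (by omega)]
    rw [amp_eq_sum (N := N + 1) (a := a) fun p hp => hN0 p (by omega),
      amp_eq_sum (N := N + 1) (a := stepFam n m q a) fun p hp => by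
        rw [stepFam, hN' p (by omega), hN0 p (by omega), e p hp]; ring]
    have e2 : ∑ p ∈ Finset.range N, deriv (a p) ρ * eigDeriv n 0 p 0 t =
        ∑ p ∈ Finset.range (N + 1), deriv (a p) ρ * eigDeriv n 0 p 0 t := by
      rw [Finset.sum_range_succ, hN' N le_rfl, zero_mul, add_zero]
    rw [e2, Finset.mul_sum, Finset.mul_sum, ← Finset.sum_add_distrib, ← Finset.sum_add_distrib]
    refine Finset.sum_congr rfl fun p _ => ?_
    rw [stepFam]
    ring
  have hfun : kerFam n m 0 (q + 1 - theta m) a 0 0 x y = fun ρ =>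
      Complex.exp (Complex.I * ((y * ρ ^ theta m : ℝ) : ℂ))
      * ((ρ ^ (q + 1 - theta m) : ℝ) : ℂ) * amp n 0 0 a (ρ ^ gam n m * x) ρ :=
    funext fun ρ => kerFam_zero_zero ..
  rw [hfun]
  refine ((hexp.fun_mul (hpow (q + 1 - theta m))).fun_mul hamp).congr_deriv ?_
  rw [kerFam_zero_zero, kerFam_zero_zero, ← ht, hstep]
  have p1 : ρ ^ (q + 1 - theta m - 1) = ρ ^ (q + 1 - theta m) * ρ⁻¹ := by
    rw [Real.rpow_sub_one hρ.ne', div_eq_mul_inv]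
  have p2 : ρ ^ q = ρ ^ (theta m - 1) * ρ ^ (q + 1 - theta m) := by
    rw [← Real.rpow_add hρ]; congr 1; ring
  rw [p1, p2]
  push_cast
  ring

/-- The total derivative in `hasDerivAt_kerFam` integrates to zero: no boundary term at `0` because
of the support, none at infinity because of the decay. The family `b` needs to agree with `stepFam`
only for `ρ > 0`, as in `stepFam_powFam`. -/
lemma Adm.mul_integral_kerFam {ρ₀ δ : ℝ} {a b : ℕ → ℝ → ℂ} (ha : Adm ρ₀ δ a) (hb : Adm ρ₀ δ b)
    (hρ₀ : 0 < ρ₀) (hδ : 0 < δ) {n m : ℕ} (hm : 0 < m) {q : ℝ}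
    (hab : ∀ p ρ, 0 < ρ → stepFam n m q a p ρ = b p ρ) (x y : ℝ) :
    (y : ℂ) * ∫ ρ in Set.Ioi 0, kerFam n m 0 q a 0 0 x y ρ =
      Complex.I / theta m * ∫ ρ in Set.Ioi 0, kerFam n m 0 (q + 1 - theta m) b 0 0 x y ρ := by
  have hθ : (theta m : ℂ) ≠ 0 := by
    exact_mod_cast (lt_trans one_pos (theta_gt_one hm)).ne'
  have i1 := (ha.isDominatedFamily hρ₀ hδ n m 0 q).integrable 0 0 x y
  have i2 := (hb.isDominatedFamily hρ₀ hδ n m 0 (q + 1 - theta m)).integrable 0 0 x y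
  have hd : ∀ ρ ∈ Set.Ioi (0 : ℝ), HasDerivAt (kerFam n m 0 (q + 1 - theta m) a 0 0 x y)
      (Complex.I * theta m * y * kerFam n m 0 q a 0 0 x y ρ
        + kerFam n m 0 (q + 1 - theta m) b 0 0 x y ρ) ρ := by
    intro ρ hρ
    refine (hasDerivAt_kerFam ha n m q x y hρ).congr_deriv ?_
    simp only [kerFam_zero_zero, amp, hab _ ρ hρ]
  have h0 : ∀ ρ < ρ₀, kerFam n m 0 (q + 1 - theta m) a 0 0 x y ρ = 0 := fun ρ hρ => by
    rw [kerFam_zero_zero, amp_eq_sum (N := 0) fun p _ => ha.zero p ρ hρ]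
    simp
  have hlim : Tendsto (kerFam n m 0 (q + 1 - theta m) a 0 0 x y) atTop (𝓝 0) := by
    obtain ⟨C, hC⟩ := ha.exists_norm_kerFam_le hρ₀ hδ n m 0 (q + 1 - theta m) 0 0
    have hz : Tendsto (fun ρ : ℝ => C * Real.exp (-(δ / 2) * ρ)) atTop (𝓝 0) := by
      have : Tendsto (fun ρ : ℝ => -(δ / 2) * ρ) atTop atBot :=
        tendsto_id.const_mul_atTop_of_neg (by linarith)
      simpa using (Real.tendsto_exp_atBot.comp this).const_mul C
    refine squeeze_zero_norm' ?_ hz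
    filter_upwards [eventually_gt_atTop 0] with ρ hρ using hC x y ρ hρ
  have hc : ContinuousWithinAt (kerFam n m 0 (q + 1 - theta m) a 0 0 x y) (Set.Ici 0) 0 := by
    have : kerFam n m 0 (q + 1 - theta m) a 0 0 x y =ᶠ[𝓝 0] fun _ => 0 := by
      filter_upwards [Iio_mem_nhds hρ₀] with r hr using h0 r hr
    exact (continuousAt_const.congr this.symm).continuousWithinAt
  have key := integral_Ioi_of_hasDerivAt_of_tendsto hc hd ((i1.const_mul _).add i2) hlim
  rw [h0 0 hρ₀, sub_zero, integral_add (i1.const_mul _) i2, integral_const_mul] at key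
  have hI := Complex.I_sq
  field_simp
  linear_combination (-Complex.I) * key + (y * theta m * ∫ ρ in Set.Ioi 0,
    kerFam n m 0 q a 0 0 x y ρ) * hI

/-! ### Powers of `y` -/

/-- The action of `p` integrations by parts on coefficients. -/
noncomputable def powFam (n m : ℕ) (q f : ℝ) (N : ℕ) (a : ℕ → ℝ → ℂ) (s : ℕ) (ρ : ℝ) : ℂ :=
  ∑ i ∈ Finset.range (N + 1), ((ρ : ℂ) ^ i)⁻¹ *
    polyAct n (euPoly (theta m) (gam n m) q f N i) (fun r => iteratedDeriv (N - i) (a r) ρ) s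

variable {ρ₀ δ : ℝ} {a : ℕ → ℝ → ℂ} {n m : ℕ}

lemma adm_powFam (hρ₀ : 0 < ρ₀) {N : ℕ}
    (h : ∀ k ≤ N, Adm ρ₀ δ (fun p => iteratedDeriv k (a p))) (q f : ℝ) :
    Adm ρ₀ δ (powFam n m q f N a) :=
  Adm.sum _ fun i _ => ((h (N - i) (Nat.sub_le _ _)).polyAct n _).inv_pow_mul hρ₀ i

/-- The recursion of `euPoly` is one more integration by parts: differentiating a coefficient keeps
`i`, while the Euler part and the derivative of `ρ^(-i)`, which contributes `-i`, raise `i` by one.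
-/
lemma stepFam_powFam (hs : ∀ p, ContDiff ℝ ((⊤ : ℕ∞) : WithTop ℕ∞) (a p)) (q f : ℝ) (N s : ℕ)
    {ρ : ℝ} (hρ : 0 < ρ) :
    stepFam n m (q + gam n m * f + N * (1 - theta m)) (powFam n m q f N a) s ρ =
      powFam n m q f (N + 1) a s ρ := by
  have hρc : (ρ : ℂ) ≠ 0 := by exact_mod_cast hρ.ne'
  set Q := euPoly (theta m) (gam n m) q f N with hQ
  set D : ℕ → ℕ → ℂ := fun k r => iteratedDeriv k (a r) ρ with hD
  have hder : HasDerivAt (powFam n m q f N a s) (∑ i ∈ Finset.range (N + 1),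
      (-(i : ℂ) * ((ρ : ℂ) ^ (i + 1))⁻¹ * polyAct n (Q i) (D (N - i)) s
        + ((ρ : ℂ) ^ i)⁻¹ * polyAct n (Q i) (D (N - i + 1)) s)) ρ := by
    refine HasDerivAt.fun_sum fun i _ => ?_
    have h1 : HasDerivAt (fun r : ℝ => ((r : ℂ) ^ i)⁻¹) (-(i : ℂ) * ((ρ : ℂ) ^ (i + 1))⁻¹) ρ := by
      have := ((hasDerivAt_pow i (ρ : ℂ)).inv (pow_ne_zero i hρc)).comp_ofReal
      refine this.congr_deriv ?_
      rcases i with _ | i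
      · simp
      · rw [Nat.add_sub_cancel]
        field_simp
        ring
    have h2 := hasDerivAt_polyAct n (Q i) (a := fun r => iteratedDeriv (N - i) (a r))
      (a' := fun r => iteratedDeriv (N - i + 1) (a r)) (ρ := ρ) (fun r => by
        rw [iteratedDeriv_succ]
        exact ((contDiff_iteratedDeriv_infty (hs r) _).differentiable (by simp) ρ).hasDerivAt) s
    exact h1.mul h2
  have heul : eulerAct n (fun r => powFam n m q f N a r ρ) s =
      ∑ i ∈ Finset.range (N + 1), ((ρ : ℂ) ^ i)⁻¹ *
        polyAct n (Polynomial.X * Q i) (D (N - i)) s := by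
    simp only [polyAct_mul, polyAct_X]
    have : (fun r => powFam n m q f N a r ρ) = ∑ i ∈ Finset.range (N + 1),
        ((ρ : ℂ) ^ i)⁻¹ • polyAct n (Q i) (D (N - i)) := by
      funext r
      simp [powFam, hQ, hD]
    rw [← eulerLin_apply, this, map_sum, Finset.sum_apply]
    simp
  rw [stepFam, hder.deriv, heul]
  have hlast : Q (N + 1) = 0 := euPoly_eq_zero _ _ _ _ _ _ (by omega)
  have hR : powFam n m q f (N + 1) a s ρ =
      ∑ i ∈ Finset.range (N + 1), ((ρ : ℂ) ^ i)⁻¹ * polyAct n (Q i) (D (N - i + 1)) s +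
      ∑ i ∈ Finset.range (N + 1), ((ρ : ℂ) ^ (i + 1))⁻¹ * polyAct n
        ((Polynomial.C (((N : ℝ) - i) + 1 - ((N : ℝ) + 1) * theta m + q + gam n m * f)
          + Polynomial.C (gam n m) * Polynomial.X) * Q i) (D (N - i)) s := by
    have hA : ∑ i ∈ Finset.range (N + 1), ((ρ : ℂ) ^ i)⁻¹ * polyAct n (Q i) (D (N - i + 1)) s =
        ∑ i ∈ Finset.range (N + 1 + 1), ((ρ : ℂ) ^ i)⁻¹ * polyAct n (Q i) (D (N + 1 - i)) s := by
      rw [Finset.sum_range_succ _ (N + 1), hlast, polyAct_zero]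
      simp only [LinearMap.zero_apply, Pi.zero_apply, mul_zero, add_zero]
      refine Finset.sum_congr rfl fun i hi => ?_
      rw [Finset.mem_range] at hi
      rw [show N - i + 1 = N + 1 - i by omega]
    rw [hA, powFam, Finset.sum_range_succ' _ (N + 1), Finset.sum_range_succ' _ (N + 1),
      add_right_comm, ← Finset.sum_add_distrib]
    congr 1
    · refine Finset.sum_congr rfl fun i _ => ?_
      rw [euPoly, polyAct_add, Nat.add_sub_add_right]
      simp only [LinearMap.add_apply, Pi.add_apply, mul_add]
      rfl
  rw [hR]
  have e : ∀ i : ℕ, ((ρ : ℂ) ^ (i + 1))⁻¹ * polyAct n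
      ((Polynomial.C (((N : ℝ) - i) + 1 - ((N : ℝ) + 1) * theta m + q + gam n m * f)
        + Polynomial.C (gam n m) * Polynomial.X) * Q i) (D (N - i)) s =
      -(i : ℂ) * ((ρ : ℂ) ^ (i + 1))⁻¹ * polyAct n (Q i) (D (N - i)) s
      + (ρ : ℂ)⁻¹ * (((1 - theta m + (q + gam n m * f + N * (1 - theta m)) : ℝ) : ℂ) *
          (((ρ : ℂ) ^ i)⁻¹ * polyAct n (Q i) (D (N - i)) s)
        + (gam n m : ℂ) * (((ρ : ℂ) ^ i)⁻¹ * polyAct n (Polynomial.X * Q i) (D (N - i)) s)) := by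
    intro i
    rw [add_mul, mul_assoc (Polynomial.C (gam n m)), polyAct_add, polyAct_mul, polyAct_mul n
      (Polynomial.C (gam n m))]
    simp only [LinearMap.add_apply, Module.End.mul_apply, polyAct_C, Pi.add_apply, Pi.smul_apply,
      smul_eq_mul]
    rw [pow_succ, mul_inv]
    push_cast
    ring
  simp only [e, powFam, Finset.sum_add_distrib, Finset.mul_sum, mul_add]
  ring

lemma pow_mul_integral_kerFam (hρ₀ : 0 < ρ₀) (hδ : 0 < δ) (hm : 0 < m) (q f : ℝ) {N : ℕ}
    (h : ∀ k ≤ N, Adm ρ₀ δ (fun p => iteratedDeriv k (a p))) (x y : ℝ) :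
    (y : ℂ) ^ N * ∫ ρ in Set.Ioi 0, kerFam n m 0 (q + gam n m * f) a 0 0 x y ρ =
      (Complex.I / theta m) ^ N * ∫ ρ in Set.Ioi 0,
        kerFam n m 0 (q + gam n m * f + N * (1 - theta m)) (powFam n m q f N a) 0 0 x y ρ := by
  induction N with
  | zero =>
    have : powFam n m q f 0 a = a := by
      funext s ρ
      simp [powFam, euPoly_zero_right, polyAct_one]
    simp [this]
  | succ N ih =>
    have hs : ∀ p, ContDiff ℝ ((⊤ : ℕ∞) : WithTop ℕ∞) (a p) := fun p => by
      simpa using (h 0 (by omega)).smooth p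
    have := Adm.mul_integral_kerFam (adm_powFam (n := n) (m := m) hρ₀
      (fun k hk => h k (by omega)) q f) (adm_powFam hρ₀ h q f) hρ₀ hδ hm
      (fun s ρ hρ => stepFam_powFam hs q f N s hρ) x y
    rw [pow_succ', mul_assoc, ih (fun k hk => h k (by omega)), mul_left_comm, this, pow_succ]
    push_cast
    ring_nf

/-! ### The operator applied to the integral -/

/-- The coefficients of `∂_ρ^(2m) u + (iθ)^(2m) E u + ∑ ρ^(-i) 𝒫_i(t∂_t) ∂_ρ^(2m-i) u`. -/
noncomputable def residual (n m : ℕ) (a : ℕ → ℝ → ℂ) (s : ℕ) (ρ : ℝ) : ℂ :=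
  iteratedDeriv (2 * m) (a s) ρ + (-1) ^ m * (freq n m s : ℂ) ^ (2 * m) * a s ρ
    + ∑ i ∈ Finset.Icc 1 (2 * m), ((ρ : ℂ) ^ i)⁻¹ *
        pAct n m i (fun r => iteratedDeriv (2 * m - i) (a r) ρ) s

/-- By `freq_pow`, `(i/θ)^(2m) (-1)^m c_s^(2m) = E_s`. The rest is the definition of `𝒫_i`,
regrouped into the `2m` and the `2m - 1` integrations by parts from which it arose. -/
lemma residual_eq (hm : 0 < m) (s : ℕ) (ρ : ℝ) :
    (Complex.I / theta m) ^ (2 * m) * residual n m a s ρ = eig n s * a s ρ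
      + (Complex.I / theta m) ^ (2 * m) *
        (powFam n m (rExp n m + 2 * theta m - 2 * n * gam n m) (2 * n) (2 * m) a s ρ
        - m * theta m * (((ρ : ℂ) ^ 1)⁻¹ * powFam n m (rExp n m + theta m - 2 * n * gam n m) (2 * n)
          (2 * m - 1) a s ρ)) := by
  have hθ : (theta m : ℂ) ≠ 0 := by
    exact_mod_cast (lt_trans one_pos (theta_gt_one hm)).ne'
  have h1 : (Complex.I / theta m) ^ (2 * m) * ((-1) ^ m * (freq n m s : ℂ) ^ (2 * m)) =
      (eig n s : ℂ) := by
    rw [← Complex.ofReal_pow, freq_pow n s hm]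
    push_cast
    rw [div_pow, pow_mul Complex.I, Complex.I_sq]
    have : ((-1 : ℂ) ^ m) * (-1) ^ m = 1 := by rw [← mul_pow]; simp
    field_simp
    linear_combination (eig n s : ℂ) * this
  obtain ⟨M, hM⟩ : ∃ M, 2 * m = M + 1 := ⟨2 * m - 1, by omega⟩
  have h2 : powFam n m (rExp n m + 2 * theta m - 2 * n * gam n m) (2 * n) (2 * m) a s ρ
        - m * theta m * (((ρ : ℂ) ^ 1)⁻¹ * powFam n m (rExp n m + theta m - 2 * n * gam n m) (2 * n)
          (2 * m - 1) a s ρ) = iteratedDeriv (2 * m) (a s) ρ +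
        ∑ i ∈ Finset.Icc 1 (2 * m), ((ρ : ℂ) ^ i)⁻¹ *
          pAct n m i (fun r => iteratedDeriv (2 * m - i) (a r) ρ) s := by
    have hIcc : ∀ g : ℕ → ℂ, ∑ i ∈ Finset.Icc 1 (2 * m), g i =
        ∑ i ∈ Finset.range (2 * m), g (i + 1) := fun g => by
      rw [Finset.range_eq_Ico, Finset.sum_Ico_add' g 0 (2 * m) 1]
      rfl
    rw [hIcc, powFam, Finset.sum_range_succ', euPoly_zero_right, polyAct_one, powFam,
      show 2 * m - 1 + 1 = 2 * m by omega, Finset.mul_sum, Finset.mul_sum]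
    simp only [pow_zero, inv_one, one_mul, Module.End.one_apply, Nat.sub_zero]
    rw [add_sub_right_comm, ← Finset.sum_sub_distrib, add_comm]
    congr 1
    refine Finset.sum_congr rfl fun i _ => ?_
    rw [pAct_eq_polyAct, pPoly, polyAct_sub, polyAct_mul, Nat.add_sub_cancel]
    simp only [LinearMap.sub_apply, Module.End.mul_apply, polyAct_C, Pi.sub_apply, Pi.smul_apply,
      smul_eq_mul]
    rw [show 2 * m - 1 - i = 2 * m - (i + 1) by omega, pow_succ (ρ : ℂ) i, mul_inv]
    push_cast
    ring
  rw [h2, ← h1, residual]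
  ring

/-- Smoothness, support and local finiteness are inherited from `a`. Decay is a separate hypothesis,
since cancellations give the residual a better rate than its individual terms. -/
lemma adm_residual {δ' : ℝ} (hρ₀ : 0 < ρ₀)
    (h : ∀ k ≤ 2 * m, Adm ρ₀ δ (fun p => iteratedDeriv k (a p)))
    (hd : Dec δ' (residual n m a)) : Adm ρ₀ δ' (residual n m a) := by
  have hsum : Adm ρ₀ δ (fun s ρ => ∑ i ∈ Finset.Icc 1 (2 * m), ((ρ : ℂ) ^ i)⁻¹ *
        pAct n m i (fun r => iteratedDeriv (2 * m - i) (a r) ρ) s) := by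
    simp only [pAct_eq_polyAct]
    exact Adm.sum _ fun i _ => ((h (2 * m - i) (Nat.sub_le _ _)).polyAct n _).inv_pow_mul hρ₀ i
  have h0 := h 0 (Nat.zero_le _)
  have h2 := h (2 * m) le_rfl
  simp only [iteratedDeriv_zero] at h0
  refine ⟨fun p => ?_, fun p ρ hρ => ?_, fun r => ?_, hd⟩
  · exact ((h2.smooth p).add (contDiff_const.mul (h0.smooth p))).add (hsum.smooth p)
  · simp [residual, h2.zero p ρ hρ, h0.zero p ρ hρ, hsum.zero p ρ hρ]
  · obtain ⟨N₁, h₁⟩ := h0.locFin r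
    obtain ⟨N₂, h₂⟩ := h2.locFin r
    obtain ⟨N₃, h₃⟩ := hsum.locFin r
    refine ⟨max N₁ (max N₂ N₃), fun p hp ρ hρ => ?_⟩
    simp only [max_le_iff] at hp
    simp [residual, h₁ p hp.1 ρ hρ, h₂ p hp.2.1 ρ hρ, h₃ p hp.2.2 ρ hρ]

/-- The homogeneity of the problem: with `t = ρ^γ x`, the factors `ρ^(2γ)`, `x^(4n+2) ρ^(2θ)` and
`x^(2n) ρ^θ` all become `ρ^(2γ)` times a power of `t`. -/
lemma theta_eq_gam (n : ℕ) (hm : 0 < m) : theta m = (2 * n + 2) * gam n m := by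
  have h1 : (1 : ℝ) ≤ m := by exact_mod_cast hm
  have h2 : (2 * m - 1 : ℝ) ≠ 0 := by linarith
  have h3 : (n + 1 : ℝ) ≠ 0 := by positivity
  rw [theta, gam]
  field_simp

lemma kerFam_zero_right_shift (n m j : ℕ) (q : ℝ) (a : ℕ → ℝ → ℂ) (B : ℕ) (x y : ℝ) {ρ : ℝ}
    (hρ : 0 < ρ) :
    kerFam n m j q a 0 B x y ρ = Complex.I ^ B * kerFam n m j (q + theta m * B) a 0 0 x y ρ := by
  rw [kerFam, kerFam_zero_zero, Real.rpow_add hρ, Real.rpow_mul hρ.le, Real.rpow_natCast, mul_pow]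
  push_cast
  ring

lemma opM_integral_of_dominated {F : ℕ → ℕ → ℝ → ℝ → ℝ → ℂ} {μ : Measure ℝ}
    (hF : IsDominatedFamily μ F) (n : ℕ) (hm : 0 < m) (x y : ℝ) :
    opM n m (fun x y => ∫ ρ, F 0 0 x y ρ ∂μ) x y = -(∫ ρ, F 2 0 x y ρ ∂μ)
      - (x : ℂ) ^ (4 * n + 2) * ∫ ρ, F 0 2 x y ρ ∂μ
      - (x : ℂ) ^ (2 * n) * (m * (y : ℂ) ^ (2 * m - 1) * (∫ ρ, F 0 1 x y ρ ∂μ)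
        + (y : ℂ) ^ (2 * m) * ∫ ρ, F 0 2 x y ρ ∂μ) := by
  have hx : Dx (fun x y => ∫ ρ, F 0 0 x y ρ ∂μ) = fun x y => -Complex.I * ∫ ρ, F 1 0 x y ρ ∂μ := by
    funext x y
    rw [Dx, (hF.hasDerivAt_x 0 0 x y).deriv]
  have hy : Dy (fun x y => ∫ ρ, F 0 0 x y ρ ∂μ) = fun x y => -Complex.I * ∫ ρ, F 0 1 x y ρ ∂μ := by
    funext x y
    rw [Dy, (hF.hasDerivAt_y 0 0 x y).deriv]
  have d1 : Dx (Dx (fun x y => ∫ ρ, F 0 0 x y ρ ∂μ)) x y = -(∫ ρ, F 2 0 x y ρ ∂μ) := by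
    rw [hx, Dx, ((hF.hasDerivAt_x 1 0 x y).const_mul (-Complex.I)).deriv]
    linear_combination (∫ ρ, F 2 0 x y ρ ∂μ) * Complex.I_sq
  have d2 : X₂ n (X₂ n (fun x y => ∫ ρ, F 0 0 x y ρ ∂μ)) x y =
      -((x : ℂ) ^ (4 * n + 2) * ∫ ρ, F 0 2 x y ρ ∂μ) := by
    have : X₂ n (fun x y => ∫ ρ, F 0 0 x y ρ ∂μ) =
        fun x y => ((x ^ (2 * n + 1) : ℝ) : ℂ) * (-Complex.I * ∫ ρ, F 0 1 x y ρ ∂μ) := by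
      funext x y; rw [X₂, hy]
    rw [this, X₂, Dy, (((hF.hasDerivAt_y 0 1 x y).const_mul (-Complex.I)).const_mul _).deriv]
    rw [show 4 * n + 2 = (2 * n + 1) + (2 * n + 1) by ring, pow_add]
    push_cast
    linear_combination ((x : ℂ) ^ (2 * n + 1) * (x : ℂ) ^ (2 * n + 1) *
      ∫ ρ, F 0 2 x y ρ ∂μ) * Complex.I_sq
  have d3 : X₃ n m (X₃ n m (fun x y => ∫ ρ, F 0 0 x y ρ ∂μ)) x y =
      -((x : ℂ) ^ (2 * n) * (m * (y : ℂ) ^ (2 * m - 1) * (∫ ρ, F 0 1 x y ρ ∂μ)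
        + (y : ℂ) ^ (2 * m) * ∫ ρ, F 0 2 x y ρ ∂μ)) := by
    have : X₃ n m (fun x y => ∫ ρ, F 0 0 x y ρ ∂μ) =
        fun x y => ((x ^ n * y ^ m : ℝ) : ℂ) * (-Complex.I * ∫ ρ, F 0 1 x y ρ ∂μ) := by
      funext x y; rw [X₃, hy]
    have hp := ((hasDerivAt_pow m y).const_mul (x ^ n)).ofReal_comp
    rw [this, X₃, Dy, (hp.fun_mul ((hF.hasDerivAt_y 0 1 x y).const_mul (-Complex.I))).deriv]
    obtain ⟨k, rfl⟩ : ∃ k, m = k + 1 := ⟨m - 1, by omega⟩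
    rw [show 2 * (k + 1) - 1 = k + (k + 1) by omega, Nat.add_sub_cancel, two_mul, two_mul, pow_add,
      pow_add (y : ℂ) k, pow_add (y : ℂ) (k + 1)]
    push_cast
    linear_combination ((x : ℂ) ^ n * (x : ℂ) ^ n * ((k + 1) * ((y : ℂ) ^ k * (y : ℂ) ^ (k + 1)) *
      (∫ ρ, F 0 1 x y ρ ∂μ) + (y : ℂ) ^ (k + 1) * (y : ℂ) ^ (k + 1) *
        ∫ ρ, F 0 2 x y ρ ∂μ)) * Complex.I_sq
  rw [opM, d1, d2, d3]
  ring

/-- After extraction of `ρ^(2γ)`, the first two terms are `a_p (-v_p'' + t^(4n+2) v_p)`. The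
equation `eigDeriv_ode` replaces this by `E_p a_p t^(2n) v_p`, so `t^(2n)` is common to all terms.
-/
lemma kerFam_residual {L₁ L₂ : ℕ → ℝ → ℂ} {δ₁ δ₂ : ℝ} (hm : 0 < m) (h₀ : Adm ρ₀ δ a)
    (h₁ : Adm ρ₀ δ₁ L₁) (h₂ : Adm ρ₀ δ₂ L₂) {b : ℕ → ℝ → ℂ} {c d : ℂ}
    (hb : ∀ s ρ, b s ρ = eig n s * a s ρ + c * (L₁ s ρ - d * (((ρ : ℂ) ^ 1)⁻¹ * L₂ s ρ)))
    (q x y : ℝ) {ρ : ℝ} (hρ : 0 < ρ) :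
    -kerFam n m 0 q a 2 0 x y ρ + (x : ℂ) ^ (4 * n + 2) * kerFam n m 0 (q + theta m * 2) a 0 0 x y ρ
      + c * (x : ℂ) ^ (2 * n) * (kerFam n m 0 (q + theta m) L₁ 0 0 x y ρ
        - d * kerFam n m 0 (q + theta m - 1) L₂ 0 0 x y ρ) =
    kerFam n m (2 * n) (q + 2 * gam n m) b 0 0 x y ρ := by
  obtain ⟨N₀, hN₀⟩ := h₀.locFin (ρ + 1)
  obtain ⟨N₁, hN₁⟩ := h₁.locFin (ρ + 1)
  obtain ⟨N₂, hN₂⟩ := h₂.locFin (ρ + 1)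
  set N := N₀ + N₁ + N₂
  have e₀ : ∀ p, N ≤ p → a p ρ = 0 := fun p hp => hN₀ p (by omega) ρ (by linarith)
  have e₁ : ∀ p, N ≤ p → L₁ p ρ = 0 := fun p hp => hN₁ p (by omega) ρ (by linarith)
  have e₂ : ∀ p, N ≤ p → L₂ p ρ = 0 := fun p hp => hN₂ p (by omega) ρ (by linarith)
  have e₃ : ∀ p, N ≤ p → b p ρ = 0 := fun p hp => by simp [hb, e₀ p hp, e₁ p hp, e₂ p hp]
  set P : ℝ := ρ ^ gam n m with hP
  have hPk : ∀ k : ℕ, ρ ^ (k * gam n m) = P ^ k := fun k => by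
    rw [mul_comm, Real.rpow_mul hρ.le, Real.rpow_natCast]
  have hth : theta m = ((2 * n + 2 : ℕ) : ℝ) * gam n m := by
    rw [theta_eq_gam n hm]; push_cast; ring
  have q1 : ρ ^ (q + theta m * 2) = ρ ^ q * P ^ (4 * n + 4) := by
    rw [← hPk, ← Real.rpow_add hρ]; congr 1; rw [hth]; push_cast; ring
  have q2 : ρ ^ (q + theta m) = ρ ^ q * P ^ (2 * n + 2) := by
    rw [← hPk, ← Real.rpow_add hρ, ← hth]
  have q3 : ρ ^ (q + theta m - 1) = ρ ^ q * P ^ (2 * n + 2) * ρ⁻¹ := by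
    rw [Real.rpow_sub_one hρ.ne', q2, div_eq_mul_inv]
  have q4 : ρ ^ (q + 2 * gam n m) = ρ ^ q * P ^ 2 := by
    rw [← hPk, ← Real.rpow_add hρ]; norm_num
  rw [kerFam_zero_zero, kerFam_zero_zero, kerFam_zero_zero, kerFam_zero_zero, q1, q2, q3, q4,
    kerFam, ← hP, amp_eq_sum e₀, amp_eq_sum e₀, amp_eq_sum e₁, amp_eq_sum e₂, amp_eq_sum e₃]
  simp only [Finset.mul_sum, ← Finset.sum_sub_distrib, ← Finset.sum_add_distrib,
    ← Finset.sum_neg_distrib]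
  refine Finset.sum_congr rfl fun p _ => ?_
  have ode := eigDeriv_ode n p (P * x)
  rw [eigDeriv_zero, eigDeriv_zero] at ode
  rw [eigDeriv_zero, eigDeriv_zero, hb]
  push_cast at ode ⊢
  simp only [pow_zero, one_mul, pow_one] at ode ⊢
  have ode' := congrArg (fun z => Complex.exp (Complex.I * ((y : ℂ) * ((ρ ^ theta m : ℝ) : ℂ))) *
    ((ρ ^ q : ℝ) : ℂ) * (P : ℂ) ^ 2 * a p ρ * z) ode
  rw [mul_pow, mul_pow] at ode'
  rw [mul_pow]
  have x1 : (P : ℂ) ^ (4 * n + 4) = P ^ 2 * P ^ (4 * n + 2) := by rw [← pow_add]; congr 1; ring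
  have x2 : (P : ℂ) ^ (2 * n + 2) = P ^ 2 * P ^ (2 * n) := by rw [← pow_add]; congr 1; ring
  rw [x1, x2]
  linear_combination ode'

lemma opM_integral_kerFam (hρ₀ : 0 < ρ₀) (hδ : 0 < δ) (hm : 0 < m)
    (h : ∀ k ≤ 2 * m, Adm ρ₀ δ (fun p => iteratedDeriv k (a p))) :
    opM n m (fun x y => ∫ ρ in Set.Ioi 0, kerFam n m 0 (rExp n m) a 0 0 x y ρ) =
      fun x y => ∫ ρ in Set.Ioi 0, kerFam n m (2 * n) (rExp n m + 2 * gam n m)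
        (fun s ρ => (Complex.I / theta m) ^ (2 * m) * residual n m a s ρ) 0 0 x y ρ := by
  have hθ : (theta m : ℂ) ≠ 0 := by
    exact_mod_cast (lt_trans one_pos (theta_gt_one hm)).ne'
  have h1 : (1 : ℝ) ≤ m := by exact_mod_cast hm
  have h12 : (2 * m - 1 : ℝ) ≠ 0 := by linarith
  have h0 : Adm ρ₀ δ a := by simpa using h 0 (Nat.zero_le _)
  have hF := h0.isDominatedFamily hρ₀ hδ n m 0 (rExp n m)
  set r := rExp n m with hr
  set L₁ := powFam n m (r + 2 * theta m - 2 * n * gam n m) (2 * n) (2 * m) a with hL₁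
  set L₂ := powFam n m (r + theta m - 2 * n * gam n m) (2 * n) (2 * m - 1) a with hL₂
  have aL₁ : Adm ρ₀ δ L₁ := adm_powFam hρ₀ h _ _
  have aL₂ : Adm ρ₀ δ L₂ := adm_powFam hρ₀ (fun k hk => h k (by omega)) _ _
  funext x y
  rw [opM_integral_of_dominated hF n hm]
  have s1 : ∫ ρ in Set.Ioi 0, kerFam n m 0 r a 0 1 x y ρ =
      Complex.I * ∫ ρ in Set.Ioi 0, kerFam n m 0 (r + theta m) a 0 0 x y ρ := by
    rw [← integral_const_mul]
    refine setIntegral_congr_fun measurableSet_Ioi fun ρ hρ => ?_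
    have := kerFam_zero_right_shift n m 0 r a 1 x y hρ
    simpa using this
  have s2 : ∫ ρ in Set.Ioi 0, kerFam n m 0 r a 0 2 x y ρ =
      -∫ ρ in Set.Ioi 0, kerFam n m 0 (r + theta m * 2) a 0 0 x y ρ := by
    rw [← integral_neg]
    refine setIntegral_congr_fun measurableSet_Ioi fun ρ hρ => ?_
    have := kerFam_zero_right_shift n m 0 r a 2 x y hρ
    simpa using this
  have p1 := pow_mul_integral_kerFam (n := n) (N := 2 * m) hρ₀ hδ hm
    (r + 2 * theta m - 2 * n * gam n m) (2 * n) h x y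
  have p2 := pow_mul_integral_kerFam (n := n) (N := 2 * m - 1) hρ₀ hδ hm
    (r + theta m - 2 * n * gam n m) (2 * n) (fun k hk => h k (by omega)) x y
  -- The final exponents come from `2m(1-θ) = -θ` and `(2m-1)(1-θ) = -1`; they are `r + θ` and `r +
  -- θ - 1`, and the missing power is the `ρ⁻¹` in front of the second family in `residual_eq`.
  rw [show r + 2 * theta m - 2 * n * gam n m + gam n m * (2 * n) + ((2 * m : ℕ) : ℝ) *
      (1 - theta m) = r + theta m by
        push_cast; rw [theta]; field_simp; ring,
    show r + 2 * theta m - 2 * n * gam n m + gam n m * (2 * n) = r + theta m * 2 by ring,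
    ← hL₁] at p1
  rw [show r + theta m - 2 * n * gam n m + gam n m * (2 * n) + ((2 * m - 1 : ℕ) : ℝ) *
      (1 - theta m) = r + theta m - 1 by
        rw [Nat.cast_sub (by omega)]; push_cast; rw [theta]; field_simp; ring,
    show r + theta m - 2 * n * gam n m + gam n m * (2 * n) = r + theta m by ring,
    ← hL₂] at p2
  have i1 : Integrable (fun ρ => -kerFam n m 0 r a 2 0 x y ρ) (volume.restrict (Set.Ioi 0)) :=
    (hF.integrable 2 0 x y).neg
  have i2 := ((h0.isDominatedFamily hρ₀ hδ n m 0 (r + theta m * 2)).integrable 0 0 x y).const_mul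
    ((x : ℂ) ^ (4 * n + 2))
  have i3 := (aL₁.isDominatedFamily hρ₀ hδ n m 0 (r + theta m)).integrable 0 0 x y
  have i4 := ((aL₂.isDominatedFamily hρ₀ hδ n m 0 (r + theta m - 1)).integrable 0 0 x y).const_mul
    ((m : ℂ) * theta m)
  have key : ∫ ρ in Set.Ioi 0, kerFam n m (2 * n) (r + 2 * gam n m)
        (fun s ρ => (Complex.I / theta m) ^ (2 * m) * residual n m a s ρ) 0 0 x y ρ =
      ∫ ρ in Set.Ioi 0, (-kerFam n m 0 r a 2 0 x y ρ
        + (x : ℂ) ^ (4 * n + 2) * kerFam n m 0 (r + theta m * 2) a 0 0 x y ρ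
        + (Complex.I / theta m) ^ (2 * m) * (x : ℂ) ^ (2 * n) *
          (kerFam n m 0 (r + theta m) L₁ 0 0 x y ρ
            - m * theta m * kerFam n m 0 (r + theta m - 1) L₂ 0 0 x y ρ)) :=
    setIntegral_congr_fun measurableSet_Ioi fun ρ hρ =>
      (kerFam_residual hm h0 aL₁ aL₂ (fun s ρ => residual_eq hm s ρ) r x y hρ).symm
  have i12 : Integrable (fun ρ => -kerFam n m 0 r a 2 0 x y ρ
      + (x : ℂ) ^ (4 * n + 2) * kerFam n m 0 (r + theta m * 2) a 0 0 x y ρ)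
      (volume.restrict (Set.Ioi 0)) := i1.add i2
  have i34 : Integrable (fun ρ => kerFam n m 0 (r + theta m) L₁ 0 0 x y ρ
      - m * theta m * kerFam n m 0 (r + theta m - 1) L₂ 0 0 x y ρ)
      (volume.restrict (Set.Ioi 0)) := i3.sub i4
  rw [key, integral_add i12 (i34.const_mul _), integral_add i1 i2,
    integral_const_mul, integral_const_mul, integral_sub i3 i4, integral_const_mul, integral_neg,
    s1, s2]
  have hI : Complex.I * (Complex.I / theta m) ^ (2 * m - 1) =
      theta m * (Complex.I / theta m) ^ (2 * m) := by
    obtain ⟨k, hk⟩ : ∃ k, 2 * m = k + 1 := ⟨2 * m - 1, by omega⟩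
    rw [hk, Nat.add_sub_cancel, pow_succ]
    field_simp
  linear_combination (x : ℂ) ^ (2 * n) * p1 - (x : ℂ) ^ (2 * n) * m * Complex.I * p2
    - (x : ℂ) ^ (2 * n) * m * (∫ ρ in Set.Ioi 0, kerFam n m 0 (r + theta m - 1) L₂ 0 0 x y ρ) * hI

end MetivierGen

namespace MetivierGen
open MeasureTheory Filter Topology

/-! ### Cutoffs on the half-line -/

/-- Cutoffs at scale `R` on the positive half-line, with derivatives up to the order `N` bounded
uniformly in the index. -/
structure IsCutoff (R : ℝ) (N : ℕ) (W : ℕ → ℝ → ℂ) : Prop where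
  smooth : ∀ l, ContDiff ℝ ((⊤ : ℕ∞) : WithTop ℕ∞) (W l)
  eq_zero : ∀ (l : ℕ) (ρ : ℝ), ρ ≤ 2 * R * (l + 1) → W l ρ = 0
  eq_one : ∀ (l : ℕ) (ρ : ℝ), 4 * R * (l + 1) ≤ ρ → W l ρ = 1
  bound : ∃ C : ℝ, ∀ (l k : ℕ) (ρ : ℝ), k ≤ N → ‖iteratedDeriv k (W l) ρ‖ ≤ C

/-- The restriction of a cutoff to the positive half-line. -/
noncomputable def posPart (ω : ℕ → ℝ → ℝ) (l : ℕ) (ρ : ℝ) : ℂ := if 0 < ρ then (ω l ρ : ℂ) else 0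

lemma iteratedDeriv_ofReal {f : ℝ → ℝ} (hf : ContDiff ℝ ((⊤ : ℕ∞) : WithTop ℕ∞) f) (k : ℕ) (x : ℝ) :
    iteratedDeriv k (fun x => (f x : ℂ)) x = ((iteratedDeriv k f x : ℝ) : ℂ) := by
  induction k generalizing x with
  | zero => simp
  | succ k ih =>
    have e : iteratedDeriv k (fun x => (f x : ℂ)) = fun x => ((iteratedDeriv k f x : ℝ) : ℂ) :=
      funext ih
    have hd : HasDerivAt (iteratedDeriv k f) (deriv (iteratedDeriv k f) x) x := by
      refine DifferentiableAt.hasDerivAt ?_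
      rw [iteratedDeriv_eq_iterate]
      exact (hf.iterate_deriv k).differentiable (by simp) x
    rw [iteratedDeriv_succ, e, iteratedDeriv_succ, hd.ofReal_comp.deriv]

/-- Each `ω_ℓ` is also `1` near `-∞`, hence the passage to `posPart`. Only the second derivative
estimate is used: for `ρ ≥ 2` it bounds finitely many derivatives by a constant that may depend on
`R` and `σ` but not on the index. -/
lemma IsOmegaFamily.isCutoff {σ R : ℝ} {ω : ℕ → ℝ → ℝ} (h : IsOmegaFamily σ R ω) (hR : 1 ≤ R)
    (N : ℕ) : IsCutoff R N (posPart ω) := by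
  have hz : ∀ (l : ℕ) (ρ : ℝ), ρ ≤ 2 * R * (l + 1) → posPart ω l ρ = 0 := by
    intro l ρ hρ
    rw [posPart]
    split_ifs with h0
    · rw [h.eq_zero l ρ (by rwa [abs_of_pos h0]), Complex.ofReal_zero]
    · rfl
  have hlow : ∀ (l : ℕ) (ρ : ℝ), ρ < 2 → posPart ω l =ᶠ[𝓝 ρ] fun _ => 0 := by
    intro l ρ hρ
    filter_upwards [Iio_mem_nhds hρ] with r hr
    have hr' : r < 2 := hr
    refine hz l r ?_
    have : (0 : ℝ) ≤ l := Nat.cast_nonneg l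
    nlinarith
  have hpos : ∀ (l : ℕ) (ρ : ℝ), 0 < ρ → posPart ω l =ᶠ[𝓝 ρ] fun r => (ω l r : ℂ) := by
    intro l ρ hρ
    filter_upwards [Ioi_mem_nhds hρ] with r hr
    exact if_pos hr
  refine ⟨fun l => contDiff_iff_contDiffAt.mpr fun ρ => ?_, hz, fun l ρ hρ => ?_, ?_⟩
  · rcases lt_or_ge ρ 2 with h2 | h2
    · exact contDiffAt_const.congr_of_eventuallyEq (hlow l ρ h2)
    · exact (Complex.ofRealCLM.contDiff.comp (h.smooth l)).contDiffAt.congr_of_eventuallyEq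
        (hpos l ρ (by linarith))
  · have h0 : 0 < ρ := lt_of_lt_of_le (by positivity) hρ
    rw [posPart, if_pos h0, h.eq_one l ρ (by rwa [abs_of_pos h0]), Complex.ofReal_one]
  · obtain ⟨C, hC, -, hb⟩ := h.bound
    refine ⟨∑ k ∈ Finset.range (N + 1), (R * C) ^ (k + 1) * (k.factorial : ℝ) ^ σ,
      fun l k ρ hk => ?_⟩
    have hnn : ∀ k ∈ Finset.range (N + 1), 0 ≤ (R * C) ^ (k + 1) * (k.factorial : ℝ) ^ σ :=
      fun k _ => by positivity
    rcases lt_or_ge ρ 2 with h2 | h2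
    · rw [(hlow l ρ h2).iteratedDeriv_eq, iteratedDeriv_zero_fun, norm_zero]
      exact Finset.sum_nonneg hnn
    · rw [(hpos l ρ (by linarith)).iteratedDeriv_eq, iteratedDeriv_ofReal (h.smooth l),
        Complex.norm_real, Real.norm_eq_abs]
      refine (hb l k ρ).trans (le_trans ?_ (Finset.single_le_sum hnn
        (Finset.mem_range.mpr (Nat.lt_succ_of_le hk))))
      refine div_le_self (by positivity) (one_le_pow₀ ?_)
      rw [abs_of_nonneg (by linarith)]
      linarith

namespace IsCutoff

variable {R : ℝ} {N : ℕ} {W : ℕ → ℝ → ℂ}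

lemma iteratedDeriv_eq_zero_of_lt (hW : IsCutoff R N W) (k l : ℕ) {ρ : ℝ}
    (hρ : ρ < 2 * R * (l + 1)) : iteratedDeriv k (W l) ρ = 0 := by
  have : W l =ᶠ[𝓝 ρ] fun _ => 0 := by
    filter_upwards [Iio_mem_nhds hρ] with r hr using hW.eq_zero l r (le_of_lt hr)
  rw [this.iteratedDeriv_eq, iteratedDeriv_zero_fun]

lemma iteratedDeriv_eq_zero_of_gt (hW : IsCutoff R N W) {k : ℕ} (hk : 0 < k) (l : ℕ) {ρ : ℝ}
    (hρ : 4 * R * (l + 1) < ρ) : iteratedDeriv k (W l) ρ = 0 := by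
  have : W l =ᶠ[𝓝 ρ] fun _ => 1 := by
    filter_upwards [Ioi_mem_nhds hρ] with r hr using hW.eq_one l r (le_of_lt hr)
  rw [this.iteratedDeriv_eq, iteratedDeriv_const, if_neg hk.ne']

lemma eq_zero_of_le (hW : IsCutoff R N W) (hR : 0 < R) {l L : ℕ} (h : L ≤ l) {ρ : ℝ}
    (hρ : ρ ≤ 2 * R * (L + 1)) : W l ρ = 0 := by
  have : (L : ℝ) ≤ l := by exact_mod_cast h
  exact hW.eq_zero l ρ (hρ.trans (by gcongr))

end IsCutoff

/-! ### Convergence of the bounds -/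

/-- `(ℓ!)^(-1/2m)`. -/
noncomputable def decayFactor (m l : ℕ) : ℝ := growth m l / l.factorial

lemma decayFactor_pos (m l : ℕ) : 0 < decayFactor m l := div_pos (growth_pos m l) (by positivity)

lemma decayFactor_succ (m l : ℕ) :
    decayFactor m (l + 1) = ((l : ℝ) + 1) ^ (-(1 / (2 * m) : ℝ)) * decayFactor m l := by
  rw [decayFactor, decayFactor, growth, growth, Nat.factorial_succ]
  push_cast
  have h0 : (0 : ℝ) < (l : ℝ) + 1 := by positivity
  rw [Real.mul_rpow h0.le (by positivity), show -(1 / (2 * m) : ℝ) = growthExp m - 1 by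
    rw [growthExp]; ring, Real.rpow_sub_one h0.ne']
  field_simp

/-- The ratio of consecutive terms is `Z (l+1)^(-1/2m)` and tends to `0`. Every loss geometric in
`ℓ` is therefore harmless, and no relation between `R` and `K` is needed. -/
lemma summable_pow_mul_decayFactor {m : ℕ} (hm : 0 < m) {Z : ℝ} (hZ : 0 < Z) :
    Summable fun l => Z ^ l * decayFactor m l := by
  have hm' : (0 : ℝ) < m := by exact_mod_cast hm
  have hp : ∀ l, 0 < Z ^ l * decayFactor m l := fun l => mul_pos (pow_pos hZ l)
    (decayFactor_pos m l)
  refine summable_of_ratio_test_tendsto_lt_one (l := 0) one_pos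
    (Eventually.of_forall fun l => (hp l).ne') ?_
  have h1 : Tendsto (fun l : ℕ => Z * ((l : ℝ) + 1) ^ (-(1 / (2 * m) : ℝ))) atTop (𝓝 0) := by
    have := ((tendsto_rpow_neg_atTop (y := (1 / (2 * m) : ℝ)) (by positivity)).comp
      (tendsto_natCast_atTop_atTop.atTop_add tendsto_const_nhds (C := (1 : ℝ)))).const_mul Z
    simpa using this
  refine h1.congr fun l => ?_
  rw [Real.norm_of_nonneg (hp _).le, Real.norm_of_nonneg (hp _).le, decayFactor_succ, pow_succ]
  have := (decayFactor_pos m l).ne'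
  field_simp

/-- On the support of the cutoff `l! ≤ l^l ≤ ρ^l`, so the power of `ρ` outweighs the factorial
growth and leaves `(l!)^(-1/2m)`. -/
lemma growth_mul_inv_pow_le {m l : ℕ} {R ρ : ℝ} (hR : 1 ≤ R) (hρ : 2 * R * (l + 1) ≤ ρ) :
    growth m l * (ρ ^ l)⁻¹ ≤ decayFactor m l := by
  rw [decayFactor, div_eq_mul_inv]
  have h0 : (0 : ℝ) ≤ l := Nat.cast_nonneg l
  have h1 : (l : ℝ) ≤ ρ := by nlinarith
  have h2 : (l.factorial : ℝ) ≤ ρ ^ l :=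
    (by exact_mod_cast Nat.factorial_le_pow l : (l.factorial : ℝ) ≤ (l : ℝ) ^ l).trans
      (pow_le_pow_left₀ h0 h1 l)
  have := growth_pos m l
  gcongr

lemma dec_of_sum {δ : ℝ} {b : ℕ → ℝ → ℂ} {t : ℕ → ℕ → ℝ → ℂ}
    (hb : ∀ ρ, 0 < ρ → ∃ N, ∀ p, b p ρ = ∑ l ∈ Finset.range N, t l p ρ)
    (ht : ∀ X : ℝ, 1 ≤ X → ∃ c : ℕ → ℝ, Summable c ∧ ∀ l p ρ, 0 < ρ →
      X ^ p * ‖t l p ρ‖ ≤ c l * Real.exp (-(δ * ρ))) : Dec δ b := by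
  intro X hX
  obtain ⟨c, hc, hle⟩ := ht X hX
  refine ⟨∑' l, c l, fun p ρ hρ => ?_⟩
  obtain ⟨N, hN⟩ := hb ρ hρ
  have hc0 : ∀ l, 0 ≤ c l := fun l => by
    have := (by positivity : 0 ≤ X ^ 0 * ‖t l 0 1‖).trans (hle l 0 1 one_pos)
    exact nonneg_of_mul_nonneg_left this (Real.exp_pos _)
  calc X ^ p * ‖b p ρ‖ ≤ X ^ p * ∑ l ∈ Finset.range N, ‖t l p ρ‖ := by
        rw [hN p]; gcongr; exact norm_sum_le _ _
    _ = ∑ l ∈ Finset.range N, X ^ p * ‖t l p ρ‖ := Finset.mul_sum _ _ _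
    _ ≤ ∑ l ∈ Finset.range N, c l * Real.exp (-(δ * ρ)) := Finset.sum_le_sum fun l _ => hle l p ρ hρ
    _ = (∑ l ∈ Finset.range N, c l) * Real.exp (-(δ * ρ)) := (Finset.sum_mul _ _ _).symm
    _ ≤ _ := by
      gcongr
      exact hc.sum_le_tsum _ fun l _ => hc0 l

/-! ### Summation of a formal solution -/

/-- The number of rows by which the term `ρ^(-i) 𝒫_i` is shifted in the equation of the component
`p`. -/
def rowShift (p i : ℕ) : ℕ := if p = 0 then i - 1 else i

/-- Coefficients `g_{ℓ,p}` solving the hierarchy of equations on `(2R(ℓ+1), ∞)`, with estimates. -/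
structure IsFormalSol (n m : ℕ) (R K D : ℝ) (g : ℕ → ℕ → ℝ → ℂ) : Prop where
  smooth : ∀ l p, ContDiff ℝ ((⊤ : ℕ∞) : WithTop ℕ∞) (g l p)
  support : ∀ l p, l < p → g l p = fun _ => 0
  bound : ∀ (l p k : ℕ) (ρ : ℝ), k ≤ 2 * m → 2 * R * (l + 1) ≤ ρ →
    ‖iteratedDeriv k (g l p) ρ‖ ≤
      D * K ^ l * growth m l * (ρ ^ l)⁻¹ * Real.exp (-(decayRate n m * ρ))
  eqn : ∀ (l p : ℕ) (ρ : ℝ), 2 * R * (l + 1) < ρ →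
    iteratedDeriv (2 * m) (g l p) ρ + (-1) ^ m * (freq n m p : ℂ) ^ (2 * m) * g l p ρ =
      -∑ i ∈ Finset.Icc 1 (2 * m), if rowShift p i ≤ l then ((ρ : ℂ) ^ i)⁻¹ *
        pAct n m i (fun q => iteratedDeriv (2 * m - i) (g (l - rowShift p i) q) ρ) p else 0

/-- `∑_ℓ ω_ℓ g_{ℓ,p}`. -/
noncomputable def cutSum (W : ℕ → ℝ → ℂ) (g : ℕ → ℕ → ℝ → ℂ) (p : ℕ) (ρ : ℝ) : ℂ :=
  ∑' l, W l ρ * g l p ρ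

/-- The terms of `∂^k (ω_ℓ g_{ℓ,p})` in which derivatives fall on the cutoff. -/
noncomputable def commTerm (W : ℕ → ℝ → ℂ) (g : ℕ → ℕ → ℝ → ℂ) (k l p : ℕ) (ρ : ℝ) : ℂ :=
  ∑ j ∈ Finset.range k, (k.choose (j + 1) : ℂ) * iteratedDeriv (j + 1) (W l) ρ *
    iteratedDeriv (k - (j + 1)) (g l p) ρ

section CutSum

variable {n m N : ℕ} {R K D : ℝ} {g : ℕ → ℕ → ℝ → ℂ} {W : ℕ → ℝ → ℂ}

lemma cutSum_eq (hW : IsCutoff R N W) (hR : 0 < R) (g : ℕ → ℕ → ℝ → ℂ) {L : ℕ} {ρ : ℝ}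
    (hρ : ρ ≤ 2 * R * (L + 1)) (p : ℕ) :
    cutSum W g p ρ = ∑ l ∈ Finset.range L, W l ρ * g l p ρ :=
  tsum_eq_sum fun l hl => by
    rw [hW.eq_zero_of_le hR (by simpa using hl) hρ, zero_mul]

lemma iteratedDeriv_cutSum (hW : IsCutoff R N W) (hR : 0 < R)
    (hg : ∀ l p, ContDiff ℝ ((⊤ : ℕ∞) : WithTop ℕ∞) (g l p)) {L : ℕ} {ρ : ℝ}
    (hρ : ρ < 2 * R * (L + 1)) (k p : ℕ) :
    iteratedDeriv k (cutSum W g p) ρ = ∑ l ∈ Finset.range L,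
      (W l ρ * iteratedDeriv k (g l p) ρ + commTerm W g k l p ρ) := by
  have e : cutSum W g p =ᶠ[𝓝 ρ] fun r => ∑ l ∈ Finset.range L, (W l * g l p) r := by
    filter_upwards [Iio_mem_nhds hρ] with r hr
    exact cutSum_eq hW hR g (le_of_lt hr) p
  have hk : ((k : ℕ∞) : WithTop ℕ∞) ≤ ((⊤ : ℕ∞) : WithTop ℕ∞) := by
    exact_mod_cast le_top
  have hWk : ∀ l, ContDiffAt ℝ k (W l) ρ := fun l => ((hW.smooth l).of_le hk).contDiffAt
  have hgk : ∀ l, ContDiffAt ℝ k (g l p) ρ := fun l => ((hg l p).of_le hk).contDiffAt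
  rw [e.iteratedDeriv_eq, iteratedDeriv_fun_sum (f := fun l => W l * g l p)
    fun l _ => (hWk l).mul (hgk l)]
  refine Finset.sum_congr rfl fun l _ => ?_
  rw [iteratedDeriv_mul (hWk l) (hgk l), Finset.sum_range_succ', commTerm, add_comm]
  simp

lemma contDiff_cutSum (hW : IsCutoff R N W) (hR : 0 < R)
    (hg : ∀ l p, ContDiff ℝ ((⊤ : ℕ∞) : WithTop ℕ∞) (g l p)) (p : ℕ) :
    ContDiff ℝ ((⊤ : ℕ∞) : WithTop ℕ∞) (cutSum W g p) := by
  refine contDiff_iff_contDiffAt.mpr fun ρ => ?_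
  obtain ⟨L, hL⟩ := exists_nat_gt (ρ / (2 * R))
  have hρ : ρ < 2 * R * (L + 1) := by
    rw [div_lt_iff₀ (by positivity)] at hL
    nlinarith
  have e : cutSum W g p =ᶠ[𝓝 ρ] fun r => ∑ l ∈ Finset.range L, W l r * g l p r := by
    filter_upwards [Iio_mem_nhds hρ] with r hr
    exact cutSum_eq hW hR g (le_of_lt hr) p
  exact (ContDiff.sum fun l _ => (hW.smooth l).mul (hg l p)).contDiffAt.congr_of_eventuallyEq e

/-- The common bound of the coefficients of the row `ℓ`. -/
lemma IsFormalSol.norm_le (h : IsFormalSol n m R K D g) (hR : 1 ≤ R) (hK : 0 ≤ K) (hD : 0 ≤ D)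
    {l k : ℕ} {ρ : ℝ} (hk : k ≤ 2 * m) (hρ : 2 * R * (l + 1) ≤ ρ) (p : ℕ) :
    ‖iteratedDeriv k (g l p) ρ‖ ≤
      D * (K ^ l * decayFactor m l) * Real.exp (-(decayRate n m * ρ)) := by
  refine (h.bound l p k ρ hk hρ).trans ?_
  have := growth_mul_inv_pow_le (m := m) hR hρ
  calc _ = D * (K ^ l * (growth m l * (ρ ^ l)⁻¹)) * Real.exp (-(decayRate n m * ρ)) := by ring
    _ ≤ _ := by gcongr

lemma exists_norm_commTerm_le (h : IsFormalSol n m R K D g) (hW : IsCutoff R (2 * m) W)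
    (hR : 1 ≤ R) (hK : 0 ≤ K) (hD : 0 ≤ D) : ∃ C : ℝ, 0 ≤ C ∧ ∀ (k l p : ℕ) (ρ : ℝ), k ≤ 2 * m →
      ‖commTerm W g k l p ρ‖ ≤ C * (K ^ l * decayFactor m l) * Real.exp (-(decayRate n m * ρ)) := by
  obtain ⟨C, hC⟩ := hW.bound
  have hC0 : 0 ≤ C := (norm_nonneg _).trans (hC 0 0 0 (Nat.zero_le _))
  refine ⟨2 * m * (2 ^ (2 * m) * C * D), by positivity, fun k l p ρ hk => ?_⟩
  have hτ := (decayFactor_pos m l).le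
  rw [commTerm]
  have hterm : ∀ j ∈ Finset.range k, ‖(k.choose (j + 1) : ℂ) * iteratedDeriv (j + 1) (W l) ρ *
      iteratedDeriv (k - (j + 1)) (g l p) ρ‖ ≤ 2 ^ (2 * m) * C * (D * (K ^ l * decayFactor m l) *
        Real.exp (-(decayRate n m * ρ))) := by
    intro j hj
    rw [Finset.mem_range] at hj
    rcases lt_or_ge ρ (2 * R * (l + 1)) with hlt | hge
    · rw [hW.iteratedDeriv_eq_zero_of_lt _ l hlt, mul_zero, zero_mul, norm_zero]
      positivity
    · rw [norm_mul, norm_mul]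
      have h1 : ‖(k.choose (j + 1) : ℂ)‖ ≤ 2 ^ (2 * m) := by
        rw [Complex.norm_natCast]
        have : k.choose (j + 1) ≤ 2 ^ (2 * m) :=
          (Nat.choose_le_two_pow k (j + 1)).trans (Nat.pow_le_pow_right two_pos hk)
        exact_mod_cast this
      exact mul_le_mul (mul_le_mul h1 (hC l (j + 1) ρ (by omega)) (norm_nonneg _) (by positivity))
        (h.norm_le hR hK hD (by omega) hge p) (norm_nonneg _) (by positivity)
  have hk' : (k : ℝ) ≤ 2 * m := by exact_mod_cast hk
  refine (norm_sum_le_of_le _ hterm).trans ?_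
  rw [Finset.sum_const, Finset.card_range, nsmul_eq_mul]
  calc _ ≤ (2 * m : ℝ) * (2 ^ (2 * m) * C * (D * (K ^ l * decayFactor m l) *
        Real.exp (-(decayRate n m * ρ)))) := by gcongr
    _ = _ := by ring

lemma commTerm_eq_zero (h : IsFormalSol n m R K D g) {k l p : ℕ} (hp : l < p) (ρ : ℝ) :
    commTerm W g k l p ρ = 0 := by
  simp [commTerm, h.support l p hp]

lemma commTerm_eq_zero_of_lt (hW : IsCutoff R N W) {k l p : ℕ} {ρ : ℝ}
    (hρ : ρ < 2 * R * (l + 1)) : commTerm W g k l p ρ = 0 := by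
  simp [commTerm, hW.iteratedDeriv_eq_zero_of_lt _ l hρ]

lemma commTerm_eq_zero_of_gt (hW : IsCutoff R N W) {k l p : ℕ} {ρ : ℝ}
    (hρ : 4 * R * (l + 1) < ρ) : commTerm W g k l p ρ = 0 := by
  simp [commTerm, hW.iteratedDeriv_eq_zero_of_gt (Nat.succ_pos _) l hρ]

/-- Row `ℓ` has only components `p ≤ ℓ`, so the weight `X^p` is at most `X^ℓ` and is absorbed by the
summability. No cancellation is used, and the rate is only that of the leading term. -/
lemma adm_cutSum (h : IsFormalSol n m R K D g) (hW : IsCutoff R (2 * m) W) (hm : 0 < m)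
    (hR : 1 ≤ R) (hK : 0 < K) (hD : 0 ≤ D) {k : ℕ} (hk : k ≤ 2 * m) :
    Adm (2 * R) (decayRate n m) (fun p => iteratedDeriv k (cutSum W g p)) := by
  have hR0 : 0 < R := by linarith
  refine ⟨fun p => contDiff_iteratedDeriv_infty (contDiff_cutSum hW hR0 h.smooth p) k,
    fun p ρ hρ => ?_, fun r => ?_, ?_⟩
  · rw [iteratedDeriv_cutSum hW hR0 h.smooth (L := 0) (by simpa using hρ)]
    simp
  · obtain ⟨L, hL⟩ := exists_nat_gt (r / (2 * R))
    rw [div_lt_iff₀ (by positivity)] at hL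
    refine ⟨L, fun p hp ρ hρ => ?_⟩
    rw [iteratedDeriv_cutSum hW hR0 h.smooth (L := L) (by nlinarith)]
    refine Finset.sum_eq_zero fun l hl => ?_
    rw [Finset.mem_range] at hl
    rw [commTerm_eq_zero h (by omega), h.support l p (by omega)]
    simp
  · obtain ⟨C, hC0, hC⟩ := exists_norm_commTerm_le h hW hR hK.le hD
    obtain ⟨C', hC'⟩ := hW.bound
    have hC'0 : 0 ≤ C' := (norm_nonneg _).trans (hC' 0 0 0 (Nat.zero_le _))
    refine dec_of_sum (t := fun l p ρ => W l ρ * iteratedDeriv k (g l p) ρ + commTerm W g k l p ρ)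
      (fun ρ _ => ?_) fun X hX => ?_
    · obtain ⟨L, hL⟩ := exists_nat_gt (ρ / (2 * R))
      rw [div_lt_iff₀ (by positivity)] at hL
      exact ⟨L, fun p => iteratedDeriv_cutSum hW hR0 h.smooth (by nlinarith) k p⟩
    · refine ⟨fun l => (C' * D + C) * ((X * K) ^ l * decayFactor m l),
        (summable_pow_mul_decayFactor hm (by positivity)).mul_left _, fun l p ρ _ => ?_⟩
      have hτ := (decayFactor_pos m l).le
      rcases lt_or_ge l p with hlp | hpl
      · rw [commTerm_eq_zero h hlp, h.support l p hlp]
        simp only [iteratedDeriv_zero_fun, mul_zero, add_zero, norm_zero]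
        positivity
      · have h1 : ‖W l ρ * iteratedDeriv k (g l p) ρ‖ ≤
            C' * (D * (K ^ l * decayFactor m l) * Real.exp (-(decayRate n m * ρ))) := by
          rw [norm_mul]
          rcases lt_or_ge ρ (2 * R * (l + 1)) with hlt | hge
          · rw [hW.eq_zero l ρ hlt.le, norm_zero, zero_mul]
            positivity
          · exact mul_le_mul (by simpa using hC' l 0 ρ (Nat.zero_le _))
              (h.norm_le hR hK.le hD hk hge p) (norm_nonneg _) hC'0
        calc X ^ p * ‖W l ρ * iteratedDeriv k (g l p) ρ + commTerm W g k l p ρ‖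
            ≤ X ^ l * (C' * (D * (K ^ l * decayFactor m l) * Real.exp (-(decayRate n m * ρ))) +
              C * (K ^ l * decayFactor m l) * Real.exp (-(decayRate n m * ρ))) := by
              gcongr
              exact (norm_add_le _ _).trans (add_le_add h1 (hC k l p ρ hk))
          _ = _ := by beta_reduce; rw [mul_pow]; ring

end CutSum

end MetivierGen

namespace MetivierGen
open MeasureTheory Filter Topology

/-! ### The residual of the cut-off sum -/

section Residual

variable {n m : ℕ} {R K D : ℝ} {g : ℕ → ℕ → ℝ → ℂ} {W : ℕ → ℝ → ℂ}

lemma pAct_add (n m i : ℕ) (a b : ℕ → ℂ) (p : ℕ) :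
    pAct n m i (fun q => a q + b q) p = pAct n m i a p + pAct n m i b p := by
  rw [pAct_eq_polyAct, pAct_eq_polyAct, pAct_eq_polyAct, ← Pi.add_apply, ← map_add]
  rfl

lemma pAct_smul (n m i : ℕ) (c : ℂ) (a : ℕ → ℂ) (p : ℕ) :
    pAct n m i (fun q => c * a q) p = c * pAct n m i a p := by
  rw [pAct_eq_polyAct, pAct_eq_polyAct, ← smul_eq_mul c, ← Pi.smul_apply, ← map_smul]
  rfl

lemma pAct_sum {ι : Type*} (n m i : ℕ) (s : Finset ι) (a : ι → ℕ → ℂ) (p : ℕ) :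
    pAct n m i (fun q => ∑ l ∈ s, a l q) p = ∑ l ∈ s, pAct n m i (a l) p := by
  simp only [pAct_eq_polyAct]
  have : (fun q => ∑ l ∈ s, a l q) = ∑ l ∈ s, a l := by
    funext q
    simp
  rw [this, map_sum, Finset.sum_apply]

lemma sum_range_shift {L s : ℕ} {w b : ℕ → ℂ} (hw : ∀ l, L ≤ l → w l = 0) :
    ∑ l ∈ Finset.range L, w l * (if s ≤ l then b (l - s) else 0) =
      ∑ l ∈ Finset.range L, w (l + s) * b l := by
  have h1 : ∑ l ∈ Finset.range (L + s), w l * (if s ≤ l then b (l - s) else 0) =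
      ∑ l ∈ Finset.range L, w l * (if s ≤ l then b (l - s) else 0) := by
    rw [Finset.sum_range_add]
    refine add_eq_left.mpr (Finset.sum_eq_zero fun l _ => ?_)
    rw [hw _ (by omega), zero_mul]
  rw [← h1, add_comm L s, Finset.sum_range_add]
  rw [Finset.sum_eq_zero fun l hl => by
    rw [if_neg (by simpa using hl), mul_zero], zero_add]
  refine Finset.sum_congr rfl fun l _ => ?_
  rw [if_pos (by omega), Nat.add_sub_cancel_left, add_comm]

/-- The contribution of the row `ℓ` to the residual of `∑ ω_ℓ u_ℓ`. -/
noncomputable def residualTerm (n m : ℕ) (W : ℕ → ℝ → ℂ) (g : ℕ → ℕ → ℝ → ℂ) (l p : ℕ) (ρ : ℝ) :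
    ℂ :=
  commTerm W g (2 * m) l p ρ + ∑ i ∈ Finset.Icc 1 (2 * m),
    (((ρ : ℂ) ^ i)⁻¹ * pAct n m i (fun q => commTerm W g (2 * m - i) l q ρ) p
      + (W l ρ - W (l + rowShift p i) ρ) * (((ρ : ℂ) ^ i)⁻¹ *
        pAct n m i (fun q => iteratedDeriv (2 * m - i) (g l q) ρ) p))

/-- Leibniz's rule separates the commutators. In the equation of row `l`, multiplied by `W l`, the
operator `𝒫_i` acts on row `l - s`; reindexing puts `W (l + s)` in front of row `l`, and only the
difference `W l - W (l + s)` remains. -/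
lemma residual_cutSum (h : IsFormalSol n m R K D g) (hW : IsCutoff R (2 * m) W) (hR : 0 < R)
    {L : ℕ} {ρ : ℝ} (hρ : ρ < 2 * R * (L + 1)) (p : ℕ) :
    residual n m (cutSum W g) p ρ = ∑ l ∈ Finset.range L, residualTerm n m W g l p ρ := by
  have hder : ∀ k q, iteratedDeriv k (cutSum W g q) ρ = ∑ l ∈ Finset.range L,
      (W l ρ * iteratedDeriv k (g l q) ρ + commTerm W g k l q ρ) := fun k q =>
    iteratedDeriv_cutSum hW hR h.smooth hρ k q
  have h0 : cutSum W g p ρ = ∑ l ∈ Finset.range L, W l ρ * g l p ρ :=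
    cutSum_eq hW hR g hρ.le p
  set B : ℕ → ℕ → ℂ := fun l i => ((ρ : ℂ) ^ i)⁻¹ *
    pAct n m i (fun q => iteratedDeriv (2 * m - i) (g l q) ρ) p with hB
  have heq : ∀ l, W l ρ * (iteratedDeriv (2 * m) (g l p) ρ
      + (-1) ^ m * (freq n m p : ℂ) ^ (2 * m) * g l p ρ) =
      -∑ i ∈ Finset.Icc 1 (2 * m), W l ρ *
        (if rowShift p i ≤ l then B (l - rowShift p i) i else 0) := by
    intro l
    rcases lt_or_ge (2 * R * (l + 1)) ρ with hlt | hge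
    · rw [h.eqn l p ρ hlt, mul_neg, Finset.mul_sum]
    · simp [hW.eq_zero l ρ hge]
  have hWL : ∀ l, L ≤ l → W l ρ = 0 := fun l hl => hW.eq_zero_of_le hR hl hρ.le
  have hsum : ∑ l ∈ Finset.range L, W l ρ * (iteratedDeriv (2 * m) (g l p) ρ
      + (-1) ^ m * (freq n m p : ℂ) ^ (2 * m) * g l p ρ) =
      -∑ l ∈ Finset.range L, ∑ i ∈ Finset.Icc 1 (2 * m), W (l + rowShift p i) ρ * B l i := by
    simp only [heq, Finset.sum_neg_distrib]
    rw [Finset.sum_comm, Finset.sum_comm (s := Finset.range L)]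
    congr 1
    refine Finset.sum_congr rfl fun i _ => ?_
    exact sum_range_shift (w := fun l => W l ρ) (b := fun l => B l i) hWL
  have hp : ∑ i ∈ Finset.Icc 1 (2 * m), ((ρ : ℂ) ^ i)⁻¹ *
        pAct n m i (fun r => iteratedDeriv (2 * m - i) (cutSum W g r) ρ) p =
      ∑ l ∈ Finset.range L, ∑ i ∈ Finset.Icc 1 (2 * m), (W l ρ * B l i +
        ((ρ : ℂ) ^ i)⁻¹ * pAct n m i (fun q => commTerm W g (2 * m - i) l q ρ) p) := by
    rw [Finset.sum_comm]
    refine Finset.sum_congr rfl fun i _ => ?_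
    simp only [hder]
    rw [pAct_sum, Finset.mul_sum]
    refine Finset.sum_congr rfl fun l _ => ?_
    rw [pAct_add, pAct_smul]
    ring
  rw [residual, hp, hder, h0, Finset.mul_sum, ← Finset.sum_add_distrib]
  have e1 : ∑ l ∈ Finset.range L, (W l ρ * iteratedDeriv (2 * m) (g l p) ρ
      + commTerm W g (2 * m) l p ρ + (-1) ^ m * (freq n m p : ℂ) ^ (2 * m) * (W l ρ * g l p ρ)) =
      ∑ l ∈ Finset.range L, commTerm W g (2 * m) l p ρ
        - ∑ l ∈ Finset.range L, ∑ i ∈ Finset.Icc 1 (2 * m), W (l + rowShift p i) ρ * B l i := by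
    rw [sub_eq_add_neg, ← hsum, ← Finset.sum_add_distrib]
    refine Finset.sum_congr rfl fun l _ => ?_
    ring
  rw [e1, sub_add_eq_add_sub, add_sub_assoc, ← Finset.sum_sub_distrib, ← Finset.sum_add_distrib]
  refine Finset.sum_congr rfl fun l _ => ?_
  rw [residualTerm, ← Finset.sum_sub_distrib]
  congr 1
  refine Finset.sum_congr rfl fun i _ => ?_
  rw [hB]
  ring

/-- The loss of `𝒫_i` is now estimated wastefully by a geometric factor in `l`, using only that the
sequence stops at `l`. -/
lemma norm_inv_pow_mul_pAct_le {C A : ℝ}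
    (hC : ∀ (i : ℕ) (a : ℕ → ℂ) (A : ℝ), i ≤ 2 * m →
      (∀ q : ℕ, ((q : ℝ) + 1) ^ i * ‖a q‖ ≤ A) → ∀ p, ‖pAct n m i a p‖ ≤ C * A)
    {i l : ℕ} (hi : i ≤ 2 * m) {ρ : ℝ} (hρ : 1 ≤ ρ) {a : ℕ → ℂ} (hs : ∀ q, l < q → a q = 0)
    (ha : ∀ q, ‖a q‖ ≤ A) (p : ℕ) :
    ‖((ρ : ℂ) ^ i)⁻¹ * pAct n m i a p‖ ≤ C * ((2 ^ (2 * m)) ^ l * A) := by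
  have hA : 0 ≤ A := (norm_nonneg _).trans (ha 0)
  have h1 : ‖((ρ : ℂ) ^ i)⁻¹‖ ≤ 1 := by
    rw [norm_inv, norm_pow, Complex.norm_real, Real.norm_eq_abs, abs_of_nonneg (by linarith)]
    exact inv_le_one_of_one_le₀ (one_le_pow₀ hρ)
  rw [norm_mul]
  refine (mul_le_of_le_one_left (norm_nonneg _) h1).trans (hC i a _ hi (fun q => ?_) p)
  rcases lt_or_ge l q with hq | hq
  · rw [hs q hq, norm_zero, mul_zero]
    positivity
  · have h2 : ((q : ℝ) + 1) ≤ 2 ^ l := by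
      have : q + 1 ≤ 2 ^ l := (Nat.succ_le_succ hq).trans Nat.lt_two_pow_self
      exact_mod_cast this
    calc ((q : ℝ) + 1) ^ i * ‖a q‖ ≤ (2 ^ l) ^ i * A := by
          gcongr
          exact ha q
      _ ≤ (2 ^ l) ^ (2 * m) * A := by
          gcongr
          exact one_le_pow₀ one_le_two
      _ = _ := by rw [← pow_mul, ← pow_mul, mul_comm l]

/-- The contribution of row `l` lives on a window of `ρ` of size comparable to `l + 1`, where
`e^(δρ)` is geometric in `l`, and in components `p ≤ l + 2m`. The factor `(l!)^(-1/2m)` beats all of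
this for every `δ`. -/
lemma dec_residual_cutSum (h : IsFormalSol n m R K D g) (hW : IsCutoff R (2 * m) W) (hm : 0 < m)
    (hR : 1 ≤ R) (hK : 0 < K) (hD : 0 ≤ D) {δ : ℝ} (hδ : 0 ≤ δ) :
    Dec δ (residual n m (cutSum W g)) := by
  have hR0 : 0 < R := by linarith
  refine dec_of_sum (t := residualTerm n m W g) (fun ρ _ => ?_) fun X hX => ?_
  · obtain ⟨L, hL⟩ := exists_nat_gt (ρ / (2 * R))
    rw [div_lt_iff₀ (by positivity)] at hL
    exact ⟨L, fun p => residual_cutSum h hW hR0 (by nlinarith) p⟩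
  obtain ⟨C₁, hC₁, hcomm⟩ := exists_norm_commTerm_le h hW hR hK.le hD
  obtain ⟨C₂, hW'⟩ := hW.bound
  have hC₂ : 0 ≤ C₂ := (norm_nonneg _).trans (hW' 0 0 0 (Nat.zero_le _))
  obtain ⟨C, hC1, hC⟩ := exists_norm_pAct_le n m
  have hC0 : 0 ≤ C := by linarith
  set M := C₁ + 2 * m * (C * C₁ + 2 * C₂ * (C * D)) with hM
  have hM0 : 0 ≤ M := by positivity
  set Z := X * (2 ^ (2 * m)) * K * Real.exp (δ * (4 * R)) with hZ
  set T := M * X ^ (2 * m) * Real.exp (δ * (4 * R * (2 * m + 1))) with hT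
  refine ⟨fun l => T * (Z ^ l * decayFactor m l),
    (summable_pow_mul_decayFactor hm (by positivity)).mul_left _, fun l p ρ hρ0 => ?_⟩
  have hτ := (decayFactor_pos m l).le
  have hZ0 : 0 ≤ T * (Z ^ l * decayFactor m l) * Real.exp (-(δ * ρ)) := by positivity
  have hzero : residualTerm n m W g l p ρ = 0 → X ^ p * ‖residualTerm n m W g l p ρ‖ ≤
      T * (Z ^ l * decayFactor m l) * Real.exp (-(δ * ρ)) := fun h0 => by
    rwa [h0, norm_zero, mul_zero]
  have hpz : ∀ i, pAct n m i (fun _ => 0) p = 0 := fun i => by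
    simpa using pAct_smul n m i 0 (fun _ => 0) p
  rcases lt_or_ge ρ (2 * R * (l + 1)) with hlow | hlow
  · refine hzero ?_
    have hw : ∀ s, W (l + s) ρ = 0 := fun s => hW.eq_zero_of_le hR0 (Nat.le_add_right l s) hlow.le
    have hw0 := hw 0
    rw [add_zero] at hw0
    simp [residualTerm, commTerm_eq_zero_of_lt hW hlow, hw, hw0, hpz]
  have hs : ∀ i ∈ Finset.Icc 1 (2 * m), rowShift p i ≤ 2 * m := fun i hi => by
    rw [Finset.mem_Icc] at hi
    rw [rowShift]
    split_ifs <;> omega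
  -- Beyond this point the cutoffs with indices from `l` to `l + 2m` all equal `1`, so commutators
  -- and differences vanish.
  rcases lt_or_ge (4 * R * (l + 2 * m + 1)) ρ with hhigh | hhigh
  · refine hzero ?_
    have hw : ∀ s, s ≤ 2 * m → W (l + s) ρ = 1 := fun s hs => by
      refine hW.eq_one _ _ (le_trans ?_ hhigh.le)
      have : (s : ℝ) ≤ 2 * m := by exact_mod_cast hs
      push_cast
      gcongr
    have hw0 := hw 0 (Nat.zero_le _)
    rw [add_zero] at hw0
    have hgt : 4 * R * (l + 1) < ρ := by
      refine lt_of_le_of_lt ?_ hhigh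
      have : (0 : ℝ) ≤ 2 * m := by positivity
      gcongr
      linarith
    rw [residualTerm, commTerm_eq_zero_of_gt hW hgt, zero_add]
    refine Finset.sum_eq_zero fun i hi => ?_
    simp only [commTerm_eq_zero_of_gt hW hgt, hpz, hw _ (hs i hi), hw0, sub_self, mul_zero,
      zero_mul, add_zero]
  rcases lt_or_ge (l + 2 * m) p with hp | hp
  · refine hzero ?_
    rw [residualTerm, commTerm_eq_zero h (by omega), zero_add]
    refine Finset.sum_eq_zero fun i hi => ?_
    rw [Finset.mem_Icc] at hi
    rw [pAct_support n m i (L := l) (fun q hq => commTerm_eq_zero h hq ρ) p (by omega),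
      pAct_support n m i (L := l) (fun q hq => by rw [h.support l q hq, iteratedDeriv_zero_fun]) p
        (by omega)]
    simp
  set S := K ^ l * decayFactor m l with hS
  have hS0 : 0 ≤ S := by positivity
  have hdr := decayRate_pos n hm
  have hexp : Real.exp (-(decayRate n m * ρ)) ≤ 1 := Real.exp_le_one_iff.mpr (by nlinarith)
  have hl0 : (0 : ℝ) ≤ l := Nat.cast_nonneg l
  have hρ1 : 1 ≤ ρ := by nlinarith
  have hcomm' : ∀ k, k ≤ 2 * m → ∀ q, ‖commTerm W g k l q ρ‖ ≤ C₁ * S := fun k hk q =>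
    (hcomm k l q ρ hk).trans (mul_le_of_le_one_right (by positivity) hexp)
  have hg' : ∀ k, k ≤ 2 * m → ∀ q, ‖iteratedDeriv k (g l q) ρ‖ ≤ D * S := fun k hk q =>
    (h.norm_le hR hK.le hD hk hlow q).trans (mul_le_of_le_one_right (by positivity) hexp)
  set P : ℝ := (2 ^ (2 * m)) ^ l with hP
  have hP1 : 1 ≤ P := one_le_pow₀ (one_le_pow₀ one_le_two)
  have hterm : ∀ i ∈ Finset.Icc 1 (2 * m),
      ‖((ρ : ℂ) ^ i)⁻¹ * pAct n m i (fun q => commTerm W g (2 * m - i) l q ρ) p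
      + (W l ρ - W (l + rowShift p i) ρ) * (((ρ : ℂ) ^ i)⁻¹ *
        pAct n m i (fun q => iteratedDeriv (2 * m - i) (g l q) ρ) p)‖ ≤
      (C * C₁ + 2 * C₂ * (C * D)) * (P * S) := by
    intro i hi
    rw [Finset.mem_Icc] at hi
    have b1 := norm_inv_pow_mul_pAct_le hC hi.2 hρ1 (fun q hq => commTerm_eq_zero h hq ρ)
      (hcomm' (2 * m - i) (by omega)) p
    have b2 := norm_inv_pow_mul_pAct_le hC hi.2 hρ1 (l := l)
      (fun q hq => by rw [h.support l q hq, iteratedDeriv_zero_fun])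
      (hg' (2 * m - i) (by omega)) p
    have b3 : ‖W l ρ - W (l + rowShift p i) ρ‖ ≤ 2 * C₂ := by
      refine (norm_sub_le _ _).trans ?_
      have e1 := hW' l 0 ρ (Nat.zero_le _)
      have e2 := hW' (l + rowShift p i) 0 ρ (Nat.zero_le _)
      simp only [iteratedDeriv_zero] at e1 e2
      linarith
    refine (norm_add_le _ _).trans ?_
    rw [norm_mul (W l ρ - _)]
    calc _ ≤ C * (P * (C₁ * S)) + 2 * C₂ * (C * (P * (D * S))) :=
          add_le_add b1 (mul_le_mul b3 b2 (norm_nonneg _) (by positivity))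
      _ = _ := by ring
  have htot : ‖residualTerm n m W g l p ρ‖ ≤ M * (P * S) := by
    rw [residualTerm]
    refine (norm_add_le _ _).trans ?_
    have e1 : ‖commTerm W g (2 * m) l p ρ‖ ≤ C₁ * (P * S) :=
      (hcomm' _ le_rfl p).trans (mul_le_mul_of_nonneg_left (le_mul_of_one_le_left hS0 hP1) hC₁)
    have e2 := norm_sum_le_of_le _ hterm
    rw [Finset.sum_const, Nat.card_Icc, Nat.add_sub_cancel, nsmul_eq_mul] at e2
    refine (add_le_add e1 e2).trans_eq ?_
    rw [hM]
    push_cast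
    ring
  have hX0 : 0 ≤ X := by linarith
  -- The upper end of the window converts `e^(δρ)` into a geometric factor, which goes into `Z`, and
  -- a constant, which goes into `T`.
  have hexp2 : 1 ≤ Real.exp (δ * (4 * R)) ^ l * Real.exp (δ * (4 * R * (2 * m + 1))) *
      Real.exp (-(δ * ρ)) := by
    rw [← Real.exp_nat_mul, ← Real.exp_add, ← Real.exp_add]
    refine Real.one_le_exp ?_
    nlinarith [mul_le_mul_of_nonneg_left hhigh hδ]
  calc X ^ p * ‖residualTerm n m W g l p ρ‖ ≤ X ^ (l + 2 * m) * (M * (P * S)) := by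
        gcongr
    _ ≤ X ^ (l + 2 * m) * (M * (P * S)) * (Real.exp (δ * (4 * R)) ^ l *
        Real.exp (δ * (4 * R * (2 * m + 1))) * Real.exp (-(δ * ρ))) :=
        le_mul_of_one_le_right (by positivity) hexp2
    _ = _ := by
        beta_reduce
        rw [hT, hZ, hS, hP, mul_pow, mul_pow, mul_pow, pow_add]
        ring

end Residual

end MetivierGen

namespace MetivierGen
open MeasureTheory Filter Topology

/-! ### The coefficients `g_{ℓ,p}` as a formal solution, and `ũ` as an amplitude -/

section FormalSolution

variable {n m : ℕ} {χ : ℕ → ℝ → ℝ} {R₁ K D : ℝ}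

lemma iteratedDeriv_gCoef_zero (hm : 0 < m) (ρ : ℝ) :
    iteratedDeriv (2 * m) (gCoef n m χ 0 0) ρ =
      -((-1) ^ m * (freq n m 0 : ℂ) ^ (2 * m)) * gCoef n m χ 0 0 ρ := by
  rw [iteratedDeriv_gCoef_zero_zero, charRoot_pow hm, gCoef_zero_zero]

/-- The sum over the admissible indices `i`, written with an indicator. -/
lemma sum_Icc_min {N l s : ℕ} (hs : s ≤ 1) (f : ℕ → ℂ) :
    ∑ i ∈ Finset.Icc 1 (min (l + s) N), f i =
      ∑ i ∈ Finset.Icc 1 N, if i - s ≤ l then f i else 0 := by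
  rw [← Finset.sum_filter]
  refine Finset.sum_congr ?_ fun _ _ => rfl
  ext i
  simp only [Finset.mem_Icc, Finset.mem_filter, le_min_iff]
  omega

/-- For `R ≥ 2R₁` the cutoff `χ_ℓ` equals `1` where `ρ > 2R(ℓ+1)`, so the equations hold there
without cutoffs. The shift `i - 1` for `p = 0` reflects that `g_{ℓ,0}` is determined together with
the `𝒫_1` term of its own row. -/
lemma isFormalSol_gCoef (hm : 0 < m) (hχ : IsChiFamily m R₁ χ) (hR₁ : 0 < R₁)
    (hrow : ∀ l, RowEst n m χ R₁ K D l)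
    (hpos : ∀ l p ρ, 0 < p → p ≤ l → iteratedDeriv (2 * m) (gCoef n m χ l p) ρ =
      -((-1) ^ m * (freq n m p : ℂ) ^ (2 * m)) * gCoef n m χ l p ρ
        + (χ l ρ : ℂ) * rhsPos n m (gCoef n m χ) l p ρ)
    (hzero : ∀ l ρ, 0 < l → iteratedDeriv (2 * m) (gCoef n m χ l 0) ρ =
      -((-1) ^ m * (freq n m 0 : ℂ) ^ (2 * m)) * gCoef n m χ l 0 ρ
        + (χ l ρ : ℂ) * rhsZero n m χ (gCoef n m χ) l ρ)
    {R : ℝ} (hR : 2 * R₁ ≤ R) : IsFormalSol n m R K D (gCoef n m χ) where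
  smooth l p := (hrow l).smooth p
  support l p h := gCoef_of_lt n m χ h
  bound l p k ρ hk hρ := by
    have h := (hrow l).bound p (2 * m - k) ρ (Nat.sub_le _ _)
      (le_trans (by gcongr; linarith) hρ)
    rw [Nat.sub_sub_self hk] at h
    exact (le_mul_of_one_le_left (norm_nonneg _) (one_le_pow₀ (one_le_freq n p hm))).trans h
  eqn l p ρ hρ := by
    have hl0 : (0 : ℝ) ≤ l := Nat.cast_nonneg l
    have hχ1 : χ l ρ = 1 := hχ.eq_one l ρ (by nlinarith)
    rcases Nat.eq_zero_or_pos p with rfl | hp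
    · simp only [rowShift, if_true]
      rcases Nat.eq_zero_or_pos l with rfl | hl
      · rw [iteratedDeriv_gCoef_zero hm]
        rw [Finset.sum_eq_zero fun i hi => ?_]
        · ring
        · rw [Finset.mem_Icc] at hi
          split_ifs with h
          -- In row `0` only `i = 1` is admissible for `p = 0`, and by the choice of `rExp` its term
          -- sees only `g_{0,1} = 0`.
          · obtain rfl : i = 1 := by omega
            rw [pAct_one_zero n m hm, gCoef_of_lt n m χ (by omega : 0 - (1 - 1) < 1),
              iteratedDeriv_zero_fun, mul_zero, mul_zero]
          · rfl
      · rw [hzero l ρ hl, hχ1, rhsZero_eq hm, ← sum_Icc_min le_rfl (fun i => ((ρ : ℂ) ^ i)⁻¹ *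
          pAct n m i (fun q => iteratedDeriv (2 * m - i) (gCoef n m χ (l - (i - 1)) q) ρ) 0)]
        rw [← Finset.add_sum_Ioc_eq_sum_Icc (by omega : 1 ≤ min (l + 1) (2 * m)),
          pAct_one_zero n m hm]
        have hIoc : Finset.Ioc 1 (min (l + 1) (2 * m)) = Finset.Icc 2 (min (l + 1) (2 * m)) := rfl
        rw [hIoc, Nat.sub_self, Nat.sub_zero, gCoef_pos n m χ one_pos hl]
        have hsum : ∑ i ∈ Finset.Icc 2 (min (l + 1) (2 * m)), ((ρ : ℂ) ^ i)⁻¹ *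
            pAct n m i (fun q => iteratedDeriv (2 * m - i) (gCoef n m χ (l - (i - 1)) q) ρ) 0 =
            ∑ i ∈ Finset.Icc 2 (min (l + 1) (2 * m)), ((ρ : ℂ) ^ i)⁻¹ *
            pAct n m i (fun q => iteratedDeriv (2 * m - i) (gCoef n m χ (l + 1 - i) q) ρ) 0 := by
          refine Finset.sum_congr rfl fun i hi => ?_
          rw [Finset.mem_Icc] at hi
          rw [show l - (i - 1) = l + 1 - i by omega]
        rw [hsum]
        push_cast
        ring
    · simp only [rowShift, if_neg hp.ne']
      rcases lt_or_ge l p with hlp | hpl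
      · rw [gCoef_of_lt n m χ hlp, iteratedDeriv_zero_fun, Finset.sum_eq_zero fun i hi => ?_]
        · simp
        · split_ifs with h
          · rw [pAct_support n m i (L := l - i) (fun q hq => by
              rw [gCoef_of_lt n m χ hq, iteratedDeriv_zero_fun]) p (by omega), mul_zero]
          · rfl
      · have := sum_Icc_min (N := 2 * m) (l := l) (s := 0) zero_le_one
          (fun i => ((ρ : ℂ) ^ i)⁻¹ * pAct n m i
            (fun q => iteratedDeriv (2 * m - i) (gCoef n m χ (l - i) q) ρ) p)
        simp only [Nat.sub_zero, add_zero] at this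
        rw [hpos l p ρ hp hpl, hχ1, ← this, rhsPos]
        push_cast
        ring

lemma uTilde_eq_amp {ω : ℕ → ℝ → ℝ} {R : ℝ} {N : ℕ} (hW : IsCutoff R N (posPart ω)) (hR : 0 < R)
    (t : ℝ) {ρ : ℝ} (hρ : 0 < ρ) :
    uTilde n m χ ω t ρ = amp n 0 0 (cutSum (posPart ω) (gCoef n m χ)) t ρ := by
  obtain ⟨L, hL⟩ := exists_nat_gt (ρ / (2 * R))
  rw [div_lt_iff₀ (by positivity)] at hL
  have hρL : ρ ≤ 2 * R * (L + 1) := by nlinarith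
  have hω : ∀ l, (ω l ρ : ℂ) = posPart ω l ρ := fun l => (if_pos hρ).symm
  have hz : ∀ l, L ≤ l → posPart ω l ρ = 0 := fun l hl => hW.eq_zero_of_le hR hl hρL
  have hc : ∀ p, cutSum (posPart ω) (gCoef n m χ) p ρ =
      ∑ l ∈ Finset.range L, posPart ω l ρ * gCoef n m χ l p ρ := fun p =>
    cutSum_eq hW hR _ hρL p
  rw [uTilde, tsum_eq_sum (s := Finset.range L) fun l hl => by
    rw [hω, hz l (by simpa using hl), mul_zero],
    amp_eq_sum (N := L) fun p hp => by
      rw [hc]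
      refine Finset.sum_eq_zero fun l hl => ?_
      rw [Finset.mem_range] at hl
      rw [gCoef_of_lt n m χ (by omega), mul_zero]]
  simp only [hc, Finset.sum_mul]
  rw [Finset.sum_comm]
  refine Finset.sum_congr rfl fun l hl => ?_
  rw [Finset.mem_range] at hl
  rw [hω, uTerm, Finset.sum_mul]
  rw [Finset.sum_subset (Finset.range_mono (Nat.succ_le_of_lt hl)) fun p _ hp => by
    rw [gCoef_of_lt n m χ (by simpa using hp), zero_mul, zero_mul]]
  refine Finset.sum_congr rfl fun p _ => ?_
  rw [eigDeriv_zero, pow_zero, one_mul]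
  ring

end FormalSolution

/-! ### The Beurling class -/

/-- This is `x ≤ e^x` at `x = Λρ/Q`, raised to the power `Q`. -/
lemma rpow_le_rpow_self_mul_exp {Λ Q ρ : ℝ} (hΛ : 0 < Λ) (hQ : 0 ≤ Q) (hρ : 0 < ρ) :
    ρ ^ Q ≤ (Q / Λ) ^ Q * Real.exp (Λ * ρ) := by
  rcases hQ.eq_or_lt with rfl | hQ
  · simp only [Real.rpow_zero, one_mul]
    exact Real.one_le_exp (by positivity)
  · have h1 : Λ * ρ / Q ≤ Real.exp (Λ * ρ / Q) := by
      linarith [Real.add_one_le_exp (Λ * ρ / Q)]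
    have h2 : (Λ * ρ / Q) ^ Q ≤ Real.exp (Λ * ρ) := by
      refine (Real.rpow_le_rpow (by positivity) h1 hQ.le).trans_eq ?_
      rw [← Real.exp_mul, div_mul_cancel₀ _ hQ.ne']
    calc ρ ^ Q = (Q / Λ * (Λ * ρ / Q)) ^ Q := by congr 1; field_simp
      _ = (Q / Λ) ^ Q * (Λ * ρ / Q) ^ Q := Real.mul_rpow (by positivity) (by positivity)
      _ ≤ _ := by gcongr

/-- Decay at all rates allows `Λ` to be arbitrarily large with a constant independent of the orders
`A`, `B`. The `A!` of Cauchy's estimate supplies one power of `A`, and the powers of `ρ` supply the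
remaining `(θ-1)A + θB`. -/
lemma Adm.exists_norm_integral_kerFam_le {ρ₀ : ℝ} {a : ℕ → ℝ → ℂ} (hρ₀ : 1 ≤ ρ₀)
    (ha : ∀ δ, 0 < δ → Adm ρ₀ δ a) (n j : ℕ) {m : ℕ} (hm : 0 < m) (q : ℝ) {Λ : ℝ} (hΛ : 0 < Λ) :
    ∃ C : ℝ, 0 ≤ C ∧ ∀ (A B : ℕ) (x y : ℝ),
      ‖∫ ρ in Set.Ioi 0, kerFam n m j q a A B x y ρ‖ ≤ C * (A.factorial *
        (((theta m - 1) * A + theta m * B) / Λ) ^ ((theta m - 1) * A + theta m * B)) := by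
  obtain ⟨Ce, hCe, h⟩ := exists_norm_amp_le n j
  -- The rate is spent as follows: `Ce` on Cauchy's estimate, `Λ` on the powers of `ρ` coming from
  -- derivatives, `1` on `ρ^q`, and `1` is left for integrability.
  obtain ⟨C, hC0, hC⟩ := h (Ce + Λ + 2) a (ha _ (by linarith)).dec
  obtain ⟨C', hC'0, hC'⟩ := exists_rpow_le_exp one_pos one_pos q
  have hθ := theta_gt_one hm
  refine ⟨C' * C, by positivity, fun A B x y => ?_⟩
  set Q := (theta m - 1) * A + theta m * B with hQ
  have hQ0 : 0 ≤ Q := add_nonneg (mul_nonneg (by linarith) (Nat.cast_nonneg A))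
    (mul_nonneg (by linarith) (Nat.cast_nonneg B))
  set T := C' * C * (A.factorial * (Q / Λ) ^ Q) with hT
  have hT0 : 0 ≤ T := by positivity
  have hn : (2 * n + 2 : ℝ) ≠ 0 := by positivity
  have hle : ∀ ρ, 0 < ρ → ‖kerFam n m j q a A B x y ρ‖ ≤ T * Real.exp (-1 * ρ) := by
    intro ρ hρ
    rw [norm_kerFam hρ]
    rcases lt_or_ge ρ 1 with hlt | hge
    · rw [amp_eq_sum (N := 0) fun p _ => (ha 1 one_pos).zero p ρ (by linarith)]
      simp only [Finset.range_zero, Finset.sum_empty, norm_zero, mul_zero]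
      positivity
    -- With this radius `exp(Ce s^(2n+2))` is a plain exponential, and `ρ^(γA)/s^A` is
    -- `ρ^((θ-1)A/(2n+2))`, which is at most `ρ^((θ-1)A)` for `ρ ≥ 1`.
    · set s := ρ ^ (1 / (2 * n + 2) : ℝ) with hs
      have hs0 : 0 < s := Real.rpow_pos_of_pos hρ _
      have hsn : s ^ (2 * n + 2) = ρ := by
        rw [hs, ← Real.rpow_natCast, ← Real.rpow_mul hρ.le]
        push_cast
        rw [one_div_mul_cancel hn, Real.rpow_one]
      have h1 := hC A (ρ ^ gam n m * x) s ρ hs0 hρ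
      rw [hsn] at h1
      have h2 : ρ ^ (theta m * B + q + gam n m * A) / s ^ A ≤ ρ ^ q * ρ ^ Q := by
        rw [hs, ← Real.rpow_natCast (ρ ^ _) A, ← Real.rpow_mul hρ.le, ← Real.rpow_sub hρ,
          ← Real.rpow_add hρ]
        refine Real.rpow_le_rpow_of_exponent_le hge ?_
        have e : gam n m * A - 1 / (2 * n + 2) * A = (theta m - 1) * A / (2 * n + 2) := by
          rw [theta_eq_gam n hm]; field_simp
        have e2 : (theta m - 1) * A / (2 * n + 2) ≤ (theta m - 1) * A :=
          div_le_self (mul_nonneg (by linarith) (Nat.cast_nonneg A))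
            (by linarith [(Nat.cast_nonneg n : (0 : ℝ) ≤ n)])
        rw [hQ]
        linarith
      have h3 := hC' ρ hge
      have h4 := rpow_le_rpow_self_mul_exp hΛ hQ0 hρ
      calc ρ ^ (theta m * B + q + gam n m * A) * ‖amp n j A a (ρ ^ gam n m * x) ρ‖
          ≤ ρ ^ (theta m * B + q + gam n m * A) * (C * Real.exp (-((Ce + Λ + 2) * ρ)) *
            (A.factorial * Real.exp (Ce * ρ) / s ^ A)) := by gcongr
        _ = (ρ ^ (theta m * B + q + gam n m * A) / s ^ A) * (C * Real.exp (-((Ce + Λ + 2) * ρ)) *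
            (A.factorial * Real.exp (Ce * ρ))) := by ring
        _ ≤ ((C' * Real.exp (1 * ρ)) * ((Q / Λ) ^ Q * Real.exp (Λ * ρ))) *
            (C * Real.exp (-((Ce + Λ + 2) * ρ)) * (A.factorial * Real.exp (Ce * ρ))) := by
            refine mul_le_mul_of_nonneg_right (h2.trans ?_) (by positivity)
            exact mul_le_mul h3 h4 (by positivity) (by positivity)
        _ = T * (Real.exp (1 * ρ) * Real.exp (Λ * ρ) * Real.exp (-((Ce + Λ + 2) * ρ)) *
            Real.exp (Ce * ρ)) := by rw [hT]; ring
        _ = T * Real.exp (-1 * ρ) := by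
            rw [← Real.exp_add, ← Real.exp_add, ← Real.exp_add]
            congr 2
            ring
  refine (norm_integral_le_of_norm_le ((exp_neg_integrableOn_Ioi 0 one_pos).const_mul T)
    ((ae_restrict_iff' measurableSet_Ioi).mpr (Eventually.of_forall hle))).trans_eq ?_
  rw [integral_const_mul]
  have : ∫ ρ in Set.Ioi (0 : ℝ), Real.exp (-1 * ρ) = 1 := by
    simpa using integral_exp_neg_Ioi_zero
  rw [this, mul_one]

/-- The exponents add up: `A + (θ-1)A + θB = θ(A+B)`. Since the exponent `(θ-1)A + θB` is at least
`(θ-1)(A+B)` and `θ/Λ ≤ 1`, each derivative gains at least `(θ/Λ)^(θ-1)`. -/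
lemma factorial_mul_rpow_le {θ Λ ε : ℝ} (hθ : 1 < θ) (hΛ : θ ≤ Λ) (hε : (θ / Λ) ^ (θ - 1) ≤ ε)
    (A B : ℕ) :
    (A.factorial : ℝ) * (((θ - 1) * A + θ * B) / Λ) ^ ((θ - 1) * A + θ * B) ≤
      ε ^ (A + B) * ((A + B : ℕ) : ℝ) ^ (θ * ((A + B : ℕ) : ℝ)) := by
  rcases Nat.eq_zero_or_pos (A + B) with h0 | hN
  · obtain ⟨rfl, rfl⟩ : A = 0 ∧ B = 0 := by omega
    simp
  set N : ℝ := ((A + B : ℕ) : ℝ) with hNd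
  have hN1 : 1 ≤ N := by rw [hNd]; exact_mod_cast hN
  have hN0 : 0 < N := by linarith
  have hΛ0 : 0 < Λ := by linarith
  have hB : (0 : ℝ) ≤ B := Nat.cast_nonneg B
  have hA : (0 : ℝ) ≤ A := Nat.cast_nonneg A
  have hNAB : N = A + B := by rw [hNd]; push_cast; ring
  set Q := (θ - 1) * A + θ * B with hQ
  have hQ0 : 0 ≤ Q := add_nonneg (mul_nonneg (by linarith) hA) (mul_nonneg (by linarith) hB)
  have hQ1 : Q ≤ θ * N := by rw [hQ, hNAB]; nlinarith
  have hQ2 : (θ - 1) * N ≤ Q := by rw [hQ, hNAB]; nlinarith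
  have hfac : (A.factorial : ℝ) ≤ N ^ (A : ℝ) := by
    rw [Real.rpow_natCast]
    refine le_trans (by exact_mod_cast Nat.factorial_le_pow A : (A.factorial : ℝ) ≤ (A : ℝ) ^ A) ?_
    exact pow_le_pow_left₀ hA (by rw [hNAB]; linarith) A
  have hr0 : 0 < θ / Λ := by positivity
  have hr1 : θ / Λ ≤ 1 := (div_le_one hΛ0).mpr hΛ
  have hpow : (Q / Λ) ^ Q ≤ ε ^ (A + B) * N ^ Q := by
    calc (Q / Λ) ^ Q ≤ (θ / Λ * N) ^ Q := by
          refine Real.rpow_le_rpow (by positivity) ?_ hQ0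
          rw [div_mul_eq_mul_div]
          gcongr
      _ = (θ / Λ) ^ Q * N ^ Q := Real.mul_rpow hr0.le hN0.le
      _ ≤ (θ / Λ) ^ ((θ - 1) * N) * N ^ Q := by
          gcongr ?_ * _
          exact Real.rpow_le_rpow_of_exponent_ge hr0 hr1 hQ2
      _ = ((θ / Λ) ^ (θ - 1)) ^ (A + B) * N ^ Q := by
          rw [Real.rpow_mul hr0.le, hNd, Real.rpow_natCast]
      _ ≤ _ := by gcongr
  calc (A.factorial : ℝ) * (Q / Λ) ^ Q ≤ N ^ (A : ℝ) * (ε ^ (A + B) * N ^ Q) := by gcongr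
    _ = ε ^ (A + B) * (N ^ (A : ℝ) * N ^ Q) := by ring
    _ = _ := by
      rw [← Real.rpow_add hN0]
      congr 2
      rw [hQ, hNAB]
      ring

lemma Adm.globalBeurling {ρ₀ : ℝ} {a : ℕ → ℝ → ℂ} (hρ₀ : 1 ≤ ρ₀)
    (ha : ∀ δ, 0 < δ → Adm ρ₀ δ a) (n j : ℕ) {m : ℕ} (hm : 0 < m) (q : ℝ) :
    GlobalBeurling (theta m) (fun x y => ∫ ρ in Set.Ioi 0, kerFam n m j q a 0 0 x y ρ) := by
  have hF := (ha 1 one_pos).isDominatedFamily (by linarith) one_pos n m j q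
  have hθ := theta_gt_one hm
  refine ⟨hF.isSmooth 0 0, fun ε hε => ?_⟩
  set μ := min 1 ε
  have hμ0 : 0 < μ := lt_min one_pos hε
  have hμ1 : μ ≤ 1 := min_le_left _ _
  -- With `Λ = θ/z` the gain per derivative is `z^(θ-1) = min(1, ε)`; the truncation at `1` ensures
  -- `Λ ≥ θ`.
  set z := μ ^ (1 / (theta m - 1)) with hz
  have hz0 : 0 < z := Real.rpow_pos_of_pos hμ0 _
  have hz1 : z ≤ 1 := Real.rpow_le_one hμ0.le hμ1 (by
    have : 0 < theta m - 1 := by linarith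
    positivity)
  have hzp : (theta m / (theta m / z)) ^ (theta m - 1) ≤ ε := by
    rw [div_div_cancel₀ (by linarith), hz, ← Real.rpow_mul hμ0.le,
      one_div_mul_cancel (by linarith), Real.rpow_one]
    exact min_le_right _ _
  have hΛ : theta m ≤ theta m / z := le_div_self (by linarith) hz0 hz1
  obtain ⟨C, hC0, hC⟩ := Adm.exists_norm_integral_kerFam_le hρ₀ ha n j hm q
    (Λ := theta m / z) (by linarith)
  refine ⟨C, fun A B x y => ?_⟩
  rw [hF.mixedDeriv_eq]
  refine (hC A B x y).trans ?_
  rw [mul_assoc]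
  exact mul_le_mul_of_nonneg_left (factorial_mul_rpow_le hθ hΛ hzp A B) hC0

end MetivierGen

/-! ### Conclusion of the proof -/

open MetivierGen in
theorem proposition3p1 (n m : ℕ) (hn : 0 < n) (hm : 0 < m) :
    ∃ R₁₀ : ℝ, 0 < R₁₀ ∧ ∀ R₁ : ℝ, R₁₀ ≤ R₁ →
      ∀ χ : ℕ → ℝ → ℝ, MetivierGen.IsChiFamily m R₁ χ →
        ∃ R₀ : ℝ, 0 < R₀ ∧ ∀ R : ℝ, R₀ ≤ R → ∀ σ : ℝ, 1 < σ →
          ∀ ω : ℕ → ℝ → ℝ, MetivierGen.IsOmegaFamily σ R ω →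
            (∀ x y : ℝ, MeasureTheory.IntegrableOn
              (MetivierGen.kernelIntegrand n m (MetivierGen.uTilde n m χ ω) x y)
              (Set.Ioi (0 : ℝ))) ∧
            MetivierGen.IsSmooth (MetivierGen.opK n m (MetivierGen.uTilde n m χ ω)) ∧
            MetivierGen.GlobalBeurling (2 * m / (2 * m - 1))
              (MetivierGen.opM n m
                (MetivierGen.opK n m (MetivierGen.uTilde n m χ ω))) := by
  obtain ⟨η, hη, hη1, hgap, hgapp⟩ := exists_spectral_gap n hm
  -- `R₁ ≥ 1/η` makes the sources start late enough for the spectral gap to absorb the powers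
  -- `ρ^(-ℓ)`; `R ≥ 2R₁` places the cutoffs `ω_ℓ` where `χ_ℓ = 1`; `R ≥ 1` is used in comparing
  -- `ρ^ℓ` with `ℓ!`.
  refine ⟨1 / η, by positivity, fun R₁ hR₁ χ hχ => ⟨max (2 * R₁) 1, by positivity,
    fun R hR σ _ ω hω => ?_⟩⟩
  have hR₁0 : 0 < R₁ := lt_of_lt_of_le (by positivity) hR₁
  have hηR : 1 ≤ η * R₁ := by rwa [div_le_iff₀ hη, mul_comm] at hR₁
  obtain ⟨K, D, hK, hD, hrow, hpos, hzero⟩ := exists_rowEst hm hχ hR₁0 hη hηR hη1 hgap hgapp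
  have hR1 : 1 ≤ R := (le_max_right _ _).trans hR
  have hg := isFormalSol_gCoef hm hχ hR₁0 hrow hpos hzero ((le_max_left _ _).trans hR)
  have hW := hω.isCutoff hR1 (2 * m)
  set a := cutSum (posPart ω) (gCoef n m χ) with ha
  have hadm : ∀ k ≤ 2 * m, Adm (2 * R) (decayRate n m) (fun p => iteratedDeriv k (a p)) :=
    fun k hk => adm_cutSum hg hW hm hR1 (by linarith) hD.le hk
  -- The amplitude `a` decays only at the rate `decayRate`, whereas its residual decays at every
  -- rate: this difference is what places `M 𝒦[ũ]` in the Beurling class.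
  have hres : ∀ δ, 0 < δ → Adm (2 * R) δ
      (fun s ρ => (Complex.I / theta m) ^ (2 * m) * residual n m a s ρ) := fun δ hδ =>
    (adm_residual (by linarith) hadm
      (dec_residual_cutSum hg hW hm hR1 (by linarith) hD.le hδ.le)).smul _
  have ha0 : Adm (2 * R) (decayRate n m) a := by simpa using hadm 0 (Nat.zero_le _)
  have hF := ha0.isDominatedFamily (by linarith) (decayRate_pos n hm) n m 0 (rExp n m)
  have hker : ∀ x y, Set.EqOn (kernelIntegrand n m (uTilde n m χ ω) x y)
      (kerFam n m 0 (rExp n m) a 0 0 x y) (Set.Ioi 0) := fun x y ρ hρ => by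
    rw [kerFam_zero_zero, kernelIntegrand, uTilde_eq_amp hW (by linarith) _ hρ]
  have hK : opK n m (uTilde n m χ ω) =
      fun x y => ∫ ρ in Set.Ioi 0, kerFam n m 0 (rExp n m) a 0 0 x y ρ := by
    funext x y
    exact MeasureTheory.setIntegral_congr_fun measurableSet_Ioi (hker x y)
  refine ⟨fun x y => (MeasureTheory.integrableOn_congr_fun (hker x y) measurableSet_Ioi).mpr
    (hF.integrable 0 0 x y), ?_, ?_⟩
  · rw [hK]
    exact hF.isSmooth 0 0
  · rw [hK, opM_integral_kerFam (by linarith) (decayRate_pos n hm) hm hadm]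
    exact Adm.globalBeurling (by linarith) hres n (2 * n) hm _
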